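/- **Conventions.** A *delta-matroid* $D=(E,\mathcal F)$ is a finite set $E$ with a non-empty family $\mathcal F$ of subsets (the *feasible sets*) such that for all $X,Y\in\mathcal F$ and $u\in X\triangle Y$ there is $v\in X\triangle Y$ (possibly $v=u$) with $X\triangle\{u,v\}\in\mathcal F$. For $A\subseteq E$ the *twist* $D*A$ has feasible sets $X\triangle A$ ($X\in\mathcal F$). For $e\in E$ the *loop complement* $D+e$ has feasible sets $\mathcal F\triangle\{X\cup\{e\}:X\in\mathcal F,\ e\notin X\}$. $D$ is *vf-safe* if every sequence of twists and loop complements applied to $D$ yields a delta-matroid. Write $D\bar*e=((D+e)*\{e\})+e$, and let $D\bar*Z$ be obtained by applying this for each element of $Z$. An element is a *loop* (*coloop*) if it is in no (every) feasible set; $e$ is *singular* if it is a loop, or a coloop, or $F\triangle\{e\}\in\mathcal F$ for all $F\in\mathcal F$. $D\backslash e$ has feasible sets $\{F\in\mathcal F: e\notin F\}$ if $e$ is not a coloop, $D/e$ has feasible sets $\{F-e: e\in F\in\mathcal F\}$ if $e$ is not a loop, and $D\backslash e=D/e$ if $e$ is a loop or a coloop. A *multimatroid* consists of a finite set $U$ partitioned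 into non-empty *skew classes* and a rank function $r$ on *subtransversals* (sets meeting each skew class at most once) that restricts to a matroid rank function on the subsets of each transversal and satisfies $r(S\cup\{x\})+r(S\cup\{y\})-2r(S)\ge 1$ for distinct $x,y$ in a skew class disjoint from the subtransversal $S$. A subtransversal $S$ is *independent* if $r(S)=|S|$; *bases* are the maximal independent subtransversals. It is *tight* if all skew classes have at least two elements and for every near-transversal $S$ (a subtransversal missing exactly one class) there is a unique element $\underline{S}$ (the *slack element*) of the missed class with $r(S\cup\{\underline S\})=r(S)$. For a vf-safe $D=(E,\mathcal F)$, $Z_{[3]}(D)$ is the tight multimatroid with skew classes $\{\dot a<\bar a<\hat a\}$, $a\in E$, whose restriction to the elements $\dot a,\bar a$ has as bases the sets $\omega(X)=\{\dot a:a\in X\}\cup\{\bar a:a\in E\setminus X\}$, $X\in\mathcal F$. Conversely, a tight multimatroid $Z$ with such skew classes gives the delta-matroid $D(Z)$ on $E$ whose feasible sets are the $X$ for which $\omega(X)$ is a basis of that restriction. For non-singular $f$ in $D_1$ and $e$ in $D_2$, with disjoint ground sets, the *2-sum* is $D_1\oplus_{f=e}D_2=D(Z_{[3]}(D_1)\oplus_{f=e}Z_{[3]}(D_2))$.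 Here the 2-sum $Z_1\oplus_{f=e}Z_2$ of multimatroids has as skew classes those of $Z_1$ other than $f$ and those of $Z_2$ other than $e$, and its bases are the transversals $B$ for which $B\cap U_1$ and $B\cap U_2$ are independent near-transversals of $Z_1$ and $Z_2$ whose slack elements are in different positions of the ordered classes $f$ and $e$. If $D_1$ has no singular element and $e$ is a non-singular element of $D_2$, the *tensor product* $D_1\otimes_e D_2$ is formed from $D_1$ by successively taking, for each element $a$ of $D_1$, the 2-sum along $a$ and $e$ with a new copy of $D_2$; the copy of an element $b\neq e$ of $D_2$ in the copy belonging to $a$ is called $b^{(a)}$. Let $d_D(X)=\min_{F\in\mathcal F}|F\triangle X|$. The *multivariate topological transition polynomial* of a vf-safe $D$, in formal variables $t$ and $u_a,v_a,w_a$ ($a\in E$), with integer coefficients, is $$Q(D)=\sum_{(X,Y,Z)}\Big(\prod_{a\in X}u_a\Big)\Big(\prod_{a\in Y}v_a\Big)\Big(\prod_{a\in Z}w_a\Big)\,t^{\,d_{D\bar* Z}(X)},$$ where the sum is over all ordered partitions of $E$ into three (possibly empty) blocks. **Theorem 5.3.** Let $D_1$ be a vf-safe delta-matroid without singular elements, and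 let $D_2$ be a vf-safe delta-matroid with a non-singular element $e$. Then the system of linear equations $$Q(D_2/e)=tp+q+r,\qquad Q(D_2\backslash e)=p+tq+r,\qquad Q((D_2+e)/e)=p+q+tr$$ has a unique solution $(p,q,r)$ in polynomials with integer coefficients, and, for every order in which the 2-sums that make up the tensor product are taken, $$Q(D_1\otimes_e D_2)=\psi(Q(D_1)),$$ where $\psi$ fixes $t$ and substitutes $u_a\mapsto\psi^{(a)}(p)$, $v_a\mapsto\psi^{(a)}(q)$, $w_a\mapsto\psi^{(a)}(r)$ for each element $a$ of $D_1$, and $\psi^{(a)}$ fixes $t$ and substitutes $u_b\mapsto u_{b^{(a)}}$, $v_b\mapsto v_{b^{(a)}}$, $w_b\mapsto w_{b^{(a)}}$. -/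

import Mathlib

/-! ### Multimatroids on carriers with named elements

An element of a carrier is a pair `(a, k)`: `a` is the name of its skew class and `k : Fin 3` is its
state.  The states `0, 1, 2` of the class `a` are the elements written "a with a dot", "a with a bar"
and "a with a hat"; their order is the order of the skew class.
A carrier is given by its finite set `U` of elements; its skew classes are the non-empty sets
`{x ∈ U | x.1 = a}`. -/

/-- A carrier with a function on sets of elements. Only the values of `rank` on subtransversals
are ever used. -/
structure RankSystem (α : Type*) where
  U : Finset (α × Fin 3)
  rank : Finset (α × Fin 3) → ℕ

namespace RankSystem

variable {α : Type*} [DecidableEq α]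

instance : Nonempty (RankSystem α) := ⟨⟨∅, fun _ => 0⟩⟩

/-- The names of the skew classes. -/
def classes (Z : RankSystem α) : Finset α := Z.U.image Prod.fst

/-- The skew class named `a`. -/
def skewClass (Z : RankSystem α) (a : α) : Finset (α × Fin 3) := Z.U.filter fun x => x.1 = a

/-- A set of elements that meets each skew class at most once. -/
def IsSubtransversal (Z : RankSystem α) (S : Finset (α × Fin 3)) : Prop :=
  S ⊆ Z.U ∧ ∀ a ∈ Z.classes, (S ∩ Z.skewClass a).card ≤ 1

def IsTransversal (Z : RankSystem α) (T : Finset (α × Fin 3)) : Prop :=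
  Z.IsSubtransversal T ∧ T.card = Z.classes.card

def IsNearTransversal (Z : RankSystem α) (S : Finset (α × Fin 3)) : Prop :=
  Z.IsSubtransversal S ∧ S.card + 1 = Z.classes.card

/-- The two axioms of a multimatroid. -/
structure IsMultimatroid (Z : RankSystem α) : Prop where
  matroid : ∀ T, Z.IsTransversal T →
    ∃ M : Matroid (α × Fin 3), M.E = (T : Set (α × Fin 3)) ∧
      ∀ A ⊆ T, M.eRk (A : Set (α × Fin 3)) = (Z.rank A : ℕ∞)
  skew_pair : ∀ S, Z.IsSubtransversal S → ∀ a ∈ Z.classes, Disjoint S (Z.skewClass a) →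
    ∀ x ∈ Z.skewClass a, ∀ y ∈ Z.skewClass a, x ≠ y →
      2 * Z.rank S + 1 ≤ Z.rank (insert x S) + Z.rank (insert y S)

/-- A subtransversal of nullity zero. -/
def IsIndep (Z : RankSystem α) (S : Finset (α × Fin 3)) : Prop :=
  Z.IsSubtransversal S ∧ Z.rank S = S.card

/-- A maximal independent subtransversal. -/
def IsBasis (Z : RankSystem α) (B : Finset (α × Fin 3)) : Prop :=
  Maximal Z.IsIndep B

/-- `x` lies in the skew class missed by the near-transversal `S`, and adding it to `S` does not
change the rank. -/
def IsSlack (Z : RankSystem α) (S : Finset (α × Fin 3)) (x : α × Fin 3) : Prop :=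
  x ∈ Z.U ∧ Disjoint S (Z.skewClass x.1) ∧ Z.rank (insert x S) = Z.rank S

/-- A tight multimatroid: every skew class has at least two elements, and every near-transversal has
a unique slack element. -/
structure IsTight (Z : RankSystem α) : Prop where
  isMultimatroid : Z.IsMultimatroid
  nondegenerate : ∀ a ∈ Z.classes, 2 ≤ (Z.skewClass a).card
  existsUnique_slack : ∀ S, Z.IsNearTransversal S → ∃! x, Z.IsSlack S x

/-- `Z[A]`. -/
def restrict (Z : RankSystem α) (A : Finset (α × Fin 3)) : RankSystem α :=
  ⟨Z.U ∩ A, Z.rank⟩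

/-- The rank system on the carrier `U` with the collection `𝓑` of bases:
the rank of `S` is the maximum of `|B ∩ S|` over `B ∈ 𝓑`. -/
noncomputable def ofBases (U : Finset (α × Fin 3)) (𝓑 : Set (Finset (α × Fin 3))) :
    RankSystem α :=
  ⟨U, fun S => sSup ((fun B => (B ∩ S).card) '' 𝓑)⟩

/-- The carrier of the 2-sum: all elements of `Z₁` and `Z₂`, except those of the class `f` of `Z₁`
and of the class `e` of `Z₂`. -/
def twoSumCarrier (Z₁ Z₂ : RankSystem α) (f e : α) : Finset (α × Fin 3) :=
  (Z₁.U ∪ Z₂.U) \ (Z₁.skewClass f ∪ Z₂.skewClass e)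

/-- The bases of the 2-sum of `Z₁` and `Z₂` along `f` and `e`: the transversals `B` such that
`B ∩ U₁` and `B ∩ U₂` are independent near-transversals whose slack elements are `f_i` and `e_j`
with `i ≠ j`. -/
def twoSumBases (Z₁ Z₂ : RankSystem α) (f e : α) : Set (Finset (α × Fin 3)) :=
  {B | IsTransversal ⟨twoSumCarrier Z₁ Z₂ f e, fun _ => 0⟩ B ∧
    Z₁.IsNearTransversal (B ∩ Z₁.U) ∧ Z₁.IsIndep (B ∩ Z₁.U) ∧
    Z₂.IsNearTransversal (B ∩ Z₂.U) ∧ Z₂.IsIndep (B ∩ Z₂.U) ∧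
    ∃ i j : Fin 3, i ≠ j ∧ Z₁.IsSlack (B ∩ Z₁.U) (f, i) ∧ Z₂.IsSlack (B ∩ Z₂.U) (e, j)}

/-- The 2-sum of `Z₁` and `Z₂` along `f` and `e`. -/
noncomputable def twoSum (Z₁ Z₂ : RankSystem α) (f e : α) : RankSystem α :=
  ofBases (twoSumCarrier Z₁ Z₂ f e) (twoSumBases Z₁ Z₂ f e)

end RankSystem

/-! ### Delta-matroids -/

/-- A finite ground set with a collection of sets. -/
structure SetFamily (α : Type*) where
  ground : Finset α
  feasible : Set (Finset α)

namespace SetFamily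

variable {α : Type*} [DecidableEq α]

/-- Delta-matroids: non-empty families of subsets of the ground set with the symmetric exchange
axiom. -/
structure IsDeltaMatroid (D : SetFamily α) : Prop where
  nonempty : D.feasible.Nonempty
  subset_ground : ∀ F ∈ D.feasible, F ⊆ D.ground
  exchange : ∀ X ∈ D.feasible, ∀ Y ∈ D.feasible, ∀ u ∈ symmDiff X Y,
    ∃ v ∈ symmDiff X Y, symmDiff X {u, v} ∈ D.feasible

/-- `e` belongs to every feasible set. -/
def IsColoop (D : SetFamily α) (e : α) : Prop := ∀ F ∈ D.feasible, e ∈ F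

/-- `e` belongs to no feasible set. -/
def IsLoop (D : SetFamily α) (e : α) : Prop := ∀ F ∈ D.feasible, e ∉ F

/-- An element of a delta-matroid is singular if it is a coloop, or a loop, or if `F ∆ {e}` is
feasible for every feasible set `F`. -/
def IsSingular (D : SetFamily α) (e : α) : Prop :=
  D.IsColoop e ∨ D.IsLoop e ∨ ∀ F ∈ D.feasible, symmDiff F {e} ∈ D.feasible

open Classical in
/-- Deletion `D \ e`; it equals `D / e` if `e` is a coloop. -/
noncomputable def delete (D : SetFamily α) (e : α) : SetFamily α where
  ground := D.ground.erase e
  feasible := if D.IsColoop e then {G | ∃ F ∈ D.feasible, e ∈ F ∧ G = F.erase e}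
    else {G | G ∈ D.feasible ∧ e ∉ G}

open Classical in
/-- Contraction `D / e`; it equals `D \ e` if `e` is a loop. -/
noncomputable def contract (D : SetFamily α) (e : α) : SetFamily α where
  ground := D.ground.erase e
  feasible := if D.IsLoop e then {G | G ∈ D.feasible ∧ e ∉ G}
    else {G | ∃ F ∈ D.feasible, e ∈ F ∧ G = F.erase e}

/-- The twist `D * A`. -/
def twist (D : SetFamily α) (A : Finset α) : SetFamily α where
  ground := D.ground
  feasible := {G | ∃ X ∈ D.feasible, G = symmDiff X A}

/-- The loop complement `D + e`. -/
def loopCompl (D : SetFamily α) (e : α) : SetFamily α where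
  ground := D.ground
  feasible := symmDiff D.feasible {G | ∃ X ∈ D.feasible, e ∉ X ∧ G = insert e X}

/-- `D'` arises from `D` by a sequence of twists and loop complements. -/
inductive VfReachable (D : SetFamily α) : SetFamily α → Prop
  | refl : VfReachable D D
  | twist {D' : SetFamily α} (A : Finset α) (hA : A ⊆ D'.ground) :
      VfReachable D D' → VfReachable D (D'.twist A)
  | loopCompl {D' : SetFamily α} (e : α) (he : e ∈ D'.ground) :
      VfReachable D D' → VfReachable D (D'.loopCompl e)

/-- Vf-safe delta-matroids. -/
def IsVfSafe (D : SetFamily α) : Prop := ∀ D', D.VfReachable D' → D'.IsDeltaMatroid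

/-- The dual pivot of `D` at `e`, that is `D + e * e + e`. -/
def dualPivot (D : SetFamily α) (e : α) : SetFamily α :=
  ((D.loopCompl e).twist {e}).loopCompl e

/-- The dual pivot of `D` by a set `A`: the dual pivots at the elements of `A`, one after the
other (dual pivots at distinct elements commute). -/
noncomputable def dualPivotSet (D : SetFamily α) (A : Finset α) : SetFamily α :=
  A.toList.foldl dualPivot D

/-- The distance `d_D(X)`: the minimum of `|F ∆ X|` over the feasible sets `F`. -/
noncomputable def dist (D : SetFamily α) (X : Finset α) : ℕ :=
  sInf ((fun F => (symmDiff F X).card) '' D.feasible)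

/-! ### Passing between delta-matroids and multimatroids -/

/-- The transversal `ω(X)` of the carrier indexed by `E`: dotted elements for the members of `X`,
barred elements for the other members of `E`. -/
def omega (E X : Finset α) : Finset (α × Fin 3) :=
  E.image fun a => (a, if a ∈ X then (0 : Fin 3) else 1)

/-- The elements of the carrier indexed by `E` that are dotted or barred. -/
def dotBar (E : Finset α) : Finset (α × Fin 3) := E ×ˢ ({0, 1} : Finset (Fin 3))

/-- The 2-matroid `Z_[2](D)`, with collection of bases `{ω(X) : X ∈ 𝓕}`. -/
noncomputable def Z2 (D : SetFamily α) : RankSystem α :=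
  RankSystem.ofBases (dotBar D.ground) {B | ∃ X ∈ D.feasible, B = omega D.ground X}

/-- `Z` is a tight 3-matroid indexed by the ground set of `D`, and its restriction to the dotted and
barred elements is `Z_[2](D)`: it has the same carrier and the same bases. -/
def IsZ3 (D : SetFamily α) (Z : RankSystem α) : Prop :=
  Z.U = D.ground ×ˢ (Finset.univ : Finset (Fin 3)) ∧ Z.IsTight ∧
    (Z.restrict (dotBar D.ground)).U = D.Z2.U ∧
    ∀ B, (Z.restrict (dotBar D.ground)).IsBasis B ↔ D.Z2.IsBasis B

/-- The tight 3-matroid `Z_[3](D)` of a vf-safe delta-matroid. -/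
noncomputable def Z3 (D : SetFamily α) : RankSystem α := Classical.epsilon D.IsZ3

/-- The delta-matroid `D(Z)` of a tight 3-matroid: `X` is feasible if `ω(X)` is a basis of the
restriction of `Z` to the dotted and barred elements. -/
def ofZ3 (Z : RankSystem α) : SetFamily α where
  ground := Z.classes
  feasible := {X | X ⊆ Z.classes ∧ (Z.restrict (dotBar Z.classes)).IsBasis (omega Z.classes X)}

/-- The 2-sum of `D₁` and `D₂` (with disjoint ground sets) along `f` and `e`. -/
noncomputable def twoSum (D₁ D₂ : SetFamily α) (f e : α) : SetFamily α :=
  ofZ3 (D₁.Z3.twoSum D₂.Z3 f e)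

/-- The image of `D` under a renaming of elements. -/
def map {β : Type*} (D : SetFamily α) (g : α ↪ β) : SetFamily β where
  ground := D.ground.map g
  feasible := {G | ∃ F ∈ D.feasible, G = F.map g}

/-! ### The tensor product

The elements of `D₁` are renamed `Sum.inl a`; the copy `b^(a)` of the element `b` of `D₂` in the copy
of `D₂` that belongs to the element `a` of `D₁` is `Sum.inr (a, b)`. -/

/-- The renaming `b ↦ b^(a)`. -/
def copyName {α β : Type*} (a : α) : β ↪ α ⊕ α × β :=
  ⟨fun b => Sum.inr (a, b), fun _ _ h => (Prod.mk.inj (Sum.inr.inj h)).2⟩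

/-- The tensor product of `D₁` and `D₂` at `e`: starting from `D₁`, form the 2-sum with the copy of
`D₂` that belongs to `a`, along `a` and the copy of `e`, for every `a` in the list `l`, in the order
of the list.  Here `l` enumerates the ground set of `D₁`.  The ground set of the result is the set
of the `b^(a)` with `a` in the ground set of `D₁`, and `b ≠ e` in the ground set of `D₂`. -/
noncomputable def tensor {β : Type*} [DecidableEq β] (D₁ : SetFamily α) (D₂ : SetFamily β) (e : β)
    (l : List α) : SetFamily (α ⊕ α × β) :=
  l.foldl (fun D a => D.twoSum (D₂.map (copyName a)) (Sum.inl a) (copyName a e))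
    (D₁.map Function.Embedding.inl)

end SetFamily

/-! ### The multivariate topological transition polynomial -/

/-- The formal variables: `u_a`, `v_a`, `w_a` for every name `a`, and `t`. -/
inductive TVar (α : Type*)
  | u (a : α)
  | v (a : α)
  | w (a : α)
  | t

/-- Renaming of the variables `u_b`, `v_b`, `w_b`; `t` is kept. -/
def TVar.map {α β : Type*} (g : α → β) : TVar α → TVar β
  | .u a => .u (g a)
  | .v a => .v (g a)
  | .w a => .w (g a)
  | .t => .t

/-- Polynomials with integer coefficients in these variables. -/
abbrev TPoly (α : Type*) := MvPolynomial (TVar α) ℤ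

/-- The ordered partitions of `E` into three (possibly empty) blocks. -/
def orderedTripartitions {α : Type*} [DecidableEq α] (E : Finset α) :
    Finset (Finset α × Finset α × Finset α) :=
  (E.powerset ×ˢ E.powerset ×ˢ E.powerset).filter fun P =>
    Disjoint P.1 P.2.1 ∧ Disjoint P.1 P.2.2 ∧ Disjoint P.2.1 P.2.2 ∧ P.1 ∪ P.2.1 ∪ P.2.2 = E

/-- The multivariate topological transition polynomial. -/
noncomputable def SetFamily.Q {α : Type*} [DecidableEq α] (D : SetFamily α) : TPoly α :=
  ∑ P ∈ orderedTripartitions D.ground,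
    (∏ a ∈ P.1, MvPolynomial.X (TVar.u a)) * (∏ a ∈ P.2.1, MvPolynomial.X (TVar.v a)) *
      (∏ a ∈ P.2.2, MvPolynomial.X (TVar.w a)) *
      MvPolynomial.X TVar.t ^ (D.dualPivotSet P.2.2).dist P.1

/-- The substitution `ψ^(a)`: `u_b ↦ u_{b^(a)}`, `v_b ↦ v_{b^(a)}`, `w_b ↦ w_{b^(a)}`. -/
noncomputable def psiCopy {α β : Type*} (a : α) : TPoly β →ₐ[ℤ] TPoly (α ⊕ α × β) :=
  MvPolynomial.rename (TVar.map (SetFamily.copyName a))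

/-- The substitution `ψ`: `u_a ↦ ψ^(a)(p)`, `v_a ↦ ψ^(a)(q)`, `w_a ↦ ψ^(a)(r)`. -/
noncomputable def psi {α β : Type*} (p q r : TPoly β) : TPoly α →ₐ[ℤ] TPoly (α ⊕ α × β) :=
  MvPolynomial.aeval fun
    | .u a => psiCopy a p
    | .v a => psiCopy a q
    | .w a => psiCopy a r
    | .t => MvPolynomial.X TVar.t

/-- The system of three linear equations for `p`, `q`, `r`. -/
def TransitionSystem {β : Type*} [DecidableEq β] (D : SetFamily β) (e : β) (p q r : TPoly β) :
    Prop :=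
  (D.contract e).Q = MvPolynomial.X TVar.t * p + q + r ∧
  (D.delete e).Q = p + MvPolynomial.X TVar.t * q + r ∧
  ((D.loopCompl e).contract e).Q = p + q + MvPolynomial.X TVar.t * r

/-! A vf-safe delta-matroid on `E` is encoded by a nullity function `n` on the states `φ : E → {0,
1, 2}` (dot, bar, hat). Tightness says that on every line, where one coordinate varies, the values
of `n` are `m`, `m`, `m + 1` in some order: the base value is `m`, the slack position is where `m +
1` occurs. The feasible sets are the zeros of `n` without hats. Minors, 2-sums and the exponents of
`t` can all be read off from `n`.

Existence of `n`: the parity predicate `OddState` extends feasibility to all states so that each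
line carries an even number of solutions. Twists and loop complements permute the three positions at
an element, so vf-safety gives symmetric exchange for this predicate, and the distance to its
solutions is tight (`isTightOn_distNullity`). A tight function is determined by its hat-free zeros,
because the zeros on a line number none or two and a non-zero value can be lowered by one coordinate
change. Hence `n` is the nullity of every candidate for `Z_[3](D)` (`HasNullity.nullity_eq`). That a
candidate exists follows by building a multimatroid from `n` (`isTight_ofNullity`). The exponents in
`Q` are values of `n`, so `Q(D)` is the weighted sum of `t ^ n φ` over all states
(`HasNullity.Q_eq`).

For the 2-sum along `f` and `e`, the nullity of `φ` is the base value of `n₂` on its line through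
`e`, plus `n₁` with the slack position of that line put at `f` (`HasNullity.twoSum`). Let `slackPoly
k` collect the terms of `D₂` over the states off `e` whose slack position is `k`. Grouping the sum
for the 2-sum by `k` shows that its polynomial is `Q(D₁)` with the variables at `f` replaced by
these three polynomials (`HasNullity.Q_twoSum`). Fixing the state of `e` multiplies exactly the
matching one of them by `t`, which is the linear system; so `p`, `q`, `r` are the slack polynomials,
with integer coefficients by construction. The coefficient matrix has determinant `(t - 1)² (t + 2)
≠ 0`, hence uniqueness. Iterating over the elements of `D₁` gives the theorem: the substitutions
involve disjoint variables, so their order is immaterial. -/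

open Function

/-! ### Tight functions on three-valued states -/

section TightNullity

variable {α : Type*} [DecidableEq α]

/-- A function on the states of `E` such that the three values on every line are `m, m, m + 1`
in some order. -/
structure IsTightOn (E : Finset α) (n : (α → Fin 3) → ℕ) : Prop where
  congr : ∀ φ ψ : α → Fin 3, (∀ a ∈ E, φ a = ψ a) → n φ = n ψ
  line : ∀ φ, ∀ a ∈ E, ∃ m k, ∀ j, n (update φ a j) = m + if j = k then 1 else 0

namespace IsTightOn

variable {E : Finset α} {n : (α → Fin 3) → ℕ}

theorem line_cases (h : IsTightOn E n) (φ : α → Fin 3) {a : α} (ha : a ∈ E) :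
    ∃ m k, n φ = (m + if φ a = k then 1 else 0) ∧
      ∀ j, n (update φ a j) = m + if j = k then 1 else 0 := by
  obtain ⟨m, k, hk⟩ := h.line φ a ha
  refine ⟨m, k, ?_, hk⟩
  have := hk (φ a)
  rwa [update_eq_self] at this

theorem le_update_add_one (h : IsTightOn E n) (φ : α → Fin 3) {a : α} (ha : a ∈ E) (j : Fin 3) :
    n φ ≤ n (update φ a j) + 1 := by
  obtain ⟨m, k, h0, hk⟩ := h.line_cases φ ha
  rw [h0, hk]
  split_ifs <;> omega

theorem update_le_add_one (h : IsTightOn E n) (φ : α → Fin 3) {a : α} (ha : a ∈ E) (j : Fin 3) :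
    n (update φ a j) ≤ n φ + 1 := by
  obtain ⟨m, k, h0, hk⟩ := h.line_cases φ ha
  rw [h0, hk]
  split_ifs <;> omega

/-- A local minimum along the coordinates in `W` is a global minimum among the states that agree
with it outside `W`. -/
theorem le_of_local_min (h : IsTightOn E n) {W : Finset α} (φ : α → Fin 3)
    (hloc : ∀ a ∈ W, ∀ j, n φ ≤ n (update φ a j)) (ψ : α → Fin 3)
    (hψ : ∀ a ∈ E, a ∉ W → ψ a = φ a) : n φ ≤ n ψ := by
  induction hd : (E.filter fun a => ψ a ≠ φ a).card using Nat.strong_induction_on generalizing ψ with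
  | _ d ih =>
  by_contra! hlt
  set K := E.filter fun a => ψ a ≠ φ a with hK
  have hKE : ∀ a ∈ K, a ∈ E := fun a ha => (Finset.mem_filter.1 ha).1
  have hKW : ∀ a ∈ K, a ∈ W := fun a ha => by
    by_contra hc
    exact (Finset.mem_filter.1 ha).2 (hψ a (hKE a ha) hc)
  have hψK : ∀ a ∈ E, a ∉ K → ψ a = φ a := fun a ha hc => by
    by_contra hne
    exact hc (Finset.mem_filter.2 ⟨ha, hne⟩)
  -- By minimality of the counterexample `ψ`, states inside the box on `K` that recover a value of
  -- `φ` cannot lie below `φ`.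
  have closer : ∀ χ : α → Fin 3, (∀ a ∈ E, a ∉ K → χ a = φ a) → (∃ a ∈ K, χ a = φ a) →
      n φ ≤ n χ := by
    rintro χ hχ ⟨a, haK, ha⟩
    refine ih _ ?_ χ (fun b hb hbW => hχ b hb fun hbK => hbW (hKW b hbK)) rfl
    rw [← hd]
    refine Finset.card_lt_card ⟨fun b hb => ?_, fun hs => ?_⟩
    · by_contra hbK
      exact (Finset.mem_filter.1 hb).2 (hχ b (Finset.mem_filter.1 hb).1 hbK)
    · exact (Finset.mem_filter.1 (hs haK)).2 ha
  -- All states that avoid `φ` throughout `K` lie below `φ`, like `ψ`. Coordinates are changed one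
  -- by one: on the line in direction `a` the position `φ a` has a value at least `n φ` and another
  -- position a smaller one, so `φ a` is the exceptional position and both others share the small
  -- value.
  have step0 : ∀ J ⊆ K, ∀ χ : α → Fin 3, (∀ a ∈ E, a ∉ K → χ a = φ a) →
      (∀ a ∈ K, χ a ≠ φ a) → (∀ a ∈ K, a ∉ J → χ a = ψ a) → n χ < n φ := by
    intro J
    induction J using Finset.induction_on with
    | empty =>
      intro _ χ h1 _ h3
      rwa [h.congr χ ψ fun a ha => ?_]
      by_cases hc : a ∈ K
      · exact h3 a hc (Finset.notMem_empty a)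
      · rw [h1 a ha hc, hψK a ha hc]
    | insert a J haJ ihJ =>
      intro hJ χ h1 h2 h3
      have haK : a ∈ K := hJ (Finset.mem_insert_self a J)
      have e1 : n (update χ a (ψ a)) < n φ := by
        refine ihJ (fun b hb => hJ (Finset.mem_insert_of_mem hb)) _ (fun b hb hbK => ?_)
          (fun b hbK => ?_) fun b hbK hbJ => ?_
        · rw [update_of_ne (ne_of_mem_of_not_mem haK hbK).symm]
          exact h1 b hb hbK
        · by_cases hba : b = a
          · subst hba
            simpa using (Finset.mem_filter.1 haK).2
          · rw [update_of_ne hba]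
            exact h2 b hbK
        · by_cases hba : b = a
          · subst hba
            simp
          · rw [update_of_ne hba]
            exact h3 b hbK (by simp [hba, hbJ])
      have e2 : n φ ≤ n (update χ a (φ a)) := by
        refine closer _ (fun b hb hbK => ?_) ⟨a, haK, by simp⟩
        rw [update_of_ne (ne_of_mem_of_not_mem haK hbK).symm]
        exact h1 b hb hbK
      obtain ⟨m, k, h0, hk⟩ := h.line_cases χ (hKE a haK)
      rw [hk] at e1 e2
      have hφ : φ a = k := by
        by_contra hne
        rw [if_neg hne] at e2
        split_ifs at e1 <;> omega
      rw [if_pos hφ] at e2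
      rw [h0, if_neg (hφ ▸ h2 a haK)]
      split_ifs at e1 <;> omega
  -- The value depends only on how many coordinates of `K` agree with `φ`, and is `n φ - 1` plus
  -- that number: on a line whose two positions other than `φ a` have equal values, these are the
  -- base and `φ a` is one higher.
  have stepJ : ∀ J ⊆ K, ∀ χ : α → Fin 3, (∀ a ∈ E, a ∉ K → χ a = φ a) →
      (∀ a ∈ K, a ∉ J → χ a ≠ φ a) → (∀ a ∈ J, χ a = φ a) → n χ + 1 = n φ + J.card := by
    intro J
    induction J using Finset.induction_on with
    | empty =>
      intro _ χ h1 h2 _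
      have hKne : K.Nonempty := by
        rw [Finset.nonempty_iff_ne_empty]
        intro hKe
        rw [h.congr ψ φ fun a ha => hψK a ha (by simp [hKe])] at hlt
        exact lt_irrefl _ hlt
      obtain ⟨a, haK⟩ := hKne
      have e1 := step0 K subset_rfl χ h1 (fun b hb => h2 b hb (Finset.notMem_empty b))
        fun b hb hb' => absurd hb hb'
      have e2 : n φ ≤ n (update χ a (φ a)) := by
        refine closer _ (fun b hb hbK => ?_) ⟨a, haK, by simp⟩
        rw [update_of_ne (ne_of_mem_of_not_mem haK hbK).symm]
        exact h1 b hb hbK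
      have e3 := h.update_le_add_one χ (hKE a haK) (φ a)
      simp only [Finset.card_empty]
      omega
    | insert a J haJ ihJ =>
      intro hJ χ h1 h2 h3
      have haK : a ∈ K := hJ (Finset.mem_insert_self a J)
      have hχa : χ a = φ a := h3 a (Finset.mem_insert_self a J)
      have key : ∀ j, j ≠ φ a → n (update χ a j) + 1 = n φ + J.card := by
        intro j hj
        refine ihJ (fun b hb => hJ (Finset.mem_insert_of_mem hb)) _ (fun b hb hbK => ?_)
          (fun b hbK hbJ => ?_) fun b hbJ => ?_
        · rw [update_of_ne (ne_of_mem_of_not_mem haK hbK).symm]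
          exact h1 b hb hbK
        · by_cases hba : b = a
          · subst hba
            simpa using hj
          · rw [update_of_ne hba]
            exact h2 b hbK (by simp [hba, hbJ])
        · rw [update_of_ne (ne_of_mem_of_not_mem hbJ haJ)]
          exact h3 b (Finset.mem_insert_of_mem hbJ)
      obtain ⟨m, k, h0, hk⟩ := h.line_cases χ (hKE a haK)
      rw [Finset.card_insert_of_notMem haJ, h0, hχa]
      have k1 := key (φ a + 1) (by generalize φ a = x; revert x; decide)
      have k2 := key (φ a + 2) (by generalize φ a = x; revert x; decide)
      rw [hk] at k1 k2
      have : φ a + 1 ≠ φ a + 2 := by generalize φ a = x; revert x; decide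
      have hor : φ a = k ∨ φ a + 1 = k ∨ φ a + 2 = k := by
        generalize φ a = x; clear * -; revert x k; decide
      split_ifs at k1 k2 ⊢ <;> omega
  -- With all of `K` agreeing, the state is `φ` itself, which forces `|K| = 1`; then `ψ` is a
  -- neighbour of `φ`, against local minimality.
  have hfin := stepJ K subset_rfl φ (fun _ _ _ => rfl) (fun a ha hc => absurd ha hc)
    fun _ _ => rfl
  have hcard : K.card = 1 := by omega
  obtain ⟨a, ha⟩ := Finset.card_eq_one.1 hcard
  have haK : a ∈ K := by simp [ha]
  have := hloc a (hKW a haK) (ψ a)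
  rw [h.congr (update φ a (ψ a)) ψ fun b hb => ?_] at this
  · omega
  · by_cases hba : b = a
    · subst hba
      simp
    · rw [update_of_ne hba, hψK b hb (by simp [ha, hba])]

/-- From a state of positive nullity one can descend by changing a single coordinate arbitrarily. -/
theorem exists_descent (h : IsTightOn E n) (h0 : ∃ φ, n φ = 0) (φ : α → Fin 3) (hφ : n φ ≠ 0) :
    ∃ a ∈ E, ∀ j, j ≠ φ a → n (update φ a j) + 1 = n φ := by
  by_contra! hc
  obtain ⟨ψ, hψ⟩ := h0
  -- If no coordinate allows a descent, `φ` is nowhere in the slack position of its line, so it is a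
  -- local and hence a global minimum, which is zero.
  refine hφ (Nat.le_zero.1 (hψ ▸ h.le_of_local_min (W := E) φ (fun a ha j => ?_) ψ
    fun a ha ha' => absurd ha ha'))
  obtain ⟨i, hi, hi'⟩ := hc a ha
  obtain ⟨m, k, e0, hk⟩ := h.line_cases φ ha
  rw [hk] at hi'
  rw [hk, e0]
  rw [e0] at hi'
  split_ifs at hi' ⊢ <;> omega

theorem le_add_card (h : IsTightOn E n) (φ ψ : α → Fin 3) (J : Finset α) (hJ : J ⊆ E)
    (hφ : ∀ a ∈ E, a ∉ J → φ a = ψ a) : n φ ≤ n ψ + J.card := by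
  induction J using Finset.induction_on generalizing φ with
  | empty => rw [h.congr φ ψ fun a ha => hφ a ha (Finset.notMem_empty a)]; exact Nat.le_add_right _ _
  | insert a J haJ ih =>
    have haE : a ∈ E := hJ (Finset.mem_insert_self a J)
    have e1 := ih (update φ a (ψ a)) (fun b hb => hJ (Finset.mem_insert_of_mem hb)) fun b hb hbJ => by
      by_cases hba : b = a
      · subst hba; simp
      · rw [update_of_ne hba]; exact hφ b hb (by simp [hba, hbJ])
    have e2 := h.le_update_add_one φ haE (ψ a)
    rw [Finset.card_insert_of_notMem haJ]
    omega

/-- The zeros on a line: none or exactly two. -/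
theorem zero_iff_xor (h : IsTightOn E n) (φ : α → Fin 3) {a : α} (ha : a ∈ E) {i j k : Fin 3}
    (hij : i ≠ j) (hik : i ≠ k) (hjk : j ≠ k) :
    n (update φ a k) = 0 ↔ Xor (n (update φ a i) = 0) (n (update φ a j) = 0) := by
  obtain ⟨m, s, hs⟩ := h.line φ a ha
  simp only [hs, Nat.add_eq_zero_iff, ite_eq_right_iff, one_ne_zero, imp_false, Xor]
  have : s = i ∨ s = j ∨ s = k := by clear hs; revert i j k s; decide
  rcases this with rfl | rfl | rfl <;> by_cases hm : m = 0 <;>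
    simp [hm, hij, hik, hjk, hij.symm, hik.symm, hjk.symm]

/-- Two tight functions with the same zeros among the states without hats have the same zeros. -/
theorem zero_iff_of_dotBar {n' : (α → Fin 3) → ℕ} (h : IsTightOn E n) (h' : IsTightOn E n')
    (hz : ∀ φ : α → Fin 3, (∀ a ∈ E, φ a ≠ 2) → (n φ = 0 ↔ n' φ = 0)) (φ : α → Fin 3) :
    n φ = 0 ↔ n' φ = 0 := by
  induction hd : (E.filter fun a => φ a = 2).card using Nat.strong_induction_on generalizing φ with
  | _ d ih =>
  by_cases hφ : ∀ a ∈ E, φ a ≠ 2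
  · exact hz φ hφ
  push Not at hφ
  obtain ⟨a, ha, hφa⟩ := hφ
  have hlt : ∀ j : Fin 3, j ≠ 2 → (E.filter fun b => update φ a j b = 2).card < d := by
    intro j hj
    rw [← hd]
    refine Finset.card_lt_card ⟨fun b hb => ?_, fun hs => ?_⟩
    · rw [Finset.mem_filter] at hb ⊢
      by_cases hba : b = a
      · subst hba; exact ⟨ha, hφa⟩
      · rw [update_of_ne hba] at hb; exact hb
    · have := (Finset.mem_filter.1 (hs (Finset.mem_filter.2 ⟨ha, hφa⟩))).2
      simp at this
      exact hj this
  have e := update_eq_self a φ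
  rw [hφa] at e
  rw [← e, h.zero_iff_xor φ ha (i := 0) (j := 1) (by decide) (by decide) (by decide),
    h'.zero_iff_xor φ ha (i := 0) (j := 1) (by decide) (by decide) (by decide),
    ih _ (hlt 0 (by decide)) _ rfl, ih _ (hlt 1 (by decide)) _ rfl]

/-- A descent lowers `n'` by one while `n` falls by at most one, so the inequality at a zero of `n'`
propagates back. Applied both ways, it shows that a tight function attaining zero is determined by
its zeros. -/
theorem le_of_zero_imp {n' : (α → Fin 3) → ℕ} (h : IsTightOn E n) (h' : IsTightOn E n')
    (h0' : ∃ φ, n' φ = 0) (hz : ∀ φ, n' φ = 0 → n φ = 0) (φ : α → Fin 3) : n φ ≤ n' φ := by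
  induction hd : n' φ generalizing φ with
  | zero => exact (hz φ hd).le
  | succ d ih =>
    obtain ⟨a, ha, hj⟩ := h'.exists_descent h0' φ (by omega)
    have hne : φ a + 1 ≠ φ a := by generalize φ a = x; revert x; decide
    have e1 := ih (update φ a (φ a + 1)) (by have := hj _ hne; omega)
    have e2 := h.le_update_add_one φ ha (φ a + 1)
    omega

/-- A zero of a tight function can be freed of hats, keeping the other coordinates. -/
theorem exists_zero_dotBar (h : IsTightOn E n) (S : Finset α) (hS : S ⊆ E) (φ : α → Fin 3)
    (hφ : n φ = 0) :
    ∃ ψ : α → Fin 3, n ψ = 0 ∧ (∀ a ∈ S, ψ a ≠ 2) ∧ (∀ a, a ∉ S ∨ φ a ≠ 2 → ψ a = φ a) := by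
  induction S using Finset.induction_on with
  | empty => exact ⟨φ, hφ, by simp, fun _ _ => rfl⟩
  | insert a S haS ih =>
    obtain ⟨ψ, h0, h1, h2⟩ := ih fun b hb => hS (Finset.mem_insert_of_mem hb)
    have haE : a ∈ E := hS (Finset.mem_insert_self a S)
    by_cases hψa : ψ a = 2
    · have hxor := h.zero_iff_xor ψ haE (i := 0) (j := 1) (k := 2)
        (by decide) (by decide) (by decide)
      have e := update_eq_self a ψ
      rw [hψa] at e
      rw [e, iff_true_left h0] at hxor
      have hex : ∃ j : Fin 3, j ≠ 2 ∧ n (update ψ a j) = 0 := by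
        rcases hxor with hx | hx
        · exact ⟨0, by decide, hx.1⟩
        · exact ⟨1, by decide, hx.1⟩
      obtain ⟨j, hj, hj0⟩ := hex
      refine ⟨update ψ a j, hj0, fun b hb => ?_, fun b hb => ?_⟩
      · by_cases hba : b = a
        · subst hba; simpa using hj
        · rw [update_of_ne hba]
          exact h1 b (Finset.mem_of_mem_insert_of_ne hb hba)
      · by_cases hba : b = a
        · subst hba
          rw [h2 b (Or.inl haS)] at hψa
          simp [hψa] at hb
        · rw [update_of_ne hba]
          exact h2 b (by simpa [hba] using hb)
    · refine ⟨ψ, h0, fun b hb => ?_, fun b hb => h2 b ?_⟩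
      · by_cases hba : b = a
        · subst hba; exact hψa
        · exact h1 b (Finset.mem_of_mem_insert_of_ne hb hba)
      · rcases hb with hb | hb
        · exact Or.inl fun hc => hb (Finset.mem_insert_of_mem hc)
        · exact Or.inr hb

end IsTightOn

end TightNullity

/-! ### Even predicates on states; twists and loop complements as permutations of positions -/

section Parity

variable {α : Type*} [DecidableEq α]

/-- A predicate on the states of `E` that holds for an even number of the states of each line. -/
structure IsEvenOn (E : Finset α) (P : (α → Fin 3) → Prop) : Prop where
  congr : ∀ φ ψ : α → Fin 3, (∀ a ∈ E, φ a = ψ a) → (P φ ↔ P ψ)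
  even : ∀ φ, ∀ a ∈ E, ∀ i j k : Fin 3, i ≠ j → i ≠ k → j ≠ k →
    (P (update φ a k) ↔ Xor (P (update φ a i)) (P (update φ a j)))

/-- The element of `Fin 3` that differs from `i` and `j`, if these are distinct. -/
def third (i j : Fin 3) : Fin 3 := -(i + j)

theorem third_ne : ∀ {i j : Fin 3}, i ≠ j → i ≠ third i j ∧ j ≠ third i j := by decide

theorem third_third_right : ∀ {i j : Fin 3}, i ≠ j → third j (third i j) = i := by decide

theorem IsTightOn.isEvenOn {E : Finset α} {n : (α → Fin 3) → ℕ} (h : IsTightOn E n) :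
    IsEvenOn E fun φ => n φ = 0 where
  congr φ ψ hφ := by rw [h.congr φ ψ hφ]
  even φ a ha _ _ _ hij hik hjk := h.zero_iff_xor φ ha hij hik hjk

/-- The state with value `p` on `X` and value `q` elsewhere. -/
def statePt (p q : α → Fin 3) (X : Finset α) : α → Fin 3 := fun a => if a ∈ X then p a else q a

theorem statePt_update_right (p q : α → Fin 3) {X : Finset α} {a : α} (ha : a ∉ X) :
    statePt p q X = update (statePt p q X) a (q a) := by
  funext b
  by_cases hb : b = a
  · subst hb; simp [statePt, ha]
  · rw [update_of_ne hb]

theorem statePt_insert (p q : α → Fin 3) (X : Finset α) (a : α) :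
    statePt p q (insert a X) = update (statePt p q X) a (p a) := by
  funext b
  by_cases hb : b = a
  · subst hb; simp [statePt]
  · simp [statePt, hb]

namespace SetFamily

/-- The feasible sets of `D` are the subsets `X` of `E` such that `P` holds for the state that is `p`
on `X` and `q` outside `X`. -/
def RepBy (D : SetFamily α) (E : Finset α) (P : (α → Fin 3) → Prop) (p q : α → Fin 3) : Prop :=
  D.ground = E ∧ ∀ X, X ∈ D.feasible ↔ X ⊆ E ∧ P (statePt p q X)

variable {D : SetFamily α} {E : Finset α} {P : (α → Fin 3) → Prop} {p q : α → Fin 3}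

theorem RepBy.congr (h : D.RepBy E P p q) (hP : IsEvenOn E P) {p' q' : α → Fin 3}
    (hp : ∀ a ∈ E, p a = p' a) (hq : ∀ a ∈ E, q a = q' a) : D.RepBy E P p' q' := by
  refine ⟨h.1, fun X => ?_⟩
  rw [h.2, hP.congr (statePt p q X) (statePt p' q' X) fun a ha => ?_]
  simp only [statePt]
  rw [hp a ha, hq a ha]

theorem RepBy.twist (h : D.RepBy E P p q) {A : Finset α} (hA : A ⊆ E) :
    (D.twist A).RepBy E P (fun a => if a ∈ A then q a else p a)
      (fun a => if a ∈ A then p a else q a) := by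
  refine ⟨h.1, fun X => ?_⟩
  have h1 : X ∈ (D.twist A).feasible ↔ symmDiff X A ∈ D.feasible := by
    constructor
    · rintro ⟨Y, hY, rfl⟩
      rwa [symmDiff_symmDiff_cancel_right]
    · intro hX
      exact ⟨_, hX, (symmDiff_symmDiff_cancel_right A X).symm⟩
  rw [h1, h.2]
  refine and_congr ⟨fun hs a ha => ?_, fun hs a ha => ?_⟩ (Eq.to_iff (congrArg P ?_))
  · by_cases haA : a ∈ A
    · exact hA haA
    · exact hs (Finset.mem_symmDiff.2 (Or.inl ⟨ha, haA⟩))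
  · rcases Finset.mem_symmDiff.1 ha with ha | ha
    · exact hs ha.1
    · exact hA ha.1
  · funext a
    by_cases haA : a ∈ A <;> by_cases haX : a ∈ X <;>
      simp [statePt, Finset.mem_symmDiff, haA, haX]

/-- For `X` containing `e`, membership after loop complementation is the exclusive or of the
memberships of `X` and `X - e`. Evenness on the line through `e` turns this into `P` at the third
position. -/
theorem RepBy.loopCompl (h : D.RepBy E P p q) (hP : IsEvenOn E P) {e : α} (he : e ∈ E)
    (hne : p e ≠ q e) : (D.loopCompl e).RepBy E P (update p e (third (p e) (q e))) q := by
  refine ⟨h.1, fun X => ?_⟩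
  change X ∈ symmDiff D.feasible _ ↔ _
  rw [Set.mem_symmDiff]
  by_cases heX : e ∈ X
  · have h1 : X ∈ {G | ∃ Y ∈ D.feasible, e ∉ Y ∧ G = insert e Y} ↔ X.erase e ∈ D.feasible := by
      constructor
      · rintro ⟨Y, hY, heY, rfl⟩
        rwa [Finset.erase_insert heY]
      · intro hX
        exact ⟨_, hX, Finset.notMem_erase e X, (Finset.insert_erase heX).symm⟩
    have hsub : X.erase e ⊆ E ↔ X ⊆ E := by
      rw [Finset.subset_insert_iff.symm, Finset.insert_eq_of_mem he]
    have e1 : statePt (update p e (third (p e) (q e))) q X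
        = update (statePt p q (X.erase e)) e (third (p e) (q e)) := by
      funext b
      by_cases hb : b = e
      · subst hb; simp [statePt, heX]
      · simp [statePt, hb]
    have e2 : statePt p q X = update (statePt p q (X.erase e)) e (p e) := by
      rw [← statePt_insert, Finset.insert_erase heX]
    have e3 := statePt_update_right p q (Finset.notMem_erase e X)
    rw [h1, h.2, h.2, hsub, e1, hP.even _ e he (p e) (q e) _ hne (third_ne hne).1 (third_ne hne).2,
      ← e2, ← e3, Xor]
    tauto
  · have h1 : X ∉ {G | ∃ Y ∈ D.feasible, e ∉ Y ∧ G = insert e Y} := by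
      rintro ⟨Y, -, -, rfl⟩
      exact heX (Finset.mem_insert_self e Y)
    have e1 : statePt (update p e (third (p e) (q e))) q X = statePt p q X := by
      funext b
      by_cases hb : b = e
      · subst hb; simp [statePt, heX]
      · simp [statePt, hb]
    rw [h.2, e1]
    tauto

theorem RepBy.twist_singleton (h : D.RepBy E P p q) {e : α} (he : e ∈ E) :
    (D.twist {e}).RepBy E P (update p e (q e)) (update q e (p e)) := by
  have := h.twist (A := {e}) (by simpa using he)
  convert this using 1 <;> funext b <;> by_cases hb : b = e
  all_goals first | (subst hb; simp) | simp [hb]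

/-- With `s` the third position, the pair at `e` runs through `(p, q)`, `(s, q)`, `(q, s)`, `(p,
s)`: in effect the bar is exchanged for the hat. -/
theorem RepBy.dualPivot (h : D.RepBy E P p q) (hP : IsEvenOn E P) {e : α} (he : e ∈ E)
    (hne : p e ≠ q e) : (D.dualPivot e).RepBy E P p (update q e (third (p e) (q e))) := by
  have h1 := ((h.loopCompl hP he hne).twist_singleton he).loopCompl hP he
    (by simpa using (third_ne hne).2)
  change (((D.loopCompl e).twist {e}).loopCompl e).RepBy E P _ _
  convert h1 using 1
  · funext b
    by_cases hb : b = e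
    · subst hb; simp [third_third_right hne]
    · simp [hb]
  · funext b
    by_cases hb : b = e
    · subst hb; simp
    · simp [hb]

theorem RepBy.foldl_dualPivot (hP : IsEvenOn E P) (hne : ∀ a, p a ≠ q a) (l : List α)
    (hl : l.Nodup) (hlE : ∀ a ∈ l, a ∈ E) (h : D.RepBy E P p q) :
    (l.foldl SetFamily.dualPivot D).RepBy E P p
      (fun a => if a ∈ l then third (p a) (q a) else q a) := by
  induction l generalizing D q with
  | nil => simpa using h
  | cons e l ih =>
    have hel := (List.nodup_cons.1 hl).1
    have h1 := ih (fun a => ?_) (List.nodup_cons.1 hl).2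
      (fun a ha => hlE a (List.mem_cons_of_mem e ha))
      (h.dualPivot hP (hlE e List.mem_cons_self) (hne e))
    · rw [List.foldl_cons]
      convert h1 using 1
      funext b
      by_cases hb : b = e
      · subst hb; simp [hel]
      · simp [hb]
    · by_cases ha : a = e
      · subst ha
        simpa using (third_ne (hne a)).1
      · simpa [ha] using hne a

/-- `X ∈ 𝓕(D *̄ Z)` in terms of the three-state predicate. -/
theorem RepBy.dualPivotSet (hP : IsEvenOn E P) (h : D.RepBy E P (fun _ => 0) (fun _ => 1))
    {Z : Finset α} (hZ : Z ⊆ E) :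
    (D.dualPivotSet Z).RepBy E P (fun _ => 0) (fun a => if a ∈ Z then 2 else 1) := by
  have h1 := RepBy.foldl_dualPivot hP (fun _ => by decide) Z.toList Z.nodup_toList
    (fun a ha => hZ (Finset.mem_toList.1 ha)) h
  unfold SetFamily.dualPivotSet
  simpa only [Finset.mem_toList, show third 0 1 = 2 from rfl] using h1

/-- Every choice of two distinct values at each coordinate is represented by a set family obtained
by twists and loop complements. -/
theorem RepBy.exists_reachable (hP : IsEvenOn E P) (h : D.RepBy E P (fun _ => 0) (fun _ => 1))
    (p q : α → Fin 3) (hpq : ∀ a, p a ≠ q a) : ∃ D', D.VfReachable D' ∧ D'.RepBy E P p q := by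
  have step : ∀ (p' q' : α → Fin 3) (e : α), e ∈ E → p' e ≠ q' e →
      (∃ D', D.VfReachable D' ∧ D'.RepBy E P p' q') → ∀ i j : Fin 3, i ≠ j →
      ∃ D', D.VfReachable D' ∧ D'.RepBy E P (update p' e i) (update q' e j) := by
    intro p' q' e he hne hD i j hij
    have gen : ∀ x y : Fin 3, x ≠ y →
        (∃ D', D.VfReachable D' ∧ D'.RepBy E P (update p' e x) (update q' e y)) →
        (∃ D', D.VfReachable D' ∧ D'.RepBy E P (update p' e y) (update q' e x)) ∧
        (∃ D', D.VfReachable D' ∧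
          D'.RepBy E P (update p' e (third x y)) (update q' e y)) := by
      rintro x y hxy ⟨D', hr, hD'⟩
      refine ⟨⟨_, hr.twist {e} (by rw [hD'.1]; simpa using he), ?_⟩,
        ⟨_, hr.loopCompl e (by rw [hD'.1]; exact he), ?_⟩⟩
      · simpa using hD'.twist_singleton he
      · simpa using hD'.loopCompl hP he (by simpa using hxy)
    have g0 : ∃ D', D.VfReachable D' ∧
        D'.RepBy E P (update p' e (p' e)) (update q' e (q' e)) := by simpa using hD
    generalize p' e = x at g0 hne
    generalize q' e = y at g0 hne
    have g1 := gen _ _ hne g0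
    have n1 := (third_ne hne).1
    have n2 := (third_ne hne).2
    have g2 := gen _ _ n2.symm g1.2
    have g3 := gen _ _ hne.symm g1.1
    have g4 := gen _ _ (by rw [third, add_comm]; exact n1.symm) g3.2
    -- Twist and loop complement at `e` act as two transpositions, which generate the symmetric
    -- group on three positions; thus all six ordered pairs of distinct positions are reached.
    have hcase : (i = x ∧ j = y) ∨ (i = y ∧ j = x) ∨ (i = third x y ∧ j = y) ∨
        (i = y ∧ j = third x y) ∨ (i = third y x ∧ j = x) ∨ (i = x ∧ j = third y x) := by
      clear * - hne hij
      revert i j x y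
      decide
    rcases hcase with ⟨rfl, rfl⟩ | ⟨rfl, rfl⟩ | ⟨rfl, rfl⟩ | ⟨rfl, rfl⟩ | ⟨rfl, rfl⟩ | ⟨rfl, rfl⟩
    exacts [g0, g1.1, g1.2, g2.1, g3.2, g4.1]
  have main : ∀ S ⊆ E, ∃ D', D.VfReachable D' ∧
      D'.RepBy E P (fun a => if a ∈ S then p a else 0) (fun a => if a ∈ S then q a else 1) := by
    intro S
    induction S using Finset.induction_on with
    | empty => exact fun _ => ⟨D, .refl, by simpa using h⟩
    | insert e S heS ih =>
      intro hS
      have := step _ _ e (hS (Finset.mem_insert_self e S)) (by simp [heS])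
        (ih fun b hb => hS (Finset.mem_insert_of_mem hb)) (p e) (q e) (hpq e)
      convert this using 4 <;> funext b <;> by_cases hb : b = e
      all_goals first | (subst hb; simp) | simp [hb]
  obtain ⟨D', hr, hD'⟩ := main E subset_rfl
  exact ⟨D', hr, hD'.congr hP (fun a ha => by simp [ha]) fun a ha => by simp [ha]⟩

/-- The symmetric exchange axiom for three-state predicates. -/
theorem IsVfSafe.exchange (hD : D.IsVfSafe) (hP : IsEvenOn E P)
    (h : D.RepBy E P (fun _ => 0) (fun _ => 1)) {φ ψ : α → Fin 3} (hφ : P φ) (hψ : P ψ) {u : α}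
    (hu : u ∈ E) (hne : φ u ≠ ψ u) :
    ∃ v ∈ E, φ v ≠ ψ v ∧ P (update (update φ u (ψ u)) v (ψ v)) := by
  -- The cube is chosen to contain both states: `φ` becomes the full set `E`, and `ψ` becomes the
  -- set `Y` of coordinates where the two agree. The value `φ a + 1` is only some value different
  -- from `φ a`. Exchange for `E` and `Y` in `D'` is the claim.
  obtain ⟨D', hr, hD'⟩ := h.exists_reachable hP φ (fun a => if φ a = ψ a then φ a + 1 else ψ a)
    fun a => by
      split_ifs with hc
      · generalize φ a = x; revert x; decide
      · exact hc
  have hdm := hD D' hr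
  set q := fun a => if φ a = ψ a then φ a + 1 else ψ a with hq
  set Y := E.filter fun a => φ a = ψ a with hY
  have hE : E ∈ D'.feasible := by
    rw [hD'.2]
    refine ⟨subset_rfl, (hP.congr _ _ fun a ha => ?_).1 hφ⟩
    simp [statePt, ha]
  have hYf : Y ∈ D'.feasible := by
    rw [hD'.2]
    refine ⟨Finset.filter_subset _ _, (hP.congr _ _ fun a ha => ?_).1 hψ⟩
    by_cases hc : φ a = ψ a <;> simp [statePt, hY, ha, hq, hc]
  have hmem : ∀ a, a ∈ symmDiff E Y ↔ a ∈ E ∧ φ a ≠ ψ a := by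
    intro a
    by_cases ha : a ∈ E <;> simp [Finset.mem_symmDiff, hY, ha]
  obtain ⟨v, hv, hvf⟩ := hdm.exchange E hE Y hYf u ((hmem u).2 ⟨hu, hne⟩)
  rw [hmem] at hv
  refine ⟨v, hv.1, hv.2, ?_⟩
  rw [hD'.2] at hvf
  refine (hP.congr _ _ fun a ha => ?_).1 hvf.2
  by_cases hav : a = v
  · subst hav
    simp [statePt, Finset.mem_symmDiff, ha, hq, hv.2]
  · by_cases hau : a = u
    · subst hau
      simp [statePt, Finset.mem_symmDiff, ha, hq, hne, hav]
    · simp [statePt, Finset.mem_symmDiff, ha, hav, hau]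

open Classical in
/-- The three-state predicate of a set family: the number of feasible sets compatible with the dots
and bars of the state is odd. -/
def OddState (D : SetFamily α) (φ : α → Fin 3) : Prop :=
  Odd (D.ground.powerset.filter fun Y =>
    Y ∈ D.feasible ∧ ∀ a ∈ D.ground, (φ a = 0 → a ∈ Y) ∧ (φ a = 1 → a ∉ Y)).card

/-- A hat imposes no condition at its element, so the count for the hat is the sum of the counts for
dot and bar. Modulo 2 this relation is symmetric in the three positions. -/
theorem isEvenOn_oddState (D : SetFamily α) : IsEvenOn D.ground D.OddState where
  congr φ ψ h := by
    unfold OddState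
    congr! 7 with Y _ a ha <;> rw [h a ‹_›]
  even φ a ha := by
    have hsplit : ∀ (j : Fin 3) (Y : Finset α),
        (∀ b ∈ D.ground, (update φ a j b = 0 → b ∈ Y) ∧ (update φ a j b = 1 → b ∉ Y)) ↔
          (∀ b ∈ D.ground, b ≠ a → (φ b = 0 → b ∈ Y) ∧ (φ b = 1 → b ∉ Y)) ∧
            (j = 0 → a ∈ Y) ∧ (j = 1 → a ∉ Y) := by
      intro j Y
      constructor
      · intro h
        refine ⟨fun b hb hba => ?_, ?_⟩
        · simpa [hba] using h b hb
        · simpa using h a ha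
      · rintro ⟨h1, h2⟩ b hb
        by_cases hba : b = a
        · subst hba; simpa using h2
        · simpa [hba] using h1 b hb hba
    have base : D.OddState (update φ a 2) ↔
        Xor (D.OddState (update φ a 0)) (D.OddState (update φ a 1)) := by
      classical
      unfold OddState
      have hdis : Disjoint
          (D.ground.powerset.filter fun Y => Y ∈ D.feasible ∧ ∀ b ∈ D.ground,
            (update φ a 0 b = 0 → b ∈ Y) ∧ (update φ a 0 b = 1 → b ∉ Y))
          (D.ground.powerset.filter fun Y => Y ∈ D.feasible ∧ ∀ b ∈ D.ground,
            (update φ a 1 b = 0 → b ∈ Y) ∧ (update φ a 1 b = 1 → b ∉ Y)) := by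
        rw [Finset.disjoint_filter]
        intro Y _ h1 h2
        simp only [hsplit] at h1 h2
        simp at h1 h2
        exact h2.2.2 h1.2.2
      have hun := Finset.card_union_of_disjoint hdis
      rw [← Finset.filter_or] at hun
      have hfil : (D.ground.powerset.filter fun Y => Y ∈ D.feasible ∧ ∀ b ∈ D.ground,
          (update φ a 2 b = 0 → b ∈ Y) ∧ (update φ a 2 b = 1 → b ∉ Y)).card = _ :=
          Eq.trans ?_ hun
      · rw [hfil, Nat.odd_add, Xor, ← Nat.not_odd_iff_even]
        tauto
      · congr 1
        refine Finset.filter_congr fun Y _ => ?_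
        simp only [hsplit]
        by_cases haY : a ∈ Y <;> simp [haY]
    intro i j k hij hik hjk
    have hcase : (i = 0 ∧ j = 1 ∧ k = 2) ∨ (i = 0 ∧ j = 2 ∧ k = 1) ∨ (i = 1 ∧ j = 0 ∧ k = 2) ∨
        (i = 1 ∧ j = 2 ∧ k = 0) ∨ (i = 2 ∧ j = 0 ∧ k = 1) ∨ (i = 2 ∧ j = 1 ∧ k = 0) := by
      revert i j k; decide
    rw [Xor] at base ⊢
    rcases hcase with ⟨rfl, rfl, rfl⟩ | ⟨rfl, rfl, rfl⟩ | ⟨rfl, rfl, rfl⟩ | ⟨rfl, rfl, rfl⟩ |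
      ⟨rfl, rfl, rfl⟩ | ⟨rfl, rfl, rfl⟩ <;> tauto

/-- A state without hats is compatible with exactly one subset of the ground set, so the count is 1
or 0 according to feasibility. -/
theorem repBy_oddState (hD : ∀ F ∈ D.feasible, F ⊆ D.ground) :
    D.RepBy D.ground D.OddState (fun _ => 0) (fun _ => 1) := by
  classical
  refine ⟨rfl, fun X => ?_⟩
  have key : X ⊆ D.ground → (D.OddState (statePt (fun _ => 0) (fun _ => 1) X) ↔ X ∈ D.feasible) := by
    intro hX
    have hfil : (D.ground.powerset.filter fun Y => Y ∈ D.feasible ∧ ∀ a ∈ D.ground,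
        (statePt (fun _ => 0) (fun _ => 1) X a = 0 → a ∈ Y) ∧
        (statePt (fun _ => 0) (fun _ => 1) X a = 1 → a ∉ Y)) =
        if X ∈ D.feasible then {X} else ∅ := by
      ext Y
      rw [Finset.mem_filter, Finset.mem_powerset]
      have : (Y ⊆ D.ground ∧ ∀ a ∈ D.ground,
          (statePt (fun _ => 0) (fun _ => 1) X a = 0 → a ∈ Y) ∧
          (statePt (fun _ => 0) (fun _ => 1) X a = 1 → a ∉ Y)) ↔ Y = X := by
        constructor
        · rintro ⟨hY, h⟩
          ext a
          constructor
          · intro ha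
            by_contra haX
            exact (h a (hY ha)).2 (by simp [statePt, haX]) ha
          · intro ha
            exact (h a (hX ha)).1 (by simp [statePt, ha])
        · rintro rfl
          refine ⟨hX, fun a _ => ?_⟩
          by_cases haY : a ∈ Y <;> simp [statePt, haY]
      rw [and_left_comm, this]
      split_ifs with hf
      · rw [Finset.mem_singleton]
        constructor
        · exact fun h => h.2
        · rintro rfl; exact ⟨hf, rfl⟩
      · simp only [Finset.notMem_empty, iff_false]
        rintro ⟨h1, rfl⟩
        exact hf h1
    unfold OddState
    rw [hfil]
    split_ifs with hf <;> simp [hf]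
  constructor
  · intro h
    exact ⟨hD X h, (key (hD X h)).2 h⟩
  · rintro ⟨hX, h⟩
    exact (key hX).1 h

end SetFamily

end Parity

/-! ### The nullity function of a vf-safe delta-matroid -/

section Nullity

variable {α : Type*}

/-- The number of coordinates in `E` at which two states differ. -/
def stateDist (E : Finset α) (φ ψ : α → Fin 3) : ℕ := (E.filter fun a => φ a ≠ ψ a).card

theorem stateDist_congr {E : Finset α} {φ ψ φ' ψ' : α → Fin 3} (h : ∀ a ∈ E, φ a = φ' a)
    (h' : ∀ a ∈ E, ψ a = ψ' a) : stateDist E φ ψ = stateDist E φ' ψ' := by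
  unfold stateDist
  congr 1
  exact Finset.filter_congr fun a ha => by rw [h a ha, h' a ha]

/-- The distance to the states that satisfy `P`. -/
noncomputable def distNullity (E : Finset α) (P : (α → Fin 3) → Prop) (φ : α → Fin 3) : ℕ :=
  sInf (stateDist E φ '' {ψ | P ψ})

variable {E : Finset α} {P : (α → Fin 3) → Prop}

theorem distNullity_le {φ ψ : α → Fin 3} (h : P ψ) : distNullity E P φ ≤ stateDist E φ ψ :=
  Nat.sInf_le ⟨ψ, h, rfl⟩

theorem exists_distNullity (h : ∃ ψ, P ψ) (φ : α → Fin 3) :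
    ∃ ψ, P ψ ∧ stateDist E φ ψ = distNullity E P φ := by
  obtain ⟨ψ, hψ⟩ := h
  exact Nat.sInf_mem (s := stateDist E φ '' {ψ | P ψ}) ⟨_, ψ, hψ, rfl⟩

variable [DecidableEq α]

theorem stateDist_erase {a : α} (ha : a ∈ E) (φ ψ : α → Fin 3) :
    stateDist E φ ψ = stateDist (E.erase a) φ ψ + if φ a = ψ a then 0 else 1 := by
  unfold stateDist
  conv_lhs => rw [← Finset.insert_erase ha, Finset.filter_insert]
  by_cases h : φ a = ψ a
  · simp [h]
  · rw [if_pos h, if_neg h, Finset.card_insert_of_notMem (by simp)]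

theorem stateDist_update {a : α} (ha : a ∈ E) (φ ψ : α → Fin 3) (j : Fin 3) :
    stateDist E φ (update ψ a j) = stateDist (E.erase a) φ ψ + if φ a = j then 0 else 1 := by
  rw [stateDist_erase ha, update_self]
  congr 1
  exact stateDist_congr (fun _ _ => rfl) fun b hb => update_of_ne (Finset.ne_of_mem_erase hb) _ _

theorem stateDist_update_left {a : α} (ha : a ∈ E) (φ ψ : α → Fin 3) (j : Fin 3) :
    stateDist E (update φ a j) ψ = stateDist (E.erase a) φ ψ + if j = ψ a then 0 else 1 := by
  rw [stateDist_erase ha, update_self]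
  congr 1
  exact stateDist_congr (fun b hb => update_of_ne (Finset.ne_of_mem_erase hb) _ _) fun _ _ => rfl

theorem distNullity_eq_zero (hP : IsEvenOn E P) (h : ∃ ψ, P ψ) (φ : α → Fin 3) :
    distNullity E P φ = 0 ↔ P φ := by
  constructor
  · intro h0
    obtain ⟨ψ, hψ, hd⟩ := exists_distNullity (E := E) h φ
    rw [h0, stateDist, Finset.card_eq_zero] at hd
    refine (hP.congr φ ψ fun a ha => ?_).2 hψ
    by_contra hne
    have : a ∈ E.filter fun a => φ a ≠ ψ a := Finset.mem_filter.2 ⟨ha, hne⟩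
    simp [hd] at this
  · intro hφ
    have := distNullity_le (E := E) (φ := φ) hφ
    simpa [stateDist] using this

/-- Two closest states have the same values on the line in direction `a`. -/
theorem closest_update (hP : IsEvenOn E P)
    (hex : ∀ φ ψ, P φ → P ψ → ∀ u ∈ E, φ u ≠ ψ u →
      ∃ v ∈ E, φ v ≠ ψ v ∧ P (update (update φ u (ψ u)) v (ψ v)))
    {a : α} (ha : a ∈ E) (σ : α → Fin 3) (m : ℕ)
    (hmin : ∀ ψ, P ψ → m ≤ stateDist (E.erase a) σ ψ) (φ ψ : α → Fin 3)
    (hφ : P φ) (hψ : P ψ) (hφm : stateDist (E.erase a) σ φ = m)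
    (hψm : stateDist (E.erase a) σ ψ = m) : P (update ψ a (φ a)) := by
  induction hd : stateDist (E.erase a) ψ φ using Nat.strong_induction_on generalizing φ with
  | _ d ih =>
  -- As long as such a `u` exists, `φ` can be moved towards `ψ`, off `a`, without losing `P`, the
  -- distance `m` to `σ` or the value at `a`.
  by_cases hu : ∃ u ∈ E.erase a, φ u ≠ σ u ∧ φ u ≠ ψ u
  · obtain ⟨u, huE, hu1, hu2⟩ := hu
    have hua : a ≠ u := (Finset.ne_of_mem_erase huE).symm
    have hσφ := stateDist_erase huE σ φ
    have hψφ := stateDist_erase huE ψ φ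
    rw [if_neg hu1.symm] at hσφ
    rw [if_neg hu2.symm] at hψφ
    by_cases hu3 : ψ u = σ u
    -- Changing `φ u` to `ψ u = σ u` brings the state within `m - 1` of `σ`. By minimality of `m`
    -- the exchange partner `v` must undo this, so it is neither `a` nor `u`.
    · obtain ⟨v, hvE, hv1, hv2⟩ := hex φ ψ hφ hψ u (Finset.mem_of_mem_erase huE) hu2
      have hdu := stateDist_update huE σ φ (ψ u)
      have hdu' := stateDist_update huE ψ φ (ψ u)
      rw [if_pos hu3.symm] at hdu
      rw [if_pos rfl] at hdu'
      have h1 := hmin _ hv2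
      have hva : v ≠ a := by
        rintro rfl
        rw [stateDist_congr (φ' := σ) (ψ' := update φ u (ψ u)) (fun _ _ => rfl) fun b hb =>
          update_of_ne (Finset.ne_of_mem_erase hb) _ _] at h1
        omega
      have hvu : v ≠ u := by
        rintro rfl
        rw [update_idem] at h1
        omega
      have hvE' : v ∈ E.erase a := Finset.mem_erase.2 ⟨hva, hvE⟩
      have hd1 := stateDist_update hvE' σ (update φ u (ψ u)) (ψ v)
      have hd2 := stateDist_update hvE' ψ (update φ u (ψ u)) (ψ v)
      have hd3 := stateDist_erase hvE' σ (update φ u (ψ u))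
      have hd4 := stateDist_erase hvE' ψ (update φ u (ψ u))
      rw [update_of_ne hvu] at hd3 hd4
      rw [if_pos rfl] at hd2
      have := ih _ ?_ _ hv2 ?_ rfl
      · simpa [hva.symm, hua] using this
      · omega
      · split_ifs at hd1 hd3 <;> omega
    -- Here `φ u`, `σ u`, `ψ u` are the three positions at `u`. Position `σ u` would beat the
    -- minimum `m`, so `P` fails there and evenness gives it at `ψ u`.
    · have hline : ∀ χ : α → Fin 3, (∀ b, b ≠ a → χ b = φ b) → P χ → P (update χ u (ψ u)) := by
        intro χ hχ hPχ
        have hχu : χ u = φ u := hχ u hua.symm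
        rw [hP.even χ u (Finset.mem_of_mem_erase huE) (φ u) (σ u) (ψ u) hu1 hu2 (Ne.symm hu3)]
        refine Or.inl ⟨by rwa [← hχu, update_eq_self], fun hc => ?_⟩
        have h1 := hmin _ hc
        have hd1 := stateDist_update huE σ χ (σ u)
        rw [if_pos rfl] at hd1
        have hd2 : stateDist ((E.erase a).erase u) σ χ = stateDist ((E.erase a).erase u) σ φ :=
          stateDist_congr (fun _ _ => rfl) fun b hb =>
            hχ b (Finset.ne_of_mem_erase (Finset.mem_of_mem_erase hb))
        omega
      have hd1 := stateDist_update huE σ φ (ψ u)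
      have hd2 := stateDist_update huE ψ φ (ψ u)
      rw [if_neg (Ne.symm hu3)] at hd1
      rw [if_pos rfl] at hd2
      have := ih _ ?_ _ (hline φ (fun _ _ => rfl) hφ) ?_ rfl
      · simpa [hua] using this
      · omega
      · omega
  -- Now every place off `a` where `φ` leaves `σ` is one where `ψ` takes the same value; both leave
  -- `σ` equally often, so they coincide off `a`.
  · push Not at hu
    have hsub : ((E.erase a).filter fun b => σ b ≠ φ b) ⊆ (E.erase a).filter fun b => σ b ≠ ψ b := by
      intro b hb
      rw [Finset.mem_filter] at hb ⊢
      exact ⟨hb.1, by rw [← hu b hb.1 (Ne.symm hb.2)]; exact hb.2⟩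
    have heq := Finset.eq_of_subset_of_card_le hsub (by
      change stateDist _ _ _ ≤ stateDist _ _ _
      omega)
    refine (hP.congr φ _ fun b hb => ?_).1 hφ
    by_cases hba : b = a
    · subst hba; simp
    rw [update_of_ne hba]
    have hbE : b ∈ E.erase a := Finset.mem_erase.2 ⟨hba, hb⟩
    by_cases hbσ : φ b = σ b
    · have : b ∉ (E.erase a).filter fun b => σ b ≠ ψ b := by
        rw [← heq]; simp [hbσ]
      rw [Finset.mem_filter, not_and_not_right] at this
      rw [hbσ, this hbE]
    · exact hu b hbE hbσ

/-- Let `m` be the least distance to `P` when coordinate `a` is ignored. The line through a closest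
solution contains exactly two solutions by evenness. By `closest_update` all closest solutions omit
the same position `k` there, so `k` costs one extra step and the other positions none. -/
theorem isTightOn_distNullity (hP : IsEvenOn E P) (h0 : ∃ ψ, P ψ)
    (hex : ∀ φ ψ, P φ → P ψ → ∀ u ∈ E, φ u ≠ ψ u →
      ∃ v ∈ E, φ v ≠ ψ v ∧ P (update (update φ u (ψ u)) v (ψ v))) :
    IsTightOn E (distNullity E P) where
  congr φ ψ h := by
    unfold distNullity
    congr 1
    exact Set.image_congr fun χ _ => stateDist_congr h fun _ _ => rfl
  line σ a ha := by
    obtain ⟨m, ⟨φ, hφ, hφm⟩, hmin⟩ : ∃ m, (∃ φ, P φ ∧ stateDist (E.erase a) σ φ = m) ∧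
        ∀ ψ, P ψ → m ≤ stateDist (E.erase a) σ ψ := by
      have := exists_distNullity (E := E.erase a) h0 σ
      exact ⟨_, this, fun ψ hψ => distNullity_le hψ⟩
    obtain ⟨k, hk, hk'⟩ : ∃ k, ¬ P (update φ a k) ∧ ∀ j, j ≠ k → P (update φ a j) := by
      have hPa : P (update φ a (φ a)) := by rwa [update_eq_self]
      have hxor := hP.even φ a ha (φ a) (φ a + 1) (φ a + 2)
        (by generalize φ a = x; revert x; decide) (by generalize φ a = x; revert x; decide)
        (by generalize φ a = x; revert x; decide)
      have hcase : ∀ x j : Fin 3, j = x ∨ j = x + 1 ∨ j = x + 2 := by decide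
      by_cases h1 : P (update φ a (φ a + 1))
      · refine ⟨φ a + 2, fun h2 => ?_, fun j hj => ?_⟩
        · rw [Xor] at hxor; tauto
        · rcases hcase (φ a) j with h | h | h
          · rwa [h]
          · rwa [h]
          · exact absurd h hj
      · refine ⟨φ a + 1, h1, fun j hj => ?_⟩
        rcases hcase (φ a) j with h | h | h
        · rwa [h]
        · exact absurd h hj
        · rw [h]
          rw [Xor] at hxor; tauto
    refine ⟨m, k, fun j => ?_⟩
    refine le_antisymm ?_ ?_
    · split_ifs with hjk
      · refine (distNullity_le hφ).trans ?_
        rw [stateDist_update_left ha, hφm]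
        split_ifs <;> omega
      · refine (distNullity_le (hk' j hjk)).trans ?_
        rw [stateDist_update_left ha, update_self, if_pos rfl]
        rw [stateDist_congr (φ' := σ) (ψ' := φ) (fun _ _ => rfl) fun b hb =>
          update_of_ne (Finset.ne_of_mem_erase hb) _ _, hφm]
    · obtain ⟨χ, hχ, hd⟩ := exists_distNullity (E := E) h0 (update σ a j)
      rw [← hd, stateDist_update_left ha]
      have h1 := hmin χ hχ
      rcases h1.lt_or_eq with h2 | h2
      · split_ifs <;> omega
      · have hne : k ≠ χ a := by
          rintro rfl
          exact hk (closest_update hP hex ha σ m hmin χ φ hχ hφ h2.symm hφm)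
        split_ifs with h3 h4 h4
        · exact absurd (h3.symm.trans h4) hne
        all_goals omega

namespace SetFamily

/-- `n` is the nullity function of the delta-matroid `D`: its zeros among the states without hats
are the feasible sets. -/
structure HasNullity (D : SetFamily α) (n : (α → Fin 3) → ℕ) : Prop where
  tight : IsTightOn D.ground n
  exists_zero : ∃ φ, n φ = 0
  mem_feasible : ∀ X, X ∈ D.feasible ↔ X ⊆ D.ground ∧ n (statePt (fun _ => 0) (fun _ => 1) X) = 0

variable {D : SetFamily α}

/-- The single entry point of vf-safety: all later arguments work with nullity functions, which are
preserved by 2-sums. -/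
theorem IsVfSafe.exists_hasNullity (h : D.IsVfSafe) : ∃ n, D.HasNullity n := by
  have hD := h D .refl
  have hP := isEvenOn_oddState D
  have hR := repBy_oddState hD.subset_ground
  obtain ⟨F, hF⟩ := hD.nonempty
  have h0 : ∃ φ, D.OddState φ := ⟨_, ((hR.2 F).1 hF).2⟩
  refine ⟨distNullity D.ground D.OddState, isTightOn_distNullity hP h0 fun φ ψ hφ hψ u hu hne =>
    h.exchange hP hR hφ hψ hu hne, ?_, fun X => ?_⟩
  · obtain ⟨φ, hφ⟩ := h0
    exact ⟨φ, (distNullity_eq_zero hP ⟨φ, hφ⟩ φ).2 hφ⟩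
  · rw [hR.2, distNullity_eq_zero hP h0]

theorem HasNullity.repBy {n : (α → Fin 3) → ℕ} (h : D.HasNullity n) :
    D.RepBy D.ground (fun φ => n φ = 0) (fun _ => 0) (fun _ => 1) :=
  ⟨rfl, h.mem_feasible⟩

/-- A state agreeing with `p` and `q` can be moved to a zero by flips in the cube they span. -/
theorem _root_.IsTightOn.exists_flip {E : Finset α} {n : (α → Fin 3) → ℕ} (h : IsTightOn E n)
    (h0 : ∃ φ, n φ = 0) (p q : α → Fin 3) (hpq : ∀ a, p a ≠ q a) (X : Finset α) (hX : X ⊆ E) :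
    ∃ F ⊆ E, n (statePt p q F) = 0 ∧ (symmDiff F X).card ≤ n (statePt p q X) := by
  induction hd : n (statePt p q X) generalizing X with
  | zero => exact ⟨X, hX, hd, by simp⟩
  | succ d ih =>
    obtain ⟨a, ha, hj⟩ := h.exists_descent h0 _ (by omega : n (statePt p q X) ≠ 0)
    have hstep : ∃ Y ⊆ E, n (statePt p q Y) = d ∧ (symmDiff Y X).card ≤ 1 := by
      by_cases haX : a ∈ X
      · refine ⟨X.erase a, (Finset.erase_subset _ _).trans hX, ?_, ?_⟩
        · have e : statePt p q (X.erase a) = update (statePt p q X) a (q a) := by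
            funext b
            by_cases hb : b = a
            · subst hb; simp [statePt]
            · simp [statePt, hb]
          have := hj (q a) (by simpa [statePt, haX] using (hpq a).symm)
          rw [e]; omega
        · refine (Finset.card_le_card (t := {a}) fun b hb => ?_).trans (by simp)
          simp only [Finset.mem_symmDiff, Finset.mem_erase, Finset.mem_singleton] at hb ⊢
          tauto
      · refine ⟨insert a X, Finset.insert_subset ha hX, ?_, ?_⟩
        · have := hj (p a) (by simpa [statePt, haX] using hpq a)
          rw [statePt_insert]; omega
        · refine (Finset.card_le_card (t := {a}) fun b hb => ?_).trans (by simp)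
          simp only [Finset.mem_symmDiff, Finset.mem_insert, Finset.mem_singleton] at hb ⊢
          tauto
    obtain ⟨Y, hY, hYd, hYc⟩ := hstep
    obtain ⟨F, hF, hF0, hFc⟩ := ih Y hY hYd
    refine ⟨F, hF, hF0, ?_⟩
    have h1 : (symmDiff F X).card ≤ (symmDiff F Y ∪ symmDiff Y X).card :=
      Finset.card_le_card (symmDiff_triangle F Y X)
    have h2 := Finset.card_union_le (symmDiff F Y) (symmDiff Y X)
    omega

/-- The exponent of `t` in the transition polynomial is the nullity. -/
theorem HasNullity.dist_dualPivotSet {n : (α → Fin 3) → ℕ} (h : D.HasNullity n) {Z X : Finset α}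
    (hZ : Z ⊆ D.ground) (hX : X ⊆ D.ground) :
    (D.dualPivotSet Z).dist X = n (statePt (fun _ => 0) (fun a => if a ∈ Z then 2 else 1) X) := by
  have hR := h.repBy.dualPivotSet h.tight.isEvenOn hZ
  have hpq : ∀ a : α, (0 : Fin 3) ≠ if a ∈ Z then 2 else 1 := fun a => by split_ifs <;> decide
  refine le_antisymm ?_ ?_
  -- A descent may use any other position, so it can stay in the cube of dots and chosen non-dots;
  -- this bounds the distance above. The lower bound holds because one coordinate change alters `n`
  -- by at most one.
  · obtain ⟨F, hF, hF0, hFc⟩ := h.tight.exists_flip h.exists_zero _ _ hpq X hX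
    have hle : (D.dualPivotSet Z).dist X ≤ (symmDiff F X).card :=
      Nat.sInf_le ⟨F, (hR.2 F).2 ⟨hF, hF0⟩, rfl⟩
    exact hle.trans hFc
  · obtain ⟨F, hF, hF0, -⟩ := h.tight.exists_flip h.exists_zero _ _ hpq X hX
    have hne : ((fun G => (symmDiff G X).card) '' (D.dualPivotSet Z).feasible).Nonempty :=
      ⟨_, F, (hR.2 F).2 ⟨hF, hF0⟩, rfl⟩
    refine le_csInf hne ?_
    rintro _ ⟨G, hG, rfl⟩
    obtain ⟨hGE, hG0⟩ := (hR.2 G).1 hG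
    have := h.tight.le_add_card (statePt (fun _ => 0) (fun a => if a ∈ Z then 2 else 1) X)
      (statePt (fun _ => 0) (fun a => if a ∈ Z then 2 else 1) G) (symmDiff G X) (fun a ha => ?_)
      fun a _ ha => ?_
    · rw [hG0, Nat.zero_add] at this
      exact this
    · rcases Finset.mem_symmDiff.1 ha with ha | ha
      · exact hGE ha.1
      · exact hX ha.1
    · rw [Finset.mem_symmDiff] at ha
      have : a ∈ X ↔ a ∈ G := by tauto
      simp [statePt, this]

end SetFamily

end Nullity

/-! ### Matroids from local nullity axioms -/

section NullityMatroid

variable {γ : Type*} [DecidableEq γ]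

/-- A nullity-like function that satisfies the local axioms. -/
structure IsLocalNullity (T : Finset γ) (r : Finset γ → ℕ) : Prop where
  empty : r ∅ = 0
  mono : ∀ A B, A ⊆ B → B ⊆ T → r A ≤ r B
  step : ∀ A ⊆ T, ∀ x ∈ T, r (insert x A) ≤ r A + 1
  local_supermodular : ∀ A ⊆ T, ∀ x ∈ T, ∀ y ∈ T, x ∉ A → y ∉ A → x ≠ y →
    r (insert x A) = r A + 1 → r (insert y A) = r A + 1 → r A + 2 ≤ r (insert x (insert y A))

namespace IsLocalNullity

variable {T : Finset γ} {r : Finset γ → ℕ}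

theorem union_le (h : IsLocalNullity T r) {A K : Finset γ} (hA : A ⊆ T) (hK : K ⊆ T) :
    r (A ∪ K) ≤ r A + K.card := by
  induction K using Finset.induction_on with
  | empty => simp
  | insert x K hx ih =>
    have h1 := ih fun y hy => hK (Finset.mem_insert_of_mem hy)
    have h2 := h.step (A ∪ K) (Finset.union_subset hA fun y hy => hK (Finset.mem_insert_of_mem hy)) x
      (hK (Finset.mem_insert_self x K))
    rw [Finset.union_insert, Finset.card_insert_of_notMem hx]
    omega

/-- After one element of `K` is added, local supermodularity ensures that each remaining one still
raises the nullity, so the increments accumulate. -/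
theorem union_eq (h : IsLocalNullity T r) {A K : Finset γ} (hA : A ⊆ T) (hK : K ⊆ T)
    (hd : Disjoint A K) (hx : ∀ x ∈ K, r (insert x A) = r A + 1) : r (A ∪ K) = r A + K.card := by
  induction K using Finset.induction_on generalizing A with
  | empty => simp
  | insert y K hy ih =>
    rw [Finset.disjoint_insert_right] at hd
    have hyT := hK (Finset.mem_insert_self y K)
    have hry := hx y (Finset.mem_insert_self y K)
    have hA' : insert y A ⊆ T := Finset.insert_subset hyT hA
    have := ih (A := insert y A) hA' (fun z hz => hK (Finset.mem_insert_of_mem hz))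
      (Finset.disjoint_insert_left.2 ⟨hy, hd.2⟩) fun z hz => by
        have hzT := hK (Finset.mem_insert_of_mem hz)
        have h1 := h.step _ hA' z hzT
        have h2 := h.local_supermodular A hA z hzT y hyT (Finset.disjoint_right.1 hd.2 hz) hd.1
          (fun hzy => hy (hzy ▸ hz)) (hx z (Finset.mem_insert_of_mem hz)) hry
        omega
    rw [Finset.union_insert, ← Finset.insert_union, this, hry, Finset.card_insert_of_notMem hy]
    omega

/-- The independent sets are those of nullity zero. If no element of `J` augments `I`, then `r (I ∪
J) = |J \ I|` by `union_eq`, while starting from `J` gives at most `|I \ J|`; this is impossible for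
`|I| < |J|`. In the same way a largest null subset `I` of `A` satisfies `r A = |A \ I|`, which is
the rank formula. -/
theorem exists_matroid (h : IsLocalNullity T r) :
    ∃ M : Matroid γ, M.E = (T : Set γ) ∧
      ∀ A ⊆ T, M.eRk (A : Set γ) = ((A.card - r A : ℕ) : ℕ∞) := by
  have augment : ∀ I J, I ⊆ T ∧ r I = 0 → J ⊆ T ∧ r J = 0 → I.card < J.card →
      ∃ x ∈ J, x ∉ I ∧ insert x I ⊆ T ∧ r (insert x I) = 0 := by
    rintro I J ⟨hI, hI0⟩ ⟨hJ, hJ0⟩ hlt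
    by_contra! hc
    have h1 : r (I ∪ J \ I) = r I + (J \ I).card := by
      refine h.union_eq hI (Finset.sdiff_subset.trans hJ) Finset.disjoint_sdiff fun x hx => ?_
      rw [Finset.mem_sdiff] at hx
      have := hc x hx.1 hx.2 (Finset.insert_subset (hJ hx.1) hI)
      have := h.step I hI x (hJ hx.1)
      omega
    have h2 := h.union_le hJ (Finset.sdiff_subset (s := I) (t := J) |>.trans hI)
    rw [Finset.union_sdiff_self_eq_union] at h1 h2
    rw [Finset.union_comm] at h2
    have h3 := Finset.card_sdiff_add_card_inter J I
    have h4 := Finset.card_sdiff_add_card_inter I J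
    rw [Finset.inter_comm] at h4
    omega
  obtain ⟨M, hME, hind⟩ : ∃ M : Matroid γ, M.E = (T : Set γ) ∧
      ∀ I : Finset γ, M.Indep (I : Set γ) ↔ I ⊆ T ∧ r I = 0 := by
    refine ⟨(IndepMatroid.ofFinset (T : Set γ) (fun I => I ⊆ T ∧ r I = 0)
      ⟨Finset.empty_subset T, h.empty⟩
      (fun I J hJ hIJ => ⟨hIJ.trans hJ.1, Nat.le_zero.1 (hJ.2 ▸ h.mono I J hIJ hJ.1)⟩)
      (fun I J hI hJ hlt => augment I J hI hJ hlt)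
      (fun I hI => Finset.coe_subset.2 hI.1)).matroid, rfl, fun I => ?_⟩
    rw [IndepMatroid.matroid_Indep, IndepMatroid.ofFinset_indep]
  refine ⟨M, hME, fun A hA => le_antisymm ?_ ?_⟩
  · rw [Matroid.eRk_le_iff]
    intro I hIA hI
    lift I to Finset γ using A.finite_toSet.subset hIA
    rw [Finset.coe_subset] at hIA
    rw [hind] at hI
    rw [Set.encard_coe_eq_coe_finsetCard]
    have h1 := h.union_le hI.1 (Finset.sdiff_subset.trans hA : A \ I ⊆ T)
    rw [Finset.union_sdiff_of_subset hIA] at h1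
    have h2 := Finset.card_sdiff_add_card_eq_card hIA
    exact_mod_cast (by omega : I.card ≤ A.card - r A)
  · rw [Matroid.le_eRk_iff]
    obtain ⟨I, hI, hmax⟩ := Finset.exists_max_image (A.powerset.filter fun I => r I = 0)
      Finset.card ⟨∅, by simp [h.empty]⟩
    rw [Finset.mem_filter, Finset.mem_powerset] at hI
    have hIT := hI.1.trans hA
    refine ⟨I, Finset.coe_subset.2 hI.1, (hind I).2 ⟨hIT, hI.2⟩, ?_⟩
    have h1 : r (I ∪ A \ I) = r I + (A \ I).card := by
      refine h.union_eq hIT (Finset.sdiff_subset.trans hA) Finset.disjoint_sdiff fun x hx => ?_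
      rw [Finset.mem_sdiff] at hx
      have h2 := h.step I hIT x (hA hx.1)
      have h3 : r (insert x I) ≠ 0 := fun h0 => by
        have := hmax (insert x I) (Finset.mem_filter.2
          ⟨Finset.mem_powerset.2 (Finset.insert_subset hx.1 hI.1), h0⟩)
        rw [Finset.card_insert_of_notMem hx.2] at this
        omega
      omega
    rw [Finset.union_sdiff_of_subset hI.1] at h1
    have h2 := Finset.card_sdiff_add_card_eq_card hI.1
    rw [Set.encard_coe_eq_coe_finsetCard]
    congr 1
    omega

end IsLocalNullity

end NullityMatroid

/-! ### Subtransversals as graphs of partial states -/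

section Graph

variable {α : Type*} [DecidableEq α]

/-- The subtransversal on the classes in `A` that corresponds to the state `φ`. -/
def stateGraph (A : Finset α) (φ : α → Fin 3) : Finset (α × Fin 3) := A.image fun a => (a, φ a)

theorem mem_stateGraph {A : Finset α} {φ : α → Fin 3} {x : α × Fin 3} :
    x ∈ stateGraph A φ ↔ x.1 ∈ A ∧ φ x.1 = x.2 := by
  obtain ⟨a, k⟩ := x
  simp only [stateGraph, Finset.mem_image, Prod.mk.injEq]
  constructor
  · rintro ⟨b, hb, rfl, rfl⟩; exact ⟨hb, rfl⟩
  · rintro ⟨ha, rfl⟩; exact ⟨a, ha, rfl, rfl⟩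

theorem card_stateGraph (A : Finset α) (φ : α → Fin 3) : (stateGraph A φ).card = A.card :=
  Finset.card_image_of_injective _ fun _ _ h => (Prod.mk.inj h).1

theorem stateGraph_congr {A : Finset α} {φ ψ : α → Fin 3} (h : ∀ a ∈ A, φ a = ψ a) :
    stateGraph A φ = stateGraph A ψ :=
  Finset.image_congr fun a ha => by rw [h a ha]

theorem stateGraph_insert_update {A : Finset α} {a : α} (ha : a ∉ A) (φ : α → Fin 3) (j : Fin 3) :
    stateGraph (insert a A) (update φ a j) = insert (a, j) (stateGraph A φ) := by
  rw [stateGraph, Finset.image_insert, update_self]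
  congr 1
  exact stateGraph_congr fun b hb => update_of_ne (ne_of_mem_of_not_mem hb ha) _ _

theorem omega_eq_stateGraph (E X : Finset α) :
    SetFamily.omega E X = stateGraph E (statePt (fun _ => 0) (fun _ => 1) X) := rfl

theorem exists_eq_stateGraph {S : Finset (α × Fin 3)} (h : ∀ x ∈ S, ∀ y ∈ S, x.1 = y.1 → x = y) :
    ∃ φ, S = stateGraph (S.image Prod.fst) φ := by
  have : ∀ a, ∃ k, a ∈ S.image Prod.fst → (a, k) ∈ S := by
    intro a
    by_cases ha : a ∈ S.image Prod.fst
    · obtain ⟨x, hx, rfl⟩ := Finset.mem_image.1 ha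
      exact ⟨x.2, fun _ => hx⟩
    · exact ⟨0, fun h => absurd h ha⟩
  choose φ hφ using this
  refine ⟨φ, ?_⟩
  ext x
  rw [mem_stateGraph]
  constructor
  · intro hx
    have hx1 := Finset.mem_image_of_mem Prod.fst hx
    exact ⟨hx1, congrArg Prod.snd (h _ (hφ _ hx1) x hx rfl)⟩
  · rintro ⟨h1, h2⟩
    have := hφ x.1 h1
    rwa [h2] at this

namespace RankSystem

variable {Z : RankSystem α} {E : Finset α} {K : Finset (Fin 3)}

theorem isSubtransversal_iff {S : Finset (α × Fin 3)} :
    Z.IsSubtransversal S ↔ S ⊆ Z.U ∧ ∀ x ∈ S, ∀ y ∈ S, x.1 = y.1 → x = y := by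
  refine and_congr_right fun hS => ?_
  constructor
  · intro h x hx y hy hxy
    refine Finset.card_le_one.1 (h x.1 (Finset.mem_image_of_mem _ (hS hx))) x ?_ y ?_
    · simp [skewClass, hx, hS hx]
    · simp [skewClass, hy, hS hy, hxy]
  · intro h a _
    refine Finset.card_le_one.2 fun x hx y hy => ?_
    simp only [skewClass, Finset.mem_inter, Finset.mem_filter] at hx hy
    exact h x hx.1 y hy.1 (hx.2.2.trans hy.2.2.symm)

theorem IsSubtransversal.exists_stateGraph {S : Finset (α × Fin 3)} (h : Z.IsSubtransversal S) :
    ∃ A ⊆ Z.classes, ∃ φ, S = stateGraph A φ := by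
  rw [isSubtransversal_iff] at h
  obtain ⟨φ, hφ⟩ := exists_eq_stateGraph h.2
  exact ⟨_, Finset.image_subset_image h.1, φ, hφ⟩

theorem IsSubtransversal.card_le {S : Finset (α × Fin 3)} (h : Z.IsSubtransversal S) :
    S.card ≤ Z.classes.card := by
  obtain ⟨A, hA, φ, rfl⟩ := h.exists_stateGraph
  rw [card_stateGraph]
  exact Finset.card_le_card hA

theorem IsTransversal.exists_stateGraph {T : Finset (α × Fin 3)} (h : Z.IsTransversal T) :
    ∃ φ, T = stateGraph Z.classes φ := by
  obtain ⟨A, hA, φ, rfl⟩ := h.1.exists_stateGraph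
  have := h.2
  rw [card_stateGraph] at this
  rw [Finset.eq_of_subset_of_card_le hA this.ge]
  exact ⟨φ, rfl⟩

theorem IsNearTransversal.exists_stateGraph {S : Finset (α × Fin 3)} (h : Z.IsNearTransversal S) :
    ∃ a ∈ Z.classes, ∃ φ, S = stateGraph (Z.classes.erase a) φ := by
  obtain ⟨A, hA, φ, rfl⟩ := h.1.exists_stateGraph
  have hc := h.2
  rw [card_stateGraph] at hc
  have h1 : (Z.classes \ A).card = 1 := by
    have := Finset.card_sdiff_add_card_eq_card hA
    omega
  obtain ⟨a, ha⟩ := Finset.card_eq_one.1 h1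
  have ha' : a ∈ Z.classes \ A := by simp [ha]
  rw [Finset.mem_sdiff] at ha'
  refine ⟨a, ha'.1, φ, congrArg (stateGraph · φ) ?_⟩
  refine Finset.eq_of_subset_of_card_le (fun b hb => ?_) ?_
  · exact Finset.mem_erase.2 ⟨ne_of_mem_of_not_mem hb ha'.2, hA hb⟩
  · rw [Finset.card_erase_of_mem ha'.1]; omega

theorem classes_eq (hU : Z.U = E ×ˢ K) (hK : K.Nonempty) : Z.classes = E := by
  rw [classes, hU]
  ext a
  simp only [Finset.mem_image, Finset.mem_product, Prod.exists, exists_and_right, exists_eq_right]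
  obtain ⟨k, hk⟩ := hK
  exact ⟨fun ⟨_, h⟩ => h.1, fun h => ⟨k, h, hk⟩⟩

theorem isSubtransversal_stateGraph (hU : Z.U = E ×ˢ K) {A : Finset α} (hA : A ⊆ E) {φ : α → Fin 3}
    (hφ : ∀ a ∈ A, φ a ∈ K) : Z.IsSubtransversal (stateGraph A φ) := by
  rw [isSubtransversal_iff, hU]
  refine ⟨fun x hx => ?_, fun x hx y hy hxy => ?_⟩
  · rw [mem_stateGraph] at hx
    exact Finset.mem_product.2 ⟨hA hx.1, hx.2 ▸ hφ _ hx.1⟩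
  · rw [mem_stateGraph] at hx hy
    exact Prod.ext hxy (by rw [← hx.2, ← hy.2, hxy])

theorem isBasis_iff_of_card {T : Finset (α × Fin 3)} (h : Z.IsTransversal T) :
    Z.IsBasis T ↔ Z.rank T = T.card := by
  constructor
  · exact fun hB => hB.prop.2
  · intro hr
    refine ⟨⟨h.1, hr⟩, fun S hS hTS => ?_⟩
    exact (Finset.eq_of_subset_of_card_le hTS (hS.1.card_le.trans h.2.ge)).ge

/-- Reduces independence in a system given by bases to containment in a basis. Non-emptiness
matters: over an empty collection the supremum is 0, and the empty set would have full rank without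
lying in a basis. -/
theorem rank_ofBases_eq_card {U : Finset (α × Fin 3)} {𝓑 : Set (Finset (α × Fin 3))}
    (h𝓑 : 𝓑.Nonempty) (S : Finset (α × Fin 3)) :
    (ofBases U 𝓑).rank S = S.card ↔ ∃ B ∈ 𝓑, S ⊆ B := by
  change sSup _ = _ ↔ _
  have hbdd : BddAbove ((fun B => (B ∩ S).card) '' 𝓑) := by
    refine ⟨S.card, ?_⟩
    rintro _ ⟨B, -, rfl⟩
    exact Finset.card_le_card Finset.inter_subset_right
  constructor
  · intro h
    obtain ⟨B, hB, hBS⟩ := Nat.sSup_mem (h𝓑.image _) hbdd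
    refine ⟨B, hB, ?_⟩
    rw [h] at hBS
    have := Finset.eq_of_subset_of_card_le (Finset.inter_subset_right (s₁ := B) (s₂ := S)) hBS.ge
    exact Finset.inter_eq_right.1 this
  · rintro ⟨B, hB, hSB⟩
    refine le_antisymm (csSup_le (h𝓑.image _) ?_) (le_csSup hbdd ⟨B, hB, ?_⟩)
    · rintro _ ⟨B, -, rfl⟩
      exact Finset.card_le_card Finset.inter_subset_right
    · exact congrArg Finset.card (Finset.inter_eq_right.2 hSB)

end RankSystem

end Graph

/-! ### Nullity of partial states -/

section RelativeNullity

variable {α : Type*}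

/-- The least nullity of a state that agrees with `φ` on `A`. -/
noncomputable def relNullity (n : (α → Fin 3) → ℕ) (A : Finset α) (φ : α → Fin 3) : ℕ :=
  sInf (n '' {ψ | ∀ a ∈ A, ψ a = φ a})

variable {n : (α → Fin 3) → ℕ} {E A : Finset α} {φ ψ : α → Fin 3}

theorem relNullity_le (h : ∀ a ∈ A, ψ a = φ a) : relNullity n A φ ≤ n ψ :=
  Nat.sInf_le ⟨ψ, h, rfl⟩

theorem exists_relNullity (n : (α → Fin 3) → ℕ) (A : Finset α) (φ : α → Fin 3) :
    ∃ ψ, (∀ a ∈ A, ψ a = φ a) ∧ n ψ = relNullity n A φ :=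
  Nat.sInf_mem (s := n '' {ψ | ∀ a ∈ A, ψ a = φ a}) ⟨_, φ, fun _ _ => rfl, rfl⟩

theorem relNullity_mono {B : Finset α} (h : A ⊆ B) (φ : α → Fin 3) :
    relNullity n A φ ≤ relNullity n B φ := by
  obtain ⟨ψ, hψ, he⟩ := exists_relNullity n B φ
  rw [← he]
  exact relNullity_le fun a ha => hψ a (h ha)

theorem relNullity_empty (h0 : ∃ φ, n φ = 0) (φ : α → Fin 3) : relNullity n ∅ φ = 0 := by
  obtain ⟨ψ, hψ⟩ := h0
  have := relNullity_le (n := n) (A := ∅) (φ := φ) (ψ := ψ) (by simp)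
  omega

variable [DecidableEq α]

theorem relNullity_ground (h : IsTightOn E n) (φ : α → Fin 3) : relNullity n E φ = n φ := by
  obtain ⟨ψ, hψ, he⟩ := exists_relNullity n E φ
  rw [← he, h.congr ψ φ hψ]

theorem relNullity_insert_le (h : IsTightOn E n) {a : α} (ha : a ∈ E) (A : Finset α)
    (φ : α → Fin 3) : relNullity n (insert a A) φ ≤ relNullity n A φ + 1 := by
  obtain ⟨ψ, hψ, he⟩ := exists_relNullity n A φ
  rw [← he]
  refine le_trans (relNullity_le (ψ := update ψ a (φ a)) fun b hb => ?_) (h.update_le_add_one ψ ha _)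
  by_cases hba : b = a
  · subst hba; simp
  · rw [update_of_ne hba]; exact hψ b (Finset.mem_of_mem_insert_of_ne hb hba)

/-- An optimal completion sees the least nullity as the base of its line at `a`, and at most one of
`i`, `j` is the slack position. In terms of ranks this is the skew pair axiom. -/
theorem relNullity_update_add_le (h : IsTightOn E n) {a : α} (ha : a ∈ E) (haA : a ∉ A)
    (φ : α → Fin 3) {i j : Fin 3} (hij : i ≠ j) :
    relNullity n (insert a A) (update φ a i) + relNullity n (insert a A) (update φ a j) ≤
      2 * relNullity n A φ + 1 := by
  obtain ⟨ψ, hψ, he⟩ := exists_relNullity n A φ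
  have key : ∀ j, relNullity n (insert a A) (update φ a j) ≤ n (update ψ a j) := fun j =>
    relNullity_le fun b hb => by
      by_cases hba : b = a
      · subst hba; simp
      · rw [update_of_ne hba, update_of_ne hba]
        exact hψ b (Finset.mem_of_mem_insert_of_ne hb hba)
  have hmin : ∀ j, relNullity n A φ ≤ n (update ψ a j) := fun j =>
    relNullity_le fun b hb => by
      rw [update_of_ne (ne_of_mem_of_not_mem hb haA)]; exact hψ b hb
  obtain ⟨m, k, h1, h2⟩ := h.line_cases ψ ha
  have ki := key i
  have kj := key j
  have hm : m = relNullity n A φ := by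
    have := hmin (k + 1)
    rw [h2, if_neg (by generalize k = x; revert x; decide)] at this
    split_ifs at h1 <;> omega
  rw [h2] at ki kj
  split_ifs at ki kj <;> omega

/-- Otherwise an optimal completion `ψ` on `A ∪ {a, b}` has nullity only one above the minimum for
`A`. Changing a coordinate outside `A` preserves agreement on `A ∪ {a}` or on `A ∪ {b}`, so cannot
go lower; `ψ` is then a local and hence global minimum over completions of `A`, a contradiction. -/
theorem relNullity_local_supermodular (h : IsTightOn E n) {a b : α} (haA : a ∉ A) (hab : a ≠ b) (φ : α → Fin 3)
    (h1 : relNullity n (insert a A) φ = relNullity n A φ + 1)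
    (h2 : relNullity n (insert b A) φ = relNullity n A φ + 1) :
    relNullity n A φ + 2 ≤ relNullity n (insert a (insert b A)) φ := by
  by_contra! hlt
  obtain ⟨ψ, hψ, he⟩ := exists_relNullity n (insert a (insert b A)) φ
  obtain ⟨χ, hχ, he'⟩ := exists_relNullity n A φ
  have := h.le_of_local_min (W := E \ A) ψ (fun c hc j => ?_) χ fun c hc hcA => ?_
  · have h3 := relNullity_mono (n := n) (A := insert a A) (B := insert a (insert b A))
      (Finset.insert_subset_insert _ (Finset.subset_insert _ _)) φ
    omega
  · rw [Finset.mem_sdiff] at hc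
    have hle : n ψ ≤ relNullity n A φ + 1 := by omega
    refine hle.trans ?_
    by_cases hca : c = a
    · subst hca
      rw [← h2]
      refine relNullity_le fun d hd => ?_
      rw [update_of_ne (ne_of_mem_of_not_mem hd (by simp [hab, haA]))]
      exact hψ d (Finset.mem_insert_of_mem hd)
    · rw [← h1]
      refine relNullity_le fun d hd => ?_
      rw [update_of_ne (ne_of_mem_of_not_mem hd (by simp [hca, hc.2]))]
      exact hψ d (Finset.insert_subset_insert _ (Finset.subset_insert _ _) hd)
  · have hcA : c ∈ A := by simpa [hc] using hcA
    rw [hχ c hcA, hψ c (by simp [hcA])]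

end RelativeNullity

/-! ### The tight 3-matroid of a nullity function, and its uniqueness -/

section TightMultimatroid

variable {α : Type*} [DecidableEq α] {n : (α → Fin 3) → ℕ} {E : Finset α}

theorem relNullity_le_card (h : IsTightOn E n) (h0 : ∃ φ, n φ = 0) {A : Finset α} (hA : A ⊆ E)
    (φ : α → Fin 3) : relNullity n A φ ≤ A.card := by
  induction A using Finset.induction_on with
  | empty => rw [relNullity_empty h0]; exact Nat.zero_le _
  | insert a A haA ih =>
    have h1 := ih fun b hb => hA (Finset.mem_insert_of_mem hb)
    have h2 := relNullity_insert_le h (hA (Finset.mem_insert_self a A)) A φ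
    rw [Finset.card_insert_of_notMem haA]
    omega

namespace RankSystem

/-- The rank system on three-element classes with the nullity function `n`. -/
noncomputable def ofNullity (E : Finset α) (n : (α → Fin 3) → ℕ) : RankSystem α :=
  ⟨E ×ˢ Finset.univ, fun S => S.card - sInf (n '' {ψ | ∀ x ∈ S, ψ x.1 = x.2})⟩

theorem classes_ofNullity : (ofNullity E n).classes = E :=
  classes_eq (K := Finset.univ) rfl Finset.univ_nonempty

theorem sInf_stateGraph (A : Finset α) (φ : α → Fin 3) :
    sInf (n '' {ψ | ∀ x ∈ stateGraph A φ, ψ x.1 = x.2}) = relNullity n A φ := by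
  unfold relNullity
  congr 2
  ext ψ
  constructor
  · intro h a ha
    exact h (a, φ a) (mem_stateGraph.2 ⟨ha, rfl⟩)
  · intro h x hx
    rw [mem_stateGraph] at hx
    rw [h _ hx.1, hx.2]

theorem rank_ofNullity (A : Finset α) (φ : α → Fin 3) :
    (ofNullity E n).rank (stateGraph A φ) = A.card - relNullity n A φ := by
  change (stateGraph A φ).card - _ = _
  rw [card_stateGraph, sInf_stateGraph]

theorem exists_subset_eq_stateGraph {φ : α → Fin 3} {S : Finset (α × Fin 3)}
    (hS : S ⊆ stateGraph E φ) : ∃ A ⊆ E, S = stateGraph A φ := by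
  refine ⟨S.image Prod.fst, fun a ha => ?_, ?_⟩
  · obtain ⟨x, hx, rfl⟩ := Finset.mem_image.1 ha
    exact (mem_stateGraph.1 (hS hx)).1
  · ext x
    rw [mem_stateGraph]
    constructor
    · intro hx
      exact ⟨Finset.mem_image_of_mem _ hx, (mem_stateGraph.1 (hS hx)).2⟩
    · rintro ⟨h1, h2⟩
      obtain ⟨y, hy, hyx⟩ := Finset.mem_image.1 h1
      have := (mem_stateGraph.1 (hS hy)).2
      rwa [show x = y from Prod.ext hyx.symm (by rw [← h2, ← this, hyx])]

theorem isLocalNullity_stateGraph (h : IsTightOn E n) (h0 : ∃ φ, n φ = 0) (φ : α → Fin 3) :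
    IsLocalNullity (stateGraph E φ) fun S => sInf (n '' {ψ | ∀ x ∈ S, ψ x.1 = x.2}) := by
  have hins : ∀ (A : Finset α) (x : α × Fin 3), x ∈ stateGraph E φ →
      insert x (stateGraph A φ) = stateGraph (insert x.1 A) φ := by
    intro A x hx
    rw [mem_stateGraph] at hx
    rw [stateGraph, stateGraph, Finset.image_insert, hx.2]
  have hnot : ∀ (A : Finset α) (x : α × Fin 3), x ∈ stateGraph E φ → x ∉ stateGraph A φ →
      x.1 ∉ A := by
    intro A x hx hxA hc
    exact hxA (mem_stateGraph.2 ⟨hc, (mem_stateGraph.1 hx).2⟩)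
  constructor
  · have := sInf_stateGraph (n := n) ∅ φ
    rw [relNullity_empty h0] at this
    simpa [stateGraph] using this
  · intro S T hST hT
    obtain ⟨B, hB, rfl⟩ := exists_subset_eq_stateGraph hT
    obtain ⟨A, hA, rfl⟩ := exists_subset_eq_stateGraph hST
    simp only [sInf_stateGraph]
    exact relNullity_mono hA φ
  · intro S hS x hx
    obtain ⟨A, hA, rfl⟩ := exists_subset_eq_stateGraph hS
    simp only [hins A x hx, sInf_stateGraph]
    exact relNullity_insert_le h (mem_stateGraph.1 hx).1 A φ
  · intro S hS x hx y hy hxS hyS hxy h1 h2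
    obtain ⟨A, hA, rfl⟩ := exists_subset_eq_stateGraph hS
    simp only [hins _ x hx, hins _ y hy, sInf_stateGraph] at h1 h2 ⊢
    refine relNullity_local_supermodular h (hnot A x hx hxS) (fun hc => hxy ?_) φ h1 h2
    rw [mem_stateGraph] at hx hy
    exact Prod.ext hc (by rw [← hx.2, ← hy.2, hc])

theorem isSlack_stateGraph_iff {Z : RankSystem α} (hU : Z.U = E ×ˢ Finset.univ) {a : α}
    (ha : a ∈ E) (φ : α → Fin 3) (x : α × Fin 3) :
    Z.IsSlack (stateGraph (E.erase a) φ) x ↔ x.1 = a ∧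
      Z.rank (stateGraph E (update φ a x.2)) = Z.rank (stateGraph (E.erase a) φ) := by
  have hins : x.1 = a → insert x (stateGraph (E.erase a) φ) = stateGraph E (update φ a x.2) := by
    rintro rfl
    have := stateGraph_insert_update (Finset.notMem_erase x.1 E) φ x.2
    rw [Finset.insert_erase ha] at this
    exact this.symm
  constructor
  · rintro ⟨h1, h2, h3⟩
    rw [hU, Finset.mem_product] at h1
    have hxa : x.1 = a := by
      by_contra hne
      have : (x.1, φ x.1) ∈ stateGraph (E.erase a) φ :=
        mem_stateGraph.2 ⟨Finset.mem_erase.2 ⟨hne, h1.1⟩, rfl⟩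
      refine Finset.disjoint_left.1 h2 this ?_
      simp [skewClass, hU, h1.1]
    exact ⟨hxa, by rw [← hins hxa, h3]⟩
  · rintro ⟨hxa, h⟩
    refine ⟨by simp [hU, hxa, ha], ?_, by rw [hins hxa, h]⟩
    rw [Finset.disjoint_left]
    intro y hy hy'
    rw [mem_stateGraph] at hy
    simp only [skewClass, Finset.mem_filter] at hy'
    exact Finset.ne_of_mem_erase hy.1 (hy'.2.trans hxa)

/-- The transversal matroids come from `exists_matroid`. The slack element of a near-transversal is
the exceptional position of the line that it determines. -/
theorem isTight_ofNullity (h : IsTightOn E n) (h0 : ∃ φ, n φ = 0) : (ofNullity E n).IsTight := by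
  refine ⟨⟨fun T hT => ?_, fun S hS a ha hdis x hx y hy hxy => ?_⟩, fun a ha => ?_, fun S hS => ?_⟩
  · obtain ⟨φ, rfl⟩ := hT.exists_stateGraph
    rw [classes_ofNullity]
    obtain ⟨M, hE, hM⟩ := (isLocalNullity_stateGraph h h0 φ).exists_matroid
    exact ⟨M, hE, hM⟩
  · obtain ⟨A, hA, φ, rfl⟩ := hS.exists_stateGraph
    rw [classes_ofNullity] at hA ha
    obtain ⟨x1, i⟩ := x
    obtain ⟨y1, j⟩ := y
    simp only [skewClass, Finset.mem_filter] at hx hy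
    obtain ⟨-, rfl⟩ := hx
    obtain ⟨-, rfl⟩ := hy
    have hij : i ≠ j := fun hc => hxy (by rw [hc])
    have haA : y1 ∉ A := by
      intro hc
      refine Finset.disjoint_left.1 hdis (mem_stateGraph.2 ⟨hc, rfl⟩ : (y1, φ y1) ∈ _) ?_
      simp [skewClass, ofNullity, ha]
    rw [← stateGraph_insert_update haA, ← stateGraph_insert_update haA, rank_ofNullity,
      rank_ofNullity, rank_ofNullity, Finset.card_insert_of_notMem haA]
    have h1 := relNullity_update_add_le h ha haA φ hij
    have h2 := relNullity_le_card h h0 hA φ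
    omega
  · rw [classes_ofNullity] at ha
    have : (ofNullity E n).skewClass a = {a} ×ˢ Finset.univ := by
      ext x
      simp only [skewClass, ofNullity, Finset.mem_filter, Finset.mem_product, Finset.mem_univ,
        and_true, Finset.mem_singleton]
      exact ⟨fun hx => hx.2, fun hx => ⟨hx ▸ ha, hx⟩⟩
    rw [this, Finset.card_product]
    simp
  · obtain ⟨a, ha, φ, rfl⟩ := hS.exists_stateGraph
    rw [classes_ofNullity] at ha ⊢
    obtain ⟨m, k, hk⟩ := h.line φ a ha
    -- The near-transversal has the base value as nullity, so its rank is kept exactly at the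
    -- position where the transversal has nullity `m + 1`.
    have hrel : relNullity n (E.erase a) φ = m := by
      obtain ⟨ψ, hψ, he⟩ := exists_relNullity n (E.erase a) φ
      refine le_antisymm ?_ ?_
      · have := hk (k + 1)
        rw [if_neg (by generalize k = x; revert x; decide), Nat.add_zero] at this
        rw [← this]
        exact relNullity_le fun b hb => update_of_ne (Finset.ne_of_mem_erase hb) _ _
      · rw [← he, h.congr ψ (update φ a (ψ a)) fun b hb => ?_, hk]
        · exact Nat.le_add_right _ _
        · by_cases hba : b = a
          · subst hba; simp
          · rw [update_of_ne hba, hψ b (Finset.mem_erase.2 ⟨hba, hb⟩)]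
    have hm := relNullity_le_card h h0 (Finset.erase_subset a E) φ
    have hcard := Finset.card_erase_add_one ha
    have hiff : ∀ x : α × Fin 3, (ofNullity E n).IsSlack (stateGraph (E.erase a) φ) x ↔
        x.1 = a ∧ x.2 = k := by
      intro x
      rw [isSlack_stateGraph_iff rfl ha, rank_ofNullity, rank_ofNullity, relNullity_ground h, hk,
        hrel]
      refine and_congr_right fun _ => ?_
      split_ifs with hc
      · simp only [hc, iff_true]; omega
      · simp only [hc, iff_false]; omega
    refine ⟨(a, k), (hiff _).2 ⟨rfl, rfl⟩, fun x hx => ?_⟩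
    exact Prod.ext ((hiff x).1 hx).1 ((hiff x).1 hx).2

end RankSystem

namespace SetFamily

variable {D : SetFamily α}

theorem statePt_filter {φ : α → Fin 3} (hφ : ∀ a ∈ E, φ a ≠ 2) :
    ∀ a ∈ E, statePt (fun _ => 0) (fun _ => 1) (E.filter fun a => φ a = 0) a = φ a := by
  intro a ha
  have : ∀ x : Fin 3, x ≠ 2 → (if x = 0 then 0 else 1) = x := by decide
  simpa [statePt, ha] using this _ (hφ a ha)

theorem HasNullity.filter_mem_feasible (h : D.HasNullity n) {φ : α → Fin 3}
    (hφ : ∀ a ∈ D.ground, φ a ≠ 2) :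
    (D.ground.filter fun a => φ a = 0) ∈ D.feasible ↔ n φ = 0 := by
  rw [h.mem_feasible, h.tight.congr _ φ (statePt_filter hφ)]
  exact and_iff_right (Finset.filter_subset _ _)

theorem HasNullity.nonempty (h : D.HasNullity n) : D.feasible.Nonempty := by
  obtain ⟨φ, hφ⟩ := h.exists_zero
  obtain ⟨ψ, h1, h2, -⟩ := h.tight.exists_zero_dotBar D.ground subset_rfl φ hφ
  exact ⟨_, (h.filter_mem_feasible h2).2 h1⟩

theorem HasNullity.isIndep_Z2 (h : D.HasNullity n) {S : Finset (α × Fin 3)} :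
    D.Z2.IsIndep S ↔ D.Z2.IsSubtransversal S ∧ ∃ X ∈ D.feasible, S ⊆ omega D.ground X := by
  refine and_congr_right fun _ => ?_
  obtain ⟨F, hF⟩ := h.nonempty
  have hB : {B | ∃ X ∈ D.feasible, B = omega D.ground X}.Nonempty := ⟨_, F, hF, rfl⟩
  refine (RankSystem.rank_ofBases_eq_card (U := dotBar D.ground) hB S).trans ?_
  constructor
  · rintro ⟨_, ⟨X, hX, rfl⟩, hS⟩; exact ⟨X, hX, hS⟩
  · rintro ⟨X, hX, hS⟩; exact ⟨_, ⟨X, hX, rfl⟩, hS⟩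

theorem dotBar_eq_inter : E ×ˢ (Finset.univ : Finset (Fin 3)) ∩ dotBar E = dotBar E :=
  Finset.inter_eq_right.2 (Finset.product_subset_product_right (Finset.subset_univ _))

theorem classes_Z2 (D : SetFamily α) : D.Z2.classes = D.ground :=
  RankSystem.classes_eq (K := {0, 1}) rfl (by simp)

theorem state_ne_two_of_subset_dotBar {A : Finset α} {φ : α → Fin 3}
    (h : stateGraph A φ ⊆ dotBar E) : ∀ a ∈ A, φ a ≠ 2 := by
  intro a ha hc
  have := h (mem_stateGraph.2 ⟨ha, rfl⟩ : (a, φ a) ∈ _)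
  simp [dotBar, hc] at this

/-- Supplies the witness that makes the choice in `Z3` meaningful. For a hat-free subtransversal, a
completion to a zero can be freed of hats without touching the prescribed coordinates, so
independence means extension to a feasible set. -/
theorem HasNullity.isZ3_ofNullity (h : D.HasNullity n) :
    D.IsZ3 (RankSystem.ofNullity D.ground n) := by
  have hU : ((RankSystem.ofNullity D.ground n).restrict (dotBar D.ground)).U = D.Z2.U :=
    dotBar_eq_inter
  refine ⟨rfl, RankSystem.isTight_ofNullity h.tight h.exists_zero, hU, fun B => ?_⟩
  suffices hind : ((RankSystem.ofNullity D.ground n).restrict (dotBar D.ground)).IsIndep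
      = D.Z2.IsIndep by
    unfold RankSystem.IsBasis
    rw [hind]
  funext S
  rw [eq_iff_iff, h.isIndep_Z2]
  have hsub : ((RankSystem.ofNullity D.ground n).restrict (dotBar D.ground)).IsSubtransversal S ↔
      D.Z2.IsSubtransversal S := by
    rw [RankSystem.isSubtransversal_iff, RankSystem.isSubtransversal_iff, hU]
  unfold RankSystem.IsIndep
  rw [hsub]
  refine and_congr_right fun hS => ?_
  obtain ⟨A, hA, φ, rfl⟩ := hS.exists_stateGraph
  rw [classes_Z2] at hA
  have hφ := state_ne_two_of_subset_dotBar hS.1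
  change (RankSystem.ofNullity D.ground n).rank _ = _ ↔ _
  rw [RankSystem.rank_ofNullity, card_stateGraph]
  have hle := relNullity_le_card h.tight h.exists_zero hA φ
  have hz : A.card - relNullity n A φ = A.card ↔ relNullity n A φ = 0 := by omega
  rw [hz]
  constructor
  · intro h0
    obtain ⟨ψ, hψ, he⟩ := exists_relNullity n A φ
    obtain ⟨χ, h1, h2, h3⟩ := h.tight.exists_zero_dotBar D.ground subset_rfl ψ (he.trans h0)
    refine ⟨_, (h.filter_mem_feasible h2).2 h1, fun x hx => ?_⟩
    rw [omega_eq_stateGraph, stateGraph_congr (statePt_filter h2)]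
    rw [mem_stateGraph] at hx ⊢
    refine ⟨hA hx.1, ?_⟩
    rw [h3 x.1 (Or.inr (by rw [hψ _ hx.1]; exact hφ _ hx.1)), hψ _ hx.1, hx.2]
  · rintro ⟨X, hX, hsub⟩
    rw [omega_eq_stateGraph] at hsub
    have h1 := ((h.mem_feasible X).1 hX).2
    have h2 := relNullity_le (n := n) (A := A) (φ := φ)
      (ψ := statePt (fun _ => 0) (fun _ => 1) X) fun a ha =>
        (mem_stateGraph.1 (hsub (mem_stateGraph.2 ⟨ha, rfl⟩ : (a, φ a) ∈ _))).2
    omega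

theorem HasNullity.isZ3_Z3 (h : D.HasNullity n) : D.IsZ3 D.Z3 :=
  Classical.epsilon_spec ⟨_, h.isZ3_ofNullity⟩

theorem omega_injOn {X Y : Finset α} (hX : X ⊆ E) (hY : Y ⊆ E) (h : omega E X = omega E Y) :
    X = Y := by
  ext a
  rw [omega_eq_stateGraph, omega_eq_stateGraph] at h
  by_cases ha : a ∈ E
  · have h1 : (a, statePt (fun _ => 0) (fun _ => 1) X a) ∈
        stateGraph E (statePt (fun _ => 0) (fun _ => 1) X) :=
      mem_stateGraph.2 ⟨ha, rfl⟩
    rw [h, mem_stateGraph] at h1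
    have h2 := h1.2
    by_cases haX : a ∈ X <;> by_cases haY : a ∈ Y <;> simp_all [statePt]
  · exact ⟨fun hc => absurd (hX hc) ha, fun hc => absurd (hY hc) ha⟩

/-- The ranks of transversals and of sets with one element less. -/
theorem IsZ3.rank_step {Z : RankSystem α} (hZ : D.IsZ3 Z) {a : α} (ha : a ∈ D.ground)
    (φ : α → Fin 3) (j : Fin 3) :
    Z.rank (stateGraph (D.ground.erase a) φ) ≤ Z.rank (stateGraph D.ground (update φ a j)) ∧
    Z.rank (stateGraph D.ground (update φ a j)) ≤ Z.rank (stateGraph (D.ground.erase a) φ) + 1 ∧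
    Z.rank (stateGraph (D.ground.erase a) φ) + 1 ≤ D.ground.card := by
  have hc : Z.classes = D.ground := RankSystem.classes_eq hZ.1 Finset.univ_nonempty
  have hT : Z.IsTransversal (stateGraph D.ground (update φ a j)) :=
    ⟨RankSystem.isSubtransversal_stateGraph hZ.1 subset_rfl fun _ _ => Finset.mem_univ _,
      by rw [card_stateGraph, hc]⟩
  obtain ⟨M, -, hM⟩ := hZ.2.1.isMultimatroid.matroid _ hT
  have hins := stateGraph_insert_update (Finset.notMem_erase a D.ground) φ j
  rw [Finset.insert_erase ha] at hins
  have hsub : stateGraph (D.ground.erase a) φ ⊆ stateGraph D.ground (update φ a j) := by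
    rw [hins]; exact Finset.subset_insert _ _
  have e1 := hM _ hsub
  have e2 := hM _ subset_rfl
  have h1 := M.eRk_mono (Finset.coe_subset.2 hsub)
  have h2 := M.eRk_insert_le_add_one (a, j) (stateGraph (D.ground.erase a) φ)
  rw [← Finset.coe_insert, ← hins] at h2
  have h3 := M.eRk_le_encard (stateGraph (D.ground.erase a) φ)
  rw [Set.encard_coe_eq_coe_finsetCard, card_stateGraph] at h3
  rw [e1, e2] at h1 h2
  rw [e1] at h3
  have hcard := Finset.card_erase_add_one ha
  norm_cast at h1 h2 h3
  exact ⟨h1, h2, by omega⟩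

/-- The rank of the near-transversal is kept at its unique slack element and rises by one at the
other two. The bound in `rank_step` keeps the truncated subtraction harmless. -/
theorem IsZ3.isTightOn {Z : RankSystem α} (hZ : D.IsZ3 Z) :
    IsTightOn D.ground fun φ => D.ground.card - Z.rank (stateGraph D.ground φ) where
  congr φ ψ h := by rw [stateGraph_congr h]
  line φ a ha := by
    have hc : Z.classes = D.ground := RankSystem.classes_eq hZ.1 Finset.univ_nonempty
    have hS : Z.IsNearTransversal (stateGraph (D.ground.erase a) φ) :=
      ⟨RankSystem.isSubtransversal_stateGraph hZ.1 (Finset.erase_subset _ _)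
        fun _ _ => Finset.mem_univ _, by
          rw [card_stateGraph, hc, Finset.card_erase_add_one ha]⟩
    obtain ⟨x, hx, huniq⟩ := hZ.2.1.existsUnique_slack _ hS
    rw [RankSystem.isSlack_stateGraph_iff hZ.1 ha] at hx
    refine ⟨D.ground.card - 1 - Z.rank (stateGraph (D.ground.erase a) φ), x.2, fun j => ?_⟩
    obtain ⟨h1, h2, h3⟩ := hZ.rank_step ha φ j
    by_cases hj : j = x.2
    · rw [if_pos hj, hj, hx.2]
      omega
    · rw [if_neg hj]
      have h4 : Z.rank (stateGraph D.ground (update φ a j)) ≠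
          Z.rank (stateGraph (D.ground.erase a) φ) := by
        intro he
        have := huniq (a, j) ((RankSystem.isSlack_stateGraph_iff hZ.1 ha φ _).2 ⟨rfl, he⟩)
        exact hj (congrArg Prod.snd this)
      omega

/-- The nullity function of `Z_[3](D)` is determined by `D`. -/
theorem HasNullity.nullity_eq (h : D.HasNullity n) {Z : RankSystem α} (hZ : D.IsZ3 Z)
    (φ : α → Fin 3) : D.ground.card - Z.rank (stateGraph D.ground φ) = n φ := by
  have ht := hZ.isTightOn
  have hc : Z.classes = D.ground := RankSystem.classes_eq hZ.1 Finset.univ_nonempty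
  have hrU : (Z.restrict (dotBar D.ground)).U = dotBar D.ground := by
    change Z.U ∩ _ = _
    rw [hZ.1, dotBar_eq_inter]
  have hrank : ∀ φ : α → Fin 3, Z.rank (stateGraph D.ground φ) ≤ D.ground.card := by
    intro φ
    have hT : Z.IsTransversal (stateGraph D.ground φ) :=
      ⟨RankSystem.isSubtransversal_stateGraph hZ.1 subset_rfl fun _ _ => Finset.mem_univ _,
        by rw [card_stateGraph, hc]⟩
    obtain ⟨M, -, hM⟩ := hZ.2.1.isMultimatroid.matroid _ hT
    have h3 := M.eRk_le_encard (stateGraph D.ground φ)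
    rw [hM _ subset_rfl, Set.encard_coe_eq_coe_finsetCard, card_stateGraph] at h3
    exact_mod_cast h3
  have hz : ∀ φ : α → Fin 3, (∀ a ∈ D.ground, φ a ≠ 2) →
      (D.ground.card - Z.rank (stateGraph D.ground φ) = 0 ↔ n φ = 0) := by
    intro φ hφ
    have hK : ∀ a ∈ D.ground, φ a ∈ ({0, 1} : Finset (Fin 3)) := by
      intro a ha
      have : ∀ x : Fin 3, x ≠ 2 → x ∈ ({0, 1} : Finset (Fin 3)) := by decide
      exact this _ (hφ a ha)
    have hT1 : (Z.restrict (dotBar D.ground)).IsTransversal (stateGraph D.ground φ) :=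
      ⟨RankSystem.isSubtransversal_stateGraph hrU subset_rfl hK,
        by rw [card_stateGraph, RankSystem.classes_eq hrU (by simp)]⟩
    have hT2 : D.Z2.IsTransversal (stateGraph D.ground φ) :=
      ⟨RankSystem.isSubtransversal_stateGraph (K := {0, 1}) rfl subset_rfl hK,
        by rw [card_stateGraph, classes_Z2]⟩
    have h1 := hZ.2.2.2 (stateGraph D.ground φ)
    have hB1 := RankSystem.isBasis_iff_of_card hT1
    have hB2 := RankSystem.isBasis_iff_of_card hT2
    have hB3 : D.Z2.IsBasis (stateGraph D.ground φ) ↔ D.Z2.IsIndep (stateGraph D.ground φ) := by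
      rw [hB2]
      exact ⟨fun hh => ⟨hT2.1, hh⟩, fun hh => hh.2⟩
    rw [hB1, hB3, h.isIndep_Z2, card_stateGraph] at h1
    rw [← h.filter_mem_feasible hφ]
    have h2 : (∃ X ∈ D.feasible, stateGraph D.ground φ ⊆ omega D.ground X) ↔
        (D.ground.filter fun a => φ a = 0) ∈ D.feasible := by
      have e : stateGraph D.ground φ = omega D.ground (D.ground.filter fun a => φ a = 0) := by
        rw [omega_eq_stateGraph, stateGraph_congr (statePt_filter hφ)]
      constructor
      · rintro ⟨X, hX, hs⟩
        rw [e] at hs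
        have := Finset.eq_of_subset_of_card_le hs
          (by rw [omega_eq_stateGraph, omega_eq_stateGraph, card_stateGraph, card_stateGraph])
        rwa [omega_injOn (Finset.filter_subset _ _) ((h.mem_feasible X).1 hX).1 this]
      · intro hX
        exact ⟨_, hX, e.subset⟩
    rw [← h2]
    have h3 := hrank φ
    have h4 : (Z.restrict (dotBar D.ground)).rank (stateGraph D.ground φ) =
      Z.rank (stateGraph D.ground φ) := rfl
    rw [h4] at h1
    constructor
    · intro h0
      exact (h1.1 (by omega)).2
    · intro hX
      have := h1.2 ⟨hT2.1, hX⟩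
      omega
  -- The hat-free zeros agree because the bases do; evenness extends this to all zeros, and the
  -- zeros determine the functions.
  have hz' := ht.zero_iff_of_dotBar h.tight hz
  obtain ⟨ψ, hψ⟩ := h.exists_zero
  exact le_antisymm (ht.le_of_zero_imp h.tight h.exists_zero (fun φ => (hz' φ).2) φ)
    (h.tight.le_of_zero_imp ht ⟨ψ, (hz' ψ).2 hψ⟩ (fun φ => (hz' φ).1) φ)

/-- The independent near-transversals of `Z_[3](D)` and their slack elements. -/
theorem HasNullity.isIndep_and_isSlack_iff (h : D.HasNullity n) {Z : RankSystem α} (hZ : D.IsZ3 Z)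
    {a : α} (ha : a ∈ D.ground) (φ : α → Fin 3) (i : Fin 3) :
    (Z.IsIndep (stateGraph (D.ground.erase a) φ) ∧
      Z.IsSlack (stateGraph (D.ground.erase a) φ) (a, i)) ↔
      ∀ j, n (update φ a j) = if j = i then 1 else 0 := by
  rw [RankSystem.isSlack_stateGraph_iff hZ.1 ha]
  have hS : Z.IsSubtransversal (stateGraph (D.ground.erase a) φ) :=
    RankSystem.isSubtransversal_stateGraph hZ.1 (Finset.erase_subset _ _)
        fun _ _ => Finset.mem_univ _
  have hstep := fun j => hZ.rank_step ha φ j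
  have hn := fun j => h.nullity_eq hZ (update φ a j)
  have hcard := Finset.card_erase_add_one ha
  obtain ⟨m, k, hk⟩ := h.tight.line φ a ha
  unfold RankSystem.IsIndep
  rw [card_stateGraph]
  have hki := hk i
  have hki1 := hk (i + 1)
  have s0 := hstep i
  have s1 := hstep (i + 1)
  have n0 := hn i
  have n1 := hn (i + 1)
  have hkk := hk k
  have hkk1 := hk (k + 1)
  rw [if_pos rfl] at hkk
  rw [if_neg (by generalize k = x; revert x; decide)] at hkk1
  have hnk := hn k
  have hnk1 := hn (k + 1)
  have sk := hstep k
  have sk1 := hstep (k + 1)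
  constructor
  · rintro ⟨⟨-, h1⟩, -, h2⟩
    dsimp only at h2
    have hik : i = k := by
      by_contra hne
      rw [if_neg hne] at hki
      omega
    intro j
    rw [hk, hik]
    have : m = 0 := by omega
    omega
  · intro hj
    have hik : k = i := by
      by_contra hne
      have := hj k
      rw [if_neg hne] at this
      omega
    have hi := hj i
    rw [if_pos rfl] at hi
    refine ⟨⟨hS, ?_⟩, rfl, ?_⟩
    · subst hik; omega
    · dsimp only
      subst hik
      omega

end SetFamily

end TightMultimatroid

/-! ### The nullity function of a 2-sum -/

section TwoSum

variable {α : Type*} [DecidableEq α]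

/-- The smaller value of a tight function on the line in direction `a`. -/
def lineBase (n : (α → Fin 3) → ℕ) (a : α) (φ : α → Fin 3) : ℕ :=
  min (n (update φ a 0)) (n (update φ a 1))

/-- The position of the larger value of a tight function on the line in direction `a`. -/
def lineSlack (n : (α → Fin 3) → ℕ) (a : α) (φ : α → Fin 3) : Fin 3 :=
  if n (update φ a 0) ≠ lineBase n a φ then 0
  else if n (update φ a 1) ≠ lineBase n a φ then 1 else 2

variable {E E₁ E₂ : Finset α} {n n₁ n₂ : (α → Fin 3) → ℕ}

theorem IsTightOn.line_eq (h : IsTightOn E n) {a : α} (ha : a ∈ E) (φ : α → Fin 3) (j : Fin 3) :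
    n (update φ a j) = lineBase n a φ + if j = lineSlack n a φ then 1 else 0 := by
  obtain ⟨m, k, hk⟩ := h.line φ a ha
  have hb : lineBase n a φ = m := by
    unfold lineBase
    rw [hk, hk]
    have : ¬ (0 = k ∧ 1 = k) := by clear hk; revert k; decide
    split_ifs <;> omega
  have hs : lineSlack n a φ = k := by
    unfold lineSlack
    rw [hb, hk, hk]
    have : k = 0 ∨ k = 1 ∨ k = 2 := by clear hk; revert k; decide
    rcases this with rfl | rfl | rfl <;> simp
  rw [hb, hs, hk]

theorem lineBase_congr {a : α} {φ ψ : α → Fin 3}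
    (h : ∀ j, n (update φ a j) = n (update ψ a j)) : lineBase n a φ = lineBase n a ψ := by
  unfold lineBase
  rw [h, h]

theorem lineSlack_congr {a : α} {φ ψ : α → Fin 3}
    (h : ∀ j, n (update φ a j) = n (update ψ a j)) : lineSlack n a φ = lineSlack n a ψ := by
  unfold lineSlack
  rw [lineBase_congr h, h, h]

theorem IsTightOn.congr_update (h : IsTightOn E n) {a : α} {φ ψ : α → Fin 3}
    (hφ : ∀ b ∈ E.erase a, φ b = ψ b) (j : Fin 3) : n (update φ a j) = n (update ψ a j) := by
  refine h.congr _ _ fun b hb => ?_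
  by_cases hba : b = a
  · subst hba; simp
  · rw [update_of_ne hba, update_of_ne hba, hφ b (Finset.mem_erase.2 ⟨hba, hb⟩)]

theorem IsTightOn.lineBase_eq_zero (h : IsTightOn E n) {a : α} (ha : a ∈ E) {φ : α → Fin 3}
    (hφ : n φ = 0) : lineBase n a φ = 0 ∧ φ a ≠ lineSlack n a φ := by
  have := h.line_eq ha φ (φ a)
  rw [update_eq_self, hφ] at this
  split_ifs at this with hc
  exact ⟨by omega, hc⟩

/-- In a plane, either the slack position is the same on all parallel lines, or the base values
agree and the slack positions are distinct. -/
theorem plane_dichotomy (b b' : Fin 3 → ℕ) (s s' : Fin 3 → Fin 3)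
    (h : ∀ x y, (b x + if y = s x then 1 else 0) = b' y + if x = s' y then 1 else 0) :
    ((∃ s₀, ∀ x, s x = s₀) ∧ ∃ m k, ∀ x, b x = m + if x = k then 1 else 0) ∨
      ((∃ b₀, ∀ x, b x = b₀) ∧ Injective s) := by
  -- If two parallel lines have different slack positions, comparing them in the transversal
  -- direction forces equal bases, first for these two and then for all three. Two equal slack
  -- positions beside a different one would give a line with two exceptional values.
  by_cases hs : ∀ x, s x = s 0
  · refine Or.inl ⟨⟨s 0, hs⟩, b' (s 0 + 1), s' (s 0 + 1), fun x => ?_⟩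
    rw [← h, hs x, if_neg (by generalize s 0 = x; revert x; decide), Nat.add_zero]
  · push Not at hs
    obtain ⟨x₁, hx₁⟩ := hs
    have hle : ∀ x y, s x ≠ s y → b x ≤ b y := by
      intro x y hxy
      have e1 := h x (s x)
      have e2 := h y (s x)
      rw [if_pos rfl] at e1
      rw [if_neg hxy] at e2
      split_ifs at e1 e2 <;> omega
    have heq : ∀ x y, s x ≠ s y → b x = b y := fun x y hxy =>
      le_antisymm (hle x y hxy) (hle y x hxy.symm)
    have hb : ∀ x, b x = b 0 := by
      intro x
      by_cases hx : s x = s 0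
      · rw [heq x x₁ (hx ▸ hx₁.symm), heq x₁ 0 hx₁]
      · exact heq x 0 hx
    refine Or.inr ⟨⟨b 0, hb⟩, fun x y hxy => ?_⟩
    by_contra hne
    obtain ⟨z, hz⟩ : ∃ z, s z ≠ s x := by
      by_cases hx : s x = s 0
      · exact ⟨x₁, hx ▸ hx₁⟩
      · exact ⟨0, Ne.symm hx⟩
    have e1 := h x (s x)
    have e2 := h y (s x)
    have e3 := h z (s x)
    rw [if_pos rfl] at e1
    rw [if_pos hxy] at e2
    rw [if_neg hz.symm] at e3
    rw [hb] at e1 e2 e3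
    split_ifs at e1 e2 e3 <;> omega

/-- The nullity function of the 2-sum. -/
def twoSumNullity (n₁ n₂ : (α → Fin 3) → ℕ) (f e : α) (φ : α → Fin 3) : ℕ :=
  n₁ (update φ f (lineSlack n₂ e φ)) + lineBase n₂ e φ

/-- A line in a direction of `E₁` is a line of `n₁` shifted by a constant. In a direction `c` of
`E₂`, `plane_dichotomy` applies to the plane of `n₂` spanned by `e` and `c`. Either the slack at `e`
is constant and the base varies as on a tight line, or the base is constant and the slack runs once
through all positions, which reproduces a line of `n₁` in direction `f`, permuted. -/
theorem isTightOn_twoSumNullity (h₁ : IsTightOn E₁ n₁) (h₂ : IsTightOn E₂ n₂) {f e : α}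
    (hf : f ∈ E₁) (he : e ∈ E₂) (hd : Disjoint E₁ E₂) :
    IsTightOn (E₁.erase f ∪ E₂.erase e) (twoSumNullity n₁ n₂ f e) where
  congr φ ψ h := by
    have e2 := h₂.congr_update (a := e) fun b hb => h b (Finset.mem_union_right _ hb)
    unfold twoSumNullity
    rw [lineBase_congr e2, lineSlack_congr e2,
      h₁.congr_update (a := f) fun b hb => h b (Finset.mem_union_left _ hb)]
  line φ c hc := by
    unfold twoSumNullity
    rcases Finset.mem_union.1 hc with hc | hc
    · have hcE := Finset.mem_of_mem_erase hc
      have e2 : ∀ j k, n₂ (update (update φ c j) e k) = n₂ (update φ e k) := fun j k =>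
        h₂.congr_update (fun b hb => update_of_ne (ne_of_mem_of_not_mem
          (Finset.mem_of_mem_erase hb) (Finset.disjoint_left.1 hd hcE)) _ _) k
      obtain ⟨m, k, hk⟩ := h₁.line (update φ f (lineSlack n₂ e φ)) c hcE
      refine ⟨m + lineBase n₂ e φ, k, fun j => ?_⟩
      rw [lineBase_congr (e2 j), lineSlack_congr (e2 j),
        update_comm (Finset.ne_of_mem_erase hc), hk]
      omega
    · have hcE := Finset.mem_of_mem_erase hc
      have hce := Finset.ne_of_mem_erase hc
      have e1 : ∀ j s, n₁ (update (update φ c j) f s) = n₁ (update φ f s) := fun j s =>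
        h₁.congr_update (fun b hb => update_of_ne (ne_of_mem_of_not_mem
          (Finset.mem_of_mem_erase hb) (Finset.disjoint_right.1 hd hcE)) _ _) s
      simp only [e1]
      rcases plane_dichotomy (fun x => lineBase n₂ e (update φ c x))
        (fun y => lineBase n₂ c (update φ e y)) (fun x => lineSlack n₂ e (update φ c x))
        (fun y => lineSlack n₂ c (update φ e y)) (fun x y => by
          rw [← h₂.line_eq he, ← h₂.line_eq hcE, update_comm hce]) with
        ⟨⟨s₀, hs⟩, m, k, hm⟩ | ⟨⟨b₀, hb⟩, hs⟩
      · refine ⟨n₁ (update φ f s₀) + m, k, fun j => ?_⟩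
        rw [hs, hm, Nat.add_assoc]
      · obtain ⟨j₀, hj₀⟩ := Finite.surjective_of_injective hs (lineSlack n₁ f φ)
        refine ⟨lineBase n₁ f φ + b₀, j₀, fun j => ?_⟩
        rw [h₁.line_eq hf, hb, ← hj₀]
        have : lineSlack n₂ e (update φ c j) = lineSlack n₂ e (update φ c j₀) ↔ j = j₀ :=
          hs.eq_iff
        simp only [this]
        omega

/-- `e` takes every position in the zeros of `n`. -/
def IsFree (n : (α → Fin 3) → ℕ) (e : α) : Prop := ∀ k, ∃ φ, n φ = 0 ∧ φ e = k

/-- Freeness provides a zero of `n₂` whose position at `e` is the slack position of `n₁` at `f`. A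
zero is never in slack position, so the two slack positions differ. -/
theorem exists_twoSumNullity_eq_zero (h₁ : IsTightOn E₁ n₁) (h₂ : IsTightOn E₂ n₂) {f e : α}
    (hf : f ∈ E₁) (he : e ∈ E₂) (hd : Disjoint E₁ E₂) (h0 : ∃ φ, n₁ φ = 0) (hfree : IsFree n₂ e) :
    ∃ φ, twoSumNullity n₁ n₂ f e φ = 0 := by
  obtain ⟨φ₁, hφ₁⟩ := h0
  obtain ⟨φ₂, hφ₂, hi⟩ := hfree (lineSlack n₁ f φ₁)
  obtain ⟨hb₂, hs₂⟩ := h₂.lineBase_eq_zero he hφ₂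
  obtain ⟨hb₁, -⟩ := h₁.lineBase_eq_zero hf hφ₁
  have e2 : ∀ k, n₂ (update (fun a => if a ∈ E₁ then φ₁ a else φ₂ a) e k) = n₂ (update φ₂ e k) :=
    h₂.congr_update fun b hb =>
      if_neg (Finset.disjoint_right.1 hd (Finset.mem_of_mem_erase hb))
  refine ⟨fun a => if a ∈ E₁ then φ₁ a else φ₂ a, ?_⟩
  unfold twoSumNullity
  rw [lineBase_congr e2, lineSlack_congr e2, hb₂, h₁.congr_update (ψ := φ₁) (fun b hb =>
    if_pos (Finset.mem_of_mem_erase hb)), h₁.line_eq hf, hb₁, if_neg (by rw [← hi]; exact hs₂.symm)]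

namespace SetFamily

variable {D₁ D₂ : SetFamily α}

theorem twoSumCarrier_eq {Z₁ Z₂ : RankSystem α} (h₁ : Z₁.U = E₁ ×ˢ Finset.univ)
    (h₂ : Z₂.U = E₂ ×ˢ Finset.univ) {f e : α} (hf : f ∈ E₁) (he : e ∈ E₂) (hd : Disjoint E₁ E₂) :
    Z₁.twoSumCarrier Z₂ f e = (E₁.erase f ∪ E₂.erase e) ×ˢ Finset.univ := by
  ext x
  have hfE : f ∉ E₂ := Finset.disjoint_left.1 hd hf
  have heE : e ∉ E₁ := Finset.disjoint_right.1 hd he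
  simp only [RankSystem.twoSumCarrier, RankSystem.skewClass, h₁, h₂, Finset.mem_sdiff,
    Finset.mem_union, Finset.mem_filter, Finset.mem_product, Finset.mem_univ, and_true,
    Finset.mem_erase]
  by_cases h3 : x.1 = f
  · simp [h3, hf, hfE]
  · by_cases h4 : x.1 = e
    · simp [h4, he, heE]
    · simp [h3, h4]

theorem stateGraph_inter_product (A : Finset α) (φ : α → Fin 3) :
    stateGraph A φ ∩ E ×ˢ Finset.univ = stateGraph (A ∩ E) φ := by
  ext x
  simp only [Finset.mem_inter, mem_stateGraph, Finset.mem_product, Finset.mem_univ]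
  tauto

/-- Both near-transversals are independent iff both base values vanish. With base values zero, `n₁`
vanishes at the slack position of `n₂` iff the two slack positions differ. -/
theorem HasNullity.mem_twoSumBases_iff (h₁ : D₁.HasNullity n₁) (h₂ : D₂.HasNullity n₂) {f e : α}
    (hf : f ∈ D₁.ground) (he : e ∈ D₂.ground) (hd : Disjoint D₁.ground D₂.ground)
    (φ : α → Fin 3) :
    stateGraph (D₁.ground.erase f ∪ D₂.ground.erase e) φ ∈ D₁.Z3.twoSumBases D₂.Z3 f e ↔
      twoSumNullity n₁ n₂ f e φ = 0 := by
  have hZ₁ := h₁.isZ3_Z3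
  have hZ₂ := h₂.isZ3_Z3
  have hfE : f ∉ D₂.ground := Finset.disjoint_left.1 hd hf
  have heE : e ∉ D₁.ground := Finset.disjoint_right.1 hd he
  have hi₁ : (D₁.ground.erase f ∪ D₂.ground.erase e) ∩ D₁.ground = D₁.ground.erase f := by
    ext a
    simp only [Finset.mem_inter, Finset.mem_union, Finset.mem_erase]
    have hda : a ∈ D₁.ground → a ∉ D₂.ground := fun h => Finset.disjoint_left.1 hd h
    tauto
  have hi₂ : (D₁.ground.erase f ∪ D₂.ground.erase e) ∩ D₂.ground = D₂.ground.erase e := by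
    ext a
    simp only [Finset.mem_inter, Finset.mem_union, Finset.mem_erase]
    have hda : a ∈ D₁.ground → a ∉ D₂.ground := fun h => Finset.disjoint_left.1 hd h
    tauto
  have hn : ∀ {D : SetFamily α} {a : α}, D.IsZ3 D.Z3 → a ∈ D.ground →
      D.Z3.IsNearTransversal (stateGraph (D.ground.erase a) φ) := by
    intro D a hZ ha
    refine ⟨RankSystem.isSubtransversal_stateGraph hZ.1 (Finset.erase_subset _ _)
      fun _ _ => Finset.mem_univ _, ?_⟩
    rw [card_stateGraph, RankSystem.classes_eq hZ.1 Finset.univ_nonempty,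
      Finset.card_erase_add_one ha]
  unfold RankSystem.twoSumBases
  rw [Set.mem_ofPred_eq, hZ₁.1, hZ₂.1, stateGraph_inter_product, stateGraph_inter_product, hi₁, hi₂,
    twoSumCarrier_eq hZ₁.1 hZ₂.1 hf he hd]
  have ht : RankSystem.IsTransversal
      ⟨(D₁.ground.erase f ∪ D₂.ground.erase e) ×ˢ Finset.univ, fun _ => 0⟩
      (stateGraph (D₁.ground.erase f ∪ D₂.ground.erase e) φ) := by
    refine ⟨RankSystem.isSubtransversal_stateGraph (K := Finset.univ) rfl subset_rfl
      fun _ _ => Finset.mem_univ _, ?_⟩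
    rw [card_stateGraph, RankSystem.classes_eq (K := Finset.univ) rfl Finset.univ_nonempty]
  have k₁ := h₁.isIndep_and_isSlack_iff hZ₁ hf φ
  have k₂ := h₂.isIndep_and_isSlack_iff hZ₂ he φ
  unfold twoSumNullity
  constructor
  · rintro ⟨-, -, hI₁, -, hI₂, i, j, hij, hs₁, hs₂⟩
    have l₁ := (k₁ i).1 ⟨hI₁, hs₁⟩
    have l₂ := (k₂ j).1 ⟨hI₂, hs₂⟩
    have hb : lineBase n₂ e φ = 0 := by
      have := h₂.tight.line_eq he φ (j + 1)
      rw [l₂, if_neg (by generalize j = x; revert x; decide)] at this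
      omega
    have hs : lineSlack n₂ e φ = j := by
      have := h₂.tight.line_eq he φ j
      rw [l₂, if_pos rfl, hb] at this
      by_contra hne
      rw [if_neg (Ne.symm hne)] at this
      omega
    rw [hb, hs, l₁, if_neg hij.symm]
  · intro h0
    have hb : lineBase n₂ e φ = 0 := by omega
    have h1 : n₁ (update φ f (lineSlack n₂ e φ)) = 0 := by omega
    rw [h₁.tight.line_eq hf] at h1
    have hne : lineSlack n₂ e φ ≠ lineSlack n₁ f φ := by
      intro hc
      rw [if_pos hc] at h1
      omega
    rw [if_neg hne] at h1
    have l₁ := (k₁ (lineSlack n₁ f φ)).2 fun j => by rw [h₁.tight.line_eq hf]; omega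
    have l₂ := (k₂ (lineSlack n₂ e φ)).2 fun j => by rw [h₂.tight.line_eq he]; omega
    exact ⟨ht, hn hZ₁ hf, l₁.1, hn hZ₂ he, l₂.1, _, _, hne.symm, l₁.2, l₂.2⟩

theorem HasNullity.twoSum_ground (h₁ : D₁.HasNullity n₁) (h₂ : D₂.HasNullity n₂) {f e : α}
    (hf : f ∈ D₁.ground) (he : e ∈ D₂.ground) (hd : Disjoint D₁.ground D₂.ground) :
    (D₁.twoSum D₂ f e).ground = D₁.ground.erase f ∪ D₂.ground.erase e :=
  RankSystem.classes_eq (twoSumCarrier_eq h₁.isZ3_Z3.1 h₂.isZ3_Z3.1 hf he hd) Finset.univ_nonempty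

/-- Lets 2-sums be iterated with no appeal to vf-safety of the intermediate results. -/
theorem HasNullity.twoSum (h₁ : D₁.HasNullity n₁) (h₂ : D₂.HasNullity n₂) {f e : α}
    (hf : f ∈ D₁.ground) (he : e ∈ D₂.ground) (hd : Disjoint D₁.ground D₂.ground)
    (hfree : IsFree n₂ e) : (D₁.twoSum D₂ f e).HasNullity (twoSumNullity n₁ n₂ f e) := by
  have hg := h₁.twoSum_ground h₂ hf he hd
  have h0 := exists_twoSumNullity_eq_zero h₁.tight h₂.tight hf he hd h₁.exists_zero hfree
  refine ⟨by rw [hg]; exact isTightOn_twoSumNullity h₁.tight h₂.tight hf he hd, h0, fun X => ?_⟩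
  rw [hg, ← h₁.mem_twoSumBases_iff h₂ hf he hd]
  set Z := D₁.Z3.twoSum D₂.Z3 f e with hZ
  have hU : Z.U = (D₁.ground.erase f ∪ D₂.ground.erase e) ×ˢ Finset.univ :=
    twoSumCarrier_eq h₁.isZ3_Z3.1 h₂.isZ3_Z3.1 hf he hd
  have hc : Z.classes = D₁.ground.erase f ∪ D₂.ground.erase e :=
    RankSystem.classes_eq hU Finset.univ_nonempty
  change X ⊆ Z.classes ∧ (Z.restrict (dotBar Z.classes)).IsBasis (omega Z.classes X) ↔ _
  rw [hc]
  set E := D₁.ground.erase f ∪ D₂.ground.erase e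
  refine and_congr_right fun _ => ?_
  have hrU : (Z.restrict (dotBar E)).U = dotBar E := by
    change Z.U ∩ _ = _
    rw [hU, dotBar_eq_inter]
  have hT : (Z.restrict (dotBar E)).IsTransversal (omega E X) := by
    rw [omega_eq_stateGraph]
    refine ⟨RankSystem.isSubtransversal_stateGraph hrU subset_rfl fun a _ => ?_, ?_⟩
    · unfold statePt; split_ifs <;> simp
    · rw [card_stateGraph, RankSystem.classes_eq hrU (by simp)]
  rw [RankSystem.isBasis_iff_of_card hT]
  obtain ⟨φ, hφ⟩ := h0
  have hne : (D₁.Z3.twoSumBases D₂.Z3 f e).Nonempty :=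
    ⟨_, (h₁.mem_twoSumBases_iff h₂ hf he hd φ).2 hφ⟩
  refine (RankSystem.rank_ofBases_eq_card (U := D₁.Z3.twoSumCarrier D₂.Z3 f e) hne _).trans ?_
  rw [← omega_eq_stateGraph]
  constructor
  · rintro ⟨B, hB, hsub⟩
    have hBc := hB.1.2
    rw [twoSumCarrier_eq h₁.isZ3_Z3.1 h₂.isZ3_Z3.1 hf he hd,
      RankSystem.classes_eq (K := Finset.univ) rfl Finset.univ_nonempty] at hBc
    have := Finset.eq_of_subset_of_card_le hsub (by
      rw [hBc, omega_eq_stateGraph, card_stateGraph])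
    rwa [this]
  · intro hB
    exact ⟨_, hB, subset_rfl⟩

end SetFamily

end TwoSum

/-! ### Weighted sums over states -/

section TripartitionSum

variable {α : Type*} [DecidableEq α]

theorem mem_orderedTripartitions {E : Finset α} {P : Finset α × Finset α × Finset α} :
    P ∈ orderedTripartitions E ↔ ∀ a, (a ∈ P.1 ∨ a ∈ P.2.1 ∨ a ∈ P.2.2 ↔ a ∈ E) ∧
      ¬ (a ∈ P.1 ∧ a ∈ P.2.1) ∧ ¬ (a ∈ P.1 ∧ a ∈ P.2.2) ∧ ¬ (a ∈ P.2.1 ∧ a ∈ P.2.2) := by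
  obtain ⟨X, Y, Z⟩ := P
  simp only [orderedTripartitions, Finset.mem_filter, Finset.mem_product, Finset.mem_powerset,
    Finset.disjoint_left, Finset.ext_iff, Finset.mem_union, Finset.subset_iff]
  constructor
  · rintro ⟨-, h1, h2, h3, h4⟩ a
    have := h4 a
    have := @h1 a
    have := @h2 a
    have := @h3 a
    tauto
  · intro h
    refine ⟨⟨fun a ha => ?_, fun a ha => ?_, fun a ha => ?_⟩, fun a ha => ?_, fun a ha => ?_,
      fun a ha => ?_, fun a => ?_⟩ <;>
    · have := h a
      tauto

/-- The state of an ordered tripartition. -/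
def tripartitionState (P : Finset α × Finset α × Finset α) : α → Fin 3 :=
  fun a => if a ∈ P.1 then 0 else if a ∈ P.2.1 then 1 else 2

variable {R : Type*} [CommSemiring R]

/-- The weighted sum of `g` over the states of `E`. -/
def tripartitionSum (E : Finset α) (h : α → Fin 3 → R) (g : (α → Fin 3) → R) : R :=
  ∑ P ∈ orderedTripartitions E, (∏ a ∈ P.1, h a 0) * (∏ a ∈ P.2.1, h a 1) *
    (∏ a ∈ P.2.2, h a 2) * g (tripartitionState P)

theorem tripartitionSum_congr {E : Finset α} {h h' : α → Fin 3 → R} {g g' : (α → Fin 3) → R}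
    (hh : ∀ a ∈ E, ∀ k, h a k = h' a k)
    (hg : ∀ P ∈ orderedTripartitions E, g (tripartitionState P) = g' (tripartitionState P)) :
    tripartitionSum E h g = tripartitionSum E h' g' := by
  refine Finset.sum_congr rfl fun P hP => ?_
  have hm := mem_orderedTripartitions.1 hP
  rw [hg P hP, Finset.prod_congr rfl fun a ha => hh a ((hm a).1.1 (Or.inl ha)) 0,
    Finset.prod_congr rfl fun a ha => hh a ((hm a).1.1 (Or.inr (Or.inl ha))) 1,
    Finset.prod_congr rfl fun a ha => hh a ((hm a).1.1 (Or.inr (Or.inr ha))) 2]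

theorem tripartitionSum_sum {E : Finset α} (h : α → Fin 3 → R) {ι : Type*} (s : Finset ι)
    (c : ι → R) (g : ι → (α → Fin 3) → R) :
    tripartitionSum E h (fun φ => ∑ i ∈ s, c i * g i φ) =
      ∑ i ∈ s, c i * tripartitionSum E h (g i) := by
  unfold tripartitionSum
  simp only [Finset.mul_sum]
  rw [Finset.sum_comm]
  refine Finset.sum_congr rfl fun i _ => Finset.sum_congr rfl fun P _ => ?_
  ring

theorem tripartitionSum_empty (h : α → Fin 3 → R) (g : (α → Fin 3) → R) :
    tripartitionSum ∅ h g = g fun _ => 2 := by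
  have : orderedTripartitions (∅ : Finset α) = {(∅, ∅, ∅)} := by
    ext ⟨X, Y, Z⟩
    simp only [mem_orderedTripartitions, Finset.notMem_empty, iff_false, Finset.mem_singleton,
      Prod.mk.injEq, Finset.eq_empty_iff_forall_notMem]
    constructor
    · intro H
      exact ⟨fun a => by have := H a; tauto, fun a => by have := H a; tauto,
        fun a => by have := H a; tauto⟩
    · intro H a
      have := H.1 a
      have := H.2.1 a
      have := H.2.2 a
      tauto
  unfold tripartitionSum
  rw [this, Finset.sum_singleton]
  simp only [Finset.prod_empty, one_mul]
  congr 1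

theorem orderedTripartitions_insert {E : Finset α} {a : α} (ha : a ∉ E) :
    orderedTripartitions (insert a E) =
      (orderedTripartitions E).image (fun P => (insert a P.1, P.2.1, P.2.2)) ∪
      ((orderedTripartitions E).image (fun P => (P.1, insert a P.2.1, P.2.2)) ∪
      (orderedTripartitions E).image fun P => (P.1, P.2.1, insert a P.2.2)) := by
  ext ⟨X, Y, Z⟩
  simp only [Finset.mem_union, Finset.mem_image, Prod.mk.injEq]
  constructor
  · intro hP
    rw [mem_orderedTripartitions] at hP
    have haP := hP a
    simp only [Finset.mem_insert_self, iff_true] at haP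
    rcases haP.1 with hX | hY | hZ
    · refine Or.inl ⟨(X.erase a, Y, Z), ?_, Finset.insert_erase hX, rfl, rfl⟩
      rw [mem_orderedTripartitions]
      intro b
      have hb := hP b
      by_cases hba : b = a
      · subst hba
        clear hP hb
        simp only [Finset.mem_erase, ne_eq, not_true_eq_false, false_and, false_or, ha, iff_false]
        tauto
      · simpa [hba] using hb
    · refine Or.inr (Or.inl ⟨(X, Y.erase a, Z), ?_, rfl, Finset.insert_erase hY, rfl⟩)
      rw [mem_orderedTripartitions]
      intro b
      have hb := hP b
      by_cases hba : b = a
      · subst hba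
        clear hP hb
        simp only [Finset.mem_erase, ne_eq, not_true_eq_false, false_and, false_or, ha, iff_false]
        tauto
      · simpa [hba] using hb
    · refine Or.inr (Or.inr ⟨(X, Y, Z.erase a), ?_, rfl, rfl, Finset.insert_erase hZ⟩)
      rw [mem_orderedTripartitions]
      intro b
      have hb := hP b
      by_cases hba : b = a
      · subst hba
        clear hP hb
        simp only [Finset.mem_erase, ne_eq, not_true_eq_false, false_and, ha, iff_false]
        tauto
      · simpa [hba] using hb
  · rintro (⟨P, hP, rfl, rfl, rfl⟩ | ⟨P, hP, rfl, rfl, rfl⟩ | ⟨P, hP, rfl, rfl, rfl⟩)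
    all_goals
      rw [mem_orderedTripartitions] at hP ⊢
      intro b
      have hb := hP b
      by_cases hba : b = a
      · subst hba
        simp only [ha, iff_false, not_or] at hb
        simp [hb]
      · simpa [hba] using hb

/-- The block containing `a` is its state. This recursion replaces the tripartitions in the
inductions that follow. -/
theorem tripartitionSum_insert {E : Finset α} {a : α} (ha : a ∉ E) (h : α → Fin 3 → R)
    (g : (α → Fin 3) → R) :
    tripartitionSum (insert a E) h g =
      ∑ k, h a k * tripartitionSum E h fun φ => g (update φ a k) := by
  have hn : ∀ P ∈ orderedTripartitions E, a ∉ P.1 ∧ a ∉ P.2.1 ∧ a ∉ P.2.2 := by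
    intro P hP
    have := mem_orderedTripartitions.1 hP a
    tauto
  have hins : ∀ {X Y : Finset α}, a ∉ X → a ∉ Y → insert a X = insert a Y → X = Y := by
    intro X Y hX hY he
    rw [← Finset.erase_insert hX, he, Finset.erase_insert hY]
  have hst : ∀ (P P' : Finset α × Finset α × Finset α) (k : Fin 3),
      (∀ b, b ≠ a → (b ∈ P'.1 ↔ b ∈ P.1) ∧ (b ∈ P'.2.1 ↔ b ∈ P.2.1)) →
      tripartitionState P' a = k → tripartitionState P' = update (tripartitionState P) a k := by
    intro P P' k hb hk
    funext b
    by_cases hba : b = a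
    · subst hba; simpa using hk
    · rw [update_of_ne hba]
      simp only [tripartitionState, hb b hba]
  unfold tripartitionSum
  rw [orderedTripartitions_insert ha, Finset.sum_union, Finset.sum_union, Finset.sum_image,
    Finset.sum_image, Finset.sum_image, Fin.sum_univ_three, Finset.mul_sum, Finset.mul_sum,
    Finset.mul_sum, add_assoc]
  · refine congrArg₂ _ (Finset.sum_congr rfl fun P hP => ?_)
      (congrArg₂ _ (Finset.sum_congr rfl fun P hP => ?_) (Finset.sum_congr rfl fun P hP => ?_))
    · rw [Finset.prod_insert (hn P hP).1, hst P _ 0 (fun b hb => by simp [hb])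
        (by simp [tripartitionState])]
      ring
    · rw [Finset.prod_insert (hn P hP).2.1, hst P _ 1 (fun b hb => by simp [hb])
        (by simp [tripartitionState, (hn P hP).1])]
      ring
    · rw [Finset.prod_insert (hn P hP).2.2, hst P _ 2 (fun b hb => by simp)
        (by simp [tripartitionState, (hn P hP).1, (hn P hP).2.1])]
      ring
  · intro P hP P' hP' he
    simp only [Prod.mk.injEq] at he
    exact Prod.ext he.1 (Prod.ext he.2.1 (hins (hn P hP).2.2 (hn P' hP').2.2 he.2.2))
  · intro P hP P' hP' he
    simp only [Prod.mk.injEq] at he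
    exact Prod.ext he.1 (Prod.ext (hins (hn P hP).2.1 (hn P' hP').2.1 he.2.1) he.2.2)
  · intro P hP P' hP' he
    simp only [Prod.mk.injEq] at he
    exact Prod.ext (hins (hn P hP).1 (hn P' hP').1 he.1) (Prod.ext he.2.1 he.2.2)
  · rw [Finset.disjoint_left]
    intro P h1 h2
    obtain ⟨P₁, hP₁, rfl⟩ := Finset.mem_image.1 h1
    obtain ⟨P₂, hP₂, he⟩ := Finset.mem_image.1 h2
    simp only [Prod.mk.injEq] at he
    exact (hn P₂ hP₂).2.1 (he.2.1 ▸ Finset.mem_insert_self a _)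
  · rw [Finset.disjoint_left]
    intro P h1 h2
    obtain ⟨P₁, hP₁, rfl⟩ := Finset.mem_image.1 h1
    rcases Finset.mem_union.1 h2 with h2 | h2
    all_goals
      obtain ⟨P₂, hP₂, he⟩ := Finset.mem_image.1 h2
      simp only [Prod.mk.injEq] at he
      exact (hn P₂ hP₂).1 (he.1 ▸ Finset.mem_insert_self a _)

theorem tripartitionSum_union {E₁ E₂ : Finset α} (hd : Disjoint E₁ E₂) (h : α → Fin 3 → R)
    (A B : (α → Fin 3) → R) (hA : ∀ φ ψ : α → Fin 3, (∀ a ∈ E₁, φ a = ψ a) → A φ = A ψ)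
    (hB : ∀ φ ψ : α → Fin 3, (∀ a ∈ E₂, φ a = ψ a) → B φ = B ψ) :
    tripartitionSum (E₁ ∪ E₂) h (fun φ => A φ * B φ) =
      tripartitionSum E₁ h A * tripartitionSum E₂ h B := by
  induction E₁ using Finset.induction_on generalizing A with
  | empty =>
    rw [Finset.empty_union, tripartitionSum_empty]
    -- With no coordinates left `A` is constant; linearity over a one-element index set pulls it
    -- out. The constant state 2 is the one attached to the empty tripartition.
    have := tripartitionSum_sum (E := E₂) h {()} (fun _ => A fun _ => 2) fun _ => B
    simp only [Finset.sum_singleton] at this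
    rw [← this]
    congr 1
    funext φ
    rw [hA φ (fun _ => 2) (by simp)]
  | insert a E ha ih =>
    rw [Finset.disjoint_insert_left] at hd
    rw [Finset.insert_union, tripartitionSum_insert (by simp [ha, hd.1]), tripartitionSum_insert ha,
      Finset.sum_mul]
    refine Finset.sum_congr rfl fun k _ => ?_
    rw [mul_assoc, ← ih hd.2]
    · congr 2
      funext φ
      rw [hB (update φ a k) φ fun b hb => update_of_ne (ne_of_mem_of_not_mem hb hd.1) _ _]
    · intro φ ψ hφ
      refine hA _ _ fun b hb => ?_
      by_cases hba : b = a
      · subst hba; simp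
      · rw [update_of_ne hba, update_of_ne hba, hφ b (Finset.mem_of_mem_insert_of_ne hb hba)]

theorem tripartitionSum_map {β : Type*} [DecidableEq β] (c : α ↪ β) (E : Finset α)
    (h : β → Fin 3 → R) (g : (α → Fin 3) → R) :
    tripartitionSum (E.map c) h (fun φ => g (φ ∘ c)) = tripartitionSum E (fun a => h (c a)) g := by
  induction E using Finset.induction_on generalizing g with
  | empty => rw [Finset.map_empty, tripartitionSum_empty, tripartitionSum_empty]; rfl
  | insert a E ha ih =>
    rw [Finset.map_insert, tripartitionSum_insert (by simpa using ha), tripartitionSum_insert ha]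
    refine Finset.sum_congr rfl fun k _ => ?_
    rw [← ih]
    congr 2
    funext φ
    rw [update_comp_eq_of_injective φ c.injective]

theorem map_tripartitionSum {S F : Type*} [CommSemiring S] [FunLike F R S] [RingHomClass F R S]
    (s : F) (E : Finset α) (h : α → Fin 3 → R) (g : (α → Fin 3) → R) :
    s (tripartitionSum E h g) =
      tripartitionSum E (fun a k => s (h a k)) fun φ => s (g φ) := by
  simp only [tripartitionSum, map_sum, map_mul, map_prod]

end TripartitionSum

/-! ### The transition polynomial of minors and 2-sums -/

section TransitionPolynomial

variable {α : Type*}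

/-- The name of a formal variable `u_a`, `v_a`, `w_a`. -/
def stateVar (a : α) (k : Fin 3) : TVar α := if k = 0 then .u a else if k = 1 then .v a else .w a

/-- The weight of the state `k` at `a`. -/
noncomputable def stateWeight (a : α) (k : Fin 3) : TPoly α := MvPolynomial.X (stateVar a k)

theorem rename_stateWeight {β : Type*} (c : α ↪ β) (a : α) (k : Fin 3) :
    MvPolynomial.rename (TVar.map c) (stateWeight a k) = stateWeight (c a) k := by
  unfold stateWeight
  rw [MvPolynomial.rename_X]
  congr 1
  unfold stateVar
  split_ifs <;> rfl

variable [DecidableEq α] {D : SetFamily α} {n : (α → Fin 3) → ℕ}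

theorem SetFamily.HasNullity.Q_eq (h : D.HasNullity n) :
    D.Q = tripartitionSum D.ground stateWeight fun φ => MvPolynomial.X TVar.t ^ n φ := by
  refine Finset.sum_congr rfl fun P hP => ?_
  have hm := mem_orderedTripartitions.1 hP
  rw [h.dist_dualPivotSet (fun a ha => (hm a).1.1 (Or.inr (Or.inr ha)))
    (fun a ha => (hm a).1.1 (Or.inl ha)), h.tight.congr _ (tripartitionState P) fun a ha => ?_]
  · rfl
  · have := hm a
    unfold statePt tripartitionState
    by_cases h1 : a ∈ P.1
    · simp [h1]
    · by_cases h2 : a ∈ P.2.1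
      · have h3 : a ∉ P.2.2 := by tauto
        simp [h1, h2, h3]
      · have h3 : a ∈ P.2.2 := by tauto
        simp [h1, h2, h3]

/-- The part of the transition polynomial that belongs to the near-transversals with slack `k`. -/
noncomputable def slackPoly (E : Finset α) (n : (α → Fin 3) → ℕ) (e : α) (k : Fin 3) : TPoly α :=
  tripartitionSum (E.erase e) stateWeight fun φ =>
    if lineSlack n e φ = k then MvPolynomial.X TVar.t ^ lineBase n e φ else 0

/-- Source of the linear system: with `e` fixed in position `j`, a state with slack position `k`
contributes its base power of `t`, times another `t` exactly when `j = k`. -/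
theorem tripartitionSum_update {E : Finset α} (h : IsTightOn E n) {e : α} (he : e ∈ E)
    (j : Fin 3) :
    tripartitionSum (E.erase e) stateWeight
      (fun φ => (MvPolynomial.X TVar.t : TPoly α) ^ n (update φ e j)) =
      ∑ k, (if j = k then MvPolynomial.X TVar.t else 1) * slackPoly E n e k := by
  unfold slackPoly
  rw [← tripartitionSum_sum]
  congr 1
  funext φ
  rw [h.line_eq he, pow_add]
  simp only [mul_ite, mul_zero, Finset.sum_ite_eq, Finset.mem_univ, if_true]
  split_ifs <;> simp [mul_comm]

theorem tripartitionSum_erase {R : Type*} [CommSemiring R] {E : Finset α} {a : α} (ha : a ∈ E)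
    (h : α → Fin 3 → R) (g : (α → Fin 3) → R) :
    tripartitionSum E h g =
      ∑ k, h a k * tripartitionSum (E.erase a) h fun φ => g (update φ a k) := by
  rw [← tripartitionSum_insert (Finset.notMem_erase a E), Finset.insert_erase ha]

namespace SetFamily

/-- The transition polynomial of a 2-sum arises by substitution. -/
theorem HasNullity.Q_twoSum {D₁ D₂ : SetFamily α} {n₁ n₂ : (α → Fin 3) → ℕ}
    (h₁ : D₁.HasNullity n₁) (h₂ : D₂.HasNullity n₂) {f e : α} (hf : f ∈ D₁.ground)
    (he : e ∈ D₂.ground) (hd : Disjoint D₁.ground D₂.ground) (hfree : IsFree n₂ e)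
    (s : TPoly α →ₐ[ℤ] TPoly α) (hst : s (MvPolynomial.X TVar.t) = MvPolynomial.X TVar.t)
    (hs : ∀ a ∈ D₁.ground, a ≠ f → ∀ k, s (stateWeight a k) = stateWeight a k)
    (hsf : ∀ k, s (stateWeight f k) = slackPoly D₂.ground n₂ e k) :
    (D₁.twoSum D₂ f e).Q = s D₁.Q := by
  rw [(h₁.twoSum h₂ hf he hd hfree).Q_eq, h₁.Q_eq, map_tripartitionSum,
    h₁.twoSum_ground h₂ hf he hd, tripartitionSum_erase hf]
  have hd' : Disjoint (D₁.ground.erase f) (D₂.ground.erase e) :=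
    Finset.disjoint_of_subset_left (Finset.erase_subset _ _)
      (Finset.disjoint_of_subset_right (Finset.erase_subset _ _) hd)
  -- The states are grouped by the slack position `k` on the side of `D₂`. For fixed `k` the summand
  -- is a product of functions on the two disjoint ground sets, and the `D₂` factor sums to
  -- `slackPoly k`.
  have e1 : (fun φ => (MvPolynomial.X TVar.t : TPoly α) ^ twoSumNullity n₁ n₂ f e φ) =
      fun φ => ∑ k : Fin 3, 1 * (MvPolynomial.X TVar.t ^ n₁ (update φ f k) *
        if lineSlack n₂ e φ = k then MvPolynomial.X TVar.t ^ lineBase n₂ e φ else 0) := by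
    funext φ
    simp only [one_mul, mul_ite, mul_zero, Finset.sum_ite_eq, Finset.mem_univ, if_true]
    rw [twoSumNullity, pow_add]
  rw [e1, tripartitionSum_sum]
  refine Finset.sum_congr rfl fun k _ => ?_
  rw [one_mul, tripartitionSum_union hd' stateWeight
    (fun φ => MvPolynomial.X TVar.t ^ n₁ (update φ f k))
    (fun φ => if lineSlack n₂ e φ = k then MvPolynomial.X TVar.t ^ lineBase n₂ e φ else 0),
    hsf, mul_comm]
  · congr 1
    refine tripartitionSum_congr (fun a ha k => ?_) fun P _ => ?_
    · exact (hs a (Finset.mem_of_mem_erase ha) (Finset.ne_of_mem_erase ha) k).symm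
    · rw [map_pow, hst]
  · intro φ ψ hφ
    rw [h₁.tight.congr_update hφ]
  · intro φ ψ hφ
    rw [lineBase_congr (h₂.tight.congr_update hφ), lineSlack_congr (h₂.tight.congr_update hφ)]

/-- The three ways of being singular are the absence of a dot, of a bar and of a hat at `e` among
the zeros. For the hat: if `F` is feasible and `F ∆ {e}` is not, exactly one of dot and bar gives a
zero on that line, so the hat does too. -/
theorem HasNullity.isFree (h : D.HasNullity n) {e : α} (he : e ∈ D.ground)
    (hns : ¬ D.IsSingular e) : IsFree n e := by
  unfold IsSingular IsColoop IsLoop at hns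
  push Not at hns
  obtain ⟨⟨F₁, hF₁, h1⟩, ⟨F₀, hF₀, h0⟩, F, hF, h2⟩ := hns
  intro k
  have hk : k = 0 ∨ k = 1 ∨ k = 2 := by revert k; decide
  rcases hk with rfl | rfl | rfl
  · exact ⟨_, ((h.mem_feasible F₀).1 hF₀).2, by simp [statePt, h0]⟩
  · exact ⟨_, ((h.mem_feasible F₁).1 hF₁).2, by simp [statePt, h1]⟩
  · obtain ⟨hFE, hF0⟩ := (h.mem_feasible F).1 hF
    refine ⟨update (statePt (fun _ => 0) (fun _ => 1) F) e 2, ?_, by simp⟩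
    rw [h.tight.zero_iff_xor _ he (i := 0) (j := 1) (by decide) (by decide) (by decide)]
    have hflip : symmDiff F {e} ⊆ D.ground := by
      intro a ha
      rcases Finset.mem_symmDiff.1 ha with ha | ha
      · exact hFE ha.1
      · rw [Finset.mem_singleton.1 ha.1]; exact he
    have h3 : n (statePt (fun _ => 0) (fun _ => 1) (symmDiff F {e})) ≠ 0 := fun hc =>
      h2 ((h.mem_feasible _).2 ⟨hflip, hc⟩)
    by_cases heF : e ∈ F
    · refine Or.inl ⟨?_, ?_⟩
      · have := statePt_insert (fun _ => 0) (fun _ => (1 : Fin 3)) F e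
        rw [Finset.insert_eq_of_mem heF] at this
        rwa [← this]
      · convert h3 using 3
        funext b
        by_cases hb : b = e
        · subst hb; simp [statePt, Finset.mem_symmDiff, heF]
        · simp [statePt, Finset.mem_symmDiff, hb]
    · refine Or.inr ⟨?_, ?_⟩
      · have := statePt_update_right (fun _ => 0) (fun _ => (1 : Fin 3)) heF
        rwa [← this]
      · convert h3 using 3
        funext b
        by_cases hb : b = e
        · subst hb; simp [statePt, Finset.mem_symmDiff, heF]
        · simp [statePt, Finset.mem_symmDiff, hb]

/-- Guarantees that the minor with `e` fixed at `k` has a feasible set, so that the loop and coloop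
conventions for minors do not intervene. -/
theorem exists_update_eq_zero {E : Finset α} (h : IsTightOn E n) {e : α} (hfree : IsFree n e)
    (k : Fin 3) : ∃ G ⊆ E.erase e, n (update (statePt (fun _ => 0) (fun _ => 1) G) e k) = 0 := by
  obtain ⟨φ, h0, hk⟩ := hfree k
  obtain ⟨ψ, h1, h2, h3⟩ := h.exists_zero_dotBar (E.erase e) (Finset.erase_subset _ _) φ h0
  refine ⟨_, Finset.filter_subset (fun a => ψ a = 0) _, ?_⟩
  rw [h.congr_update (statePt_filter h2), ← hk, ← h3 e (Or.inl (Finset.notMem_erase e E)),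
    update_eq_self, h1]

/-- A minor at `e` has the nullity function obtained by fixing the state at `e`. -/
theorem HasNullity.minor {E : Finset α} (h : IsTightOn E n) {e : α}
    (hfree : IsFree n e) (k : Fin 3) {D' : SetFamily α} (hg : D'.ground = E.erase e)
    (hf : ∀ X, X ∈ D'.feasible ↔
      X ⊆ E.erase e ∧ n (update (statePt (fun _ => 0) (fun _ => 1) X) e k) = 0) :
    D'.HasNullity fun φ => n (update φ e k) := by
  refine ⟨⟨fun φ ψ hφ => ?_, fun φ a ha => ?_⟩, ?_, fun X => by rw [hf, hg]⟩
  · rw [hg] at hφ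
    exact h.congr_update hφ k
  · rw [hg] at ha
    obtain ⟨m, j, hj⟩ := h.line (update φ e k) a (Finset.mem_of_mem_erase ha)
    exact ⟨m, j, fun i => by rw [update_comm (Finset.ne_of_mem_erase ha), hj]⟩
  · obtain ⟨G, -, hG⟩ := exists_update_eq_zero h hfree k
    exact ⟨_, hG⟩

theorem insert_subset_iff_erase {E X : Finset α} {e : α} (he : e ∈ E) (heX : e ∉ X) :
    insert e X ⊆ E ↔ X ⊆ E.erase e := by
  rw [Finset.insert_subset_iff, Finset.subset_erase]
  tauto

/-- Contraction of a non-loop of a set family represented by a tight function. -/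
theorem RepBy.contract_hasNullity {E : Finset α} (h : IsTightOn E n) {p : α → Fin 3}
    (hD : D.RepBy E (fun φ => n φ = 0) p (fun _ => 1)) {e : α} (he : e ∈ E)
    (hp : ∀ a, a ≠ e → p a = 0) (hfree : IsFree n e) :
    (D.contract e).HasNullity fun φ => n (update φ e (p e)) := by
  have key : ∀ X, e ∉ X → (insert e X ∈ D.feasible ↔
      X ⊆ E.erase e ∧ n (update (statePt (fun _ => 0) (fun _ => 1) X) e (p e)) = 0) := by
    intro X heX
    rw [hD.2, insert_subset_iff_erase he heX, statePt_insert]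
    refine and_congr_right fun _ => ?_
    rw [h.congr_update fun b hb => ?_]
    have hbe := Finset.ne_of_mem_erase hb
    simp [statePt, hp b hbe]
  have hloop : ¬ D.IsLoop e := by
    obtain ⟨G, hG, hG0⟩ := exists_update_eq_zero h hfree (p e)
    have heG : e ∉ G := fun hc => Finset.notMem_erase e E (hG hc)
    exact fun hl => hl _ ((key G heG).2 ⟨hG, hG0⟩) (Finset.mem_insert_self e G)
  refine HasNullity.minor h hfree (p e) (congrArg (Finset.erase · e) hD.1) fun X => ?_
  unfold contract
  rw [if_neg hloop]
  constructor
  · rintro ⟨F, hF, heF, rfl⟩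
    rw [← key _ (Finset.notMem_erase e F), Finset.insert_erase heF]
    exact hF
  · rintro ⟨hX, h0⟩
    have heX : e ∉ X := fun hc => Finset.notMem_erase e E (hX hc)
    exact ⟨insert e X, (key X heX).2 ⟨hX, h0⟩, Finset.mem_insert_self e X,
      (Finset.erase_insert heX).symm⟩

theorem HasNullity.delete (h : D.HasNullity n) {e : α} (hfree : IsFree n e) :
    (D.delete e).HasNullity fun φ => n (update φ e 1) := by
  have key : ∀ X, e ∉ X → (X ∈ D.feasible ↔
      X ⊆ D.ground.erase e ∧ n (update (statePt (fun _ => 0) (fun _ => 1) X) e 1) = 0) := by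
    intro X heX
    rw [h.mem_feasible, ← statePt_update_right (fun _ => 0) (fun _ => (1 : Fin 3)) heX,
      Finset.subset_erase, and_iff_left heX]
  have hcoloop : ¬ D.IsColoop e := by
    obtain ⟨G, hG, hG0⟩ := exists_update_eq_zero h.tight hfree 1
    have heG : e ∉ G := fun hc => Finset.notMem_erase e _ (hG hc)
    exact fun hl => heG (hl _ ((key G heG).2 ⟨hG, hG0⟩))
  refine HasNullity.minor h.tight hfree 1 rfl fun X => ?_
  unfold SetFamily.delete
  rw [if_neg hcoloop]
  constructor
  · rintro ⟨hX, heX⟩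
    exact (key X heX).1 hX
  · rintro ⟨hX, h0⟩
    have heX : e ∉ X := fun hc => Finset.notMem_erase e _ (hX hc)
    exact ⟨(key X heX).2 ⟨hX, h0⟩, heX⟩

/-- Contraction fixes the dot at `e` and deletion the bar. After loop complementation the old hat
plays the dot, so the third minor fixes the hat. -/
theorem HasNullity.transitionSystem (h : D.HasNullity n) {e : α} (he : e ∈ D.ground)
    (hfree : IsFree n e) :
    TransitionSystem D e (slackPoly D.ground n e 0) (slackPoly D.ground n e 1)
      (slackPoly D.ground n e 2) := by
  have h0 := RepBy.contract_hasNullity h.tight h.repBy he (fun _ _ => rfl) hfree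
  have h1 := h.delete hfree
  have h2 := RepBy.contract_hasNullity h.tight
    (h.repBy.loopCompl h.tight.isEvenOn he (by decide)) he
    (fun a ha => by rw [update_of_ne ha]) hfree
  refine ⟨?_, ?_, ?_⟩
  · rw [h0.Q_eq]
    refine (tripartitionSum_update h.tight he 0).trans ?_
    simp [Fin.sum_univ_three]
  · rw [h1.Q_eq]
    refine (tripartitionSum_update h.tight he 1).trans ?_
    simp [Fin.sum_univ_three]
  · rw [h2.Q_eq, update_self, show third 0 1 = 2 from rfl]
    refine (tripartitionSum_update h.tight he 2).trans ?_
    simp [Fin.sum_univ_three]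

theorem HasNullity.map {β : Type*} [DecidableEq β] (h : D.HasNullity n) (c : α ↪ β) :
    (D.map c).HasNullity fun φ => n (φ ∘ c) := by
  refine ⟨⟨fun φ ψ hφ => ?_, fun φ b hb => ?_⟩, ?_, fun X => ?_⟩
  · exact h.tight.congr _ _ fun a ha => hφ _ (Finset.mem_map_of_mem c ha)
  · obtain ⟨a, ha, rfl⟩ := Finset.mem_map.1 hb
    obtain ⟨m, k, hk⟩ := h.tight.line (φ ∘ c) a ha
    exact ⟨m, k, fun j => by rw [update_comp_eq_of_injective φ c.injective, hk]⟩
  · obtain ⟨φ, hφ⟩ := h.exists_zero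
    obtain ⟨χ, hχ⟩ : ∃ χ : β → Fin 3, χ ∘ c = φ :=
      ⟨extend c φ fun _ => 0, funext fun a => c.injective.extend_apply _ _ _⟩
    exact ⟨χ, by rw [hχ, hφ]⟩
  · have hst : ∀ F : Finset α, statePt (fun _ => 0) (fun _ => 1) (F.map c) ∘ c =
        statePt (fun _ => 0) (fun _ => (1 : Fin 3)) F := by
      intro F
      funext a
      simp [statePt]
    constructor
    · rintro ⟨F, hF, rfl⟩
      have := (h.mem_feasible F).1 hF
      exact ⟨Finset.map_subset_map.2 this.1, by rw [hst]; exact this.2⟩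
    · rintro ⟨hX, h0⟩
      obtain ⟨F, hF, rfl⟩ := Finset.subset_map_iff.1 hX
      rw [hst] at h0
      exact ⟨F, (h.mem_feasible F).2 ⟨hF, h0⟩, rfl⟩

end SetFamily

theorem slackPoly_map {β : Type*} [DecidableEq β] (c : α ↪ β) (E : Finset α) (e : α) (k : Fin 3) :
    slackPoly (E.map c) (fun φ => n (φ ∘ c)) (c e) k =
      MvPolynomial.rename (TVar.map c) (slackPoly E n e k) := by
  unfold slackPoly
  rw [map_tripartitionSum, ← Finset.map_erase]
  have hu : ∀ (φ : β → Fin 3) (j : Fin 3), n (update φ (c e) j ∘ c) = n (update (φ ∘ c) e j) :=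
    fun φ j => by rw [update_comp_eq_of_injective φ c.injective]
  have hb : ∀ φ : β → Fin 3,
      lineBase (fun φ => n (φ ∘ c)) (c e) φ = lineBase n e (φ ∘ c) := fun φ => by
    simp only [lineBase, hu]
  have hs : ∀ φ : β → Fin 3,
      lineSlack (fun φ => n (φ ∘ c)) (c e) φ = lineSlack n e (φ ∘ c) := fun φ => by
    simp only [lineSlack, hb, hu]
  simp only [hb, hs, rename_stateWeight]
  rw [tripartitionSum_map c (E.erase e) stateWeight fun φ =>
    if lineSlack n e φ = k then MvPolynomial.X TVar.t ^ lineBase n e φ else 0]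
  congr 1
  funext φ
  split_ifs
  · rw [map_pow, MvPolynomial.rename_X]; rfl
  · rw [map_zero]

/-- Elimination in an integral domain: the differences are annihilated by products of `t - 1` and `t
+ 2`, which are non-zero. -/
theorem transitionSystem_unique {e : α} {p q r p' q' r' : TPoly α}
    (h : TransitionSystem D e p q r) (h' : TransitionSystem D e p' q' r') :
    p' = p ∧ q' = q ∧ r' = r := by
  obtain ⟨a1, a2, a3⟩ := h
  obtain ⟨b1, b2, b3⟩ := h'
  rw [a1] at b1
  rw [a2] at b2
  rw [a3] at b3
  have ht1 : (MvPolynomial.X TVar.t - 1 : TPoly α) ≠ 0 := by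
    intro hc
    have := congrArg (MvPolynomial.eval fun _ => (0 : ℤ)) hc
    simp at this
  have ht2 : (MvPolynomial.X TVar.t + 2 : TPoly α) ≠ 0 := by
    intro hc
    have := congrArg (MvPolynomial.eval fun _ => (1 : ℤ)) hc
    simp at this
  have hp : p' = p := by
    refine sub_eq_zero.1 ((mul_eq_zero.1 (?_ : (MvPolynomial.X TVar.t - 1 : TPoly α) *
      ((MvPolynomial.X TVar.t + 2) * (p' - p)) = 0)).resolve_left ht1 |> mul_eq_zero.1
        |>.resolve_left ht2)
    -- The last two rows minus `t + 1` times the first cancel `q` and `r`; up to sign the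
    -- coefficient of `p` becomes `t² + t - 2 = (t - 1)(t + 2)`.
    linear_combination (-MvPolynomial.X TVar.t - 1) * b1 + b2 + b3
  subst hp
  have hq : q' = q := by
    refine sub_eq_zero.1 ((mul_eq_zero.1 (?_ : (MvPolynomial.X TVar.t - 1 : TPoly α) *
      (q' - q) = 0)).resolve_left ht1)
    linear_combination b1 - b2
  subst hq
  exact ⟨rfl, rfl, by linear_combination -b1⟩

end TransitionPolynomial

/-! ### Iterated 2-sums and the tensor product -/

section Tensor

variable {α β : Type*} [DecidableEq α]

/-- The substitution of the variables that belong to the elements of `l`. -/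
noncomputable def substList (P : Fin 3 → TPoly β) (l : List α) :
    TPoly (α ⊕ α × β) →ₐ[ℤ] TPoly (α ⊕ α × β) :=
  MvPolynomial.aeval fun
    | .u (.inl a) => if a ∈ l then psiCopy a (P 0) else MvPolynomial.X (.u (.inl a))
    | .v (.inl a) => if a ∈ l then psiCopy a (P 1) else MvPolynomial.X (.v (.inl a))
    | .w (.inl a) => if a ∈ l then psiCopy a (P 2) else MvPolynomial.X (.w (.inl a))
    | x => MvPolynomial.X x

/-- A copied polynomial contains only `t` and variables of `inr` names, which the substitution
fixes. Successive substitutions therefore do not interfere and combine into a simultaneous one. -/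
theorem substList_psiCopy (P : Fin 3 → TPoly β) (l : List α) (a : α) (x : TPoly β) :
    substList P l (psiCopy a x) = psiCopy a x := by
  have : (substList P l).comp (psiCopy a) = psiCopy (α := α) (β := β) a := by
    refine MvPolynomial.algHom_ext fun y => ?_
    rw [AlgHom.comp_apply, psiCopy, MvPolynomial.rename_X]
    cases y <;> simp [substList, TVar.map, SetFamily.copyName]
  exact DFunLike.congr_fun this x

theorem substList_cons (P : Fin 3 → TPoly β) (a : α) (l : List α) (x : TPoly (α ⊕ α × β)) :
    substList P l (substList P [a] x) = substList P (a :: l) x := by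
  have : (substList P l).comp (substList P [a]) = substList P (a :: l) := by
    refine MvPolynomial.algHom_ext fun y => ?_
    rw [AlgHom.comp_apply]
    rcases y with (b | b) | (b | b) | (b | b) | _
    all_goals
      simp only [substList, MvPolynomial.aeval_X, List.mem_cons]
      try
        by_cases hb : b = a
        · subst hb
          simpa [substList] using substList_psiCopy P l b _
        · simp [hb]
  exact DFunLike.congr_fun this x

theorem substList_inl (P : Fin 3 → TPoly β) (l : List α) (a : α) (k : Fin 3) :
    substList P l (stateWeight (Sum.inl a) k) =
      if a ∈ l then psiCopy a (P k) else stateWeight (Sum.inl a) k := by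
  have hk : k = 0 ∨ k = 1 ∨ k = 2 := by revert k; decide
  rcases hk with rfl | rfl | rfl <;> simp [substList, stateWeight, stateVar]

theorem substList_inr (P : Fin 3 → TPoly β) (l : List α) (x : α × β) (k : Fin 3) :
    substList P l (stateWeight (Sum.inr x) k) = stateWeight (Sum.inr x) k := by
  have hk : k = 0 ∨ k = 1 ∨ k = 2 := by revert k; decide
  rcases hk with rfl | rfl | rfl <;> simp [substList, stateWeight, stateVar]

theorem substList_t (P : Fin 3 → TPoly β) (l : List α) :
    substList P l (MvPolynomial.X TVar.t) = MvPolynomial.X TVar.t := by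
  simp [substList]

variable [DecidableEq β]

namespace SetFamily

/-- The intermediate `D` is arbitrary for the induction's sake; the invariants say that elements yet
to be replaced are still present and their copies of `D₂` are not, which keeps the ground sets of
every 2-sum disjoint. -/
theorem Q_foldl_twoSum {D₂ : SetFamily β} {n₂ : (β → Fin 3) → ℕ} (h₂ : D₂.HasNullity n₂) {e : β}
    (he : e ∈ D₂.ground) (hfree : IsFree n₂ e) (l : List α) (hl : l.Nodup)
    (D : SetFamily (α ⊕ α × β)) {n : (α ⊕ α × β → Fin 3) → ℕ} (h : D.HasNullity n)
    (hin : ∀ a ∈ l, Sum.inl a ∈ D.ground) (hout : ∀ a ∈ l, ∀ b, Sum.inr (a, b) ∉ D.ground) :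
    (l.foldl (fun D a => D.twoSum (D₂.map (copyName a)) (Sum.inl a) (copyName a e)) D).Q =
      substList (slackPoly D₂.ground n₂ e) l D.Q := by
  induction l generalizing D n with
  | nil =>
    have : substList (slackPoly D₂.ground n₂ e) ([] : List α) = AlgHom.id ℤ _ := by
      refine MvPolynomial.algHom_ext fun y => ?_
      rcases y with (b | b) | (b | b) | (b | b) | _ <;> simp [substList]
    rw [this]
    rfl
  | cons a l ih =>
    have hal := (List.nodup_cons.1 hl).1
    have hc : copyName (α := α) a e ∈ (D₂.map (copyName a)).ground := Finset.mem_map_of_mem _ he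
    have hmem : ∀ x ∈ (D₂.map (copyName (α := α) a)).ground, ∃ b, x = Sum.inr (a, b) := by
      intro x hx
      obtain ⟨b, -, rfl⟩ := Finset.mem_map.1 hx
      exact ⟨b, rfl⟩
    have hd : Disjoint D.ground (D₂.map (copyName a)).ground := by
      rw [Finset.disjoint_right]
      intro x hx
      obtain ⟨b, rfl⟩ := hmem x hx
      exact hout a List.mem_cons_self b
    have hfree' : IsFree (fun φ : α ⊕ α × β → Fin 3 => n₂ (φ ∘ copyName a)) (copyName a e) := by
      intro k
      obtain ⟨φ, h0, hk⟩ := hfree k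
      refine ⟨extend (copyName a) φ fun _ => 0, ?_, ?_⟩
      · dsimp only
        rw [extend_comp (copyName a).injective, h0]
      · rw [(copyName a).injective.extend_apply, hk]
    have ha := hin a List.mem_cons_self
    have hts := h.twoSum (h₂.map (copyName a)) ha hc hd hfree'
    have hg := h.twoSum_ground (h₂.map (copyName a)) ha hc hd
    rw [List.foldl_cons, ih (List.nodup_cons.1 hl).2 _ hts, ← substList_cons]
    · congr 1
      refine h.Q_twoSum (h₂.map (copyName a)) ha hc hd hfree' _ (substList_t _ _) ?_ ?_
      · rintro (b | b) hb hba k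
        · rw [substList_inl, if_neg (by simpa using hba)]
        · exact substList_inr _ _ _ _
      · intro k
        rw [substList_inl, if_pos (List.mem_singleton.2 rfl)]
        exact (slackPoly_map (copyName a) D₂.ground e k).symm
    · intro b hb
      rw [hg]
      refine Finset.mem_union_left _ (Finset.mem_erase.2 ⟨?_, hin b (List.mem_cons_of_mem a hb)⟩)
      exact fun hc => ne_of_mem_of_not_mem hb hal (Sum.inl.inj hc)
    · intro b hb c hc
      rw [hg] at hc
      rcases Finset.mem_union.1 hc with hc | hc
      · exact hout b (List.mem_cons_of_mem a hb) c (Finset.mem_of_mem_erase hc)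
      · obtain ⟨d, hd⟩ := hmem _ (Finset.mem_of_mem_erase hc)
        exact ne_of_mem_of_not_mem hb hal (Prod.mk.inj (Sum.inr.inj hd)).1

end SetFamily

end Tensor

/-! ### The main theorem -/

theorem theorem5p3 {α β : Type*} [DecidableEq α] [DecidableEq β]
    (D₁ : SetFamily α) (D₂ : SetFamily β) (e : β)
    (h₁ : D₁.IsVfSafe) (hns₁ : ∀ a ∈ D₁.ground, ¬ D₁.IsSingular a)
    (h₂ : D₂.IsVfSafe) (he : e ∈ D₂.ground) (hns₂ : ¬ D₂.IsSingular e) :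
    ∃ p q r : TPoly β,
      TransitionSystem D₂ e p q r ∧
      (∀ p' q' r' : TPoly β, TransitionSystem D₂ e p' q' r' → p' = p ∧ q' = q ∧ r' = r) ∧
      ∀ l : List α, l.Nodup → l.toFinset = D₁.ground →
        (D₁.tensor D₂ e l).Q = psi p q r D₁.Q := by

  obtain ⟨n₁, hn₁⟩ := h₁.exists_hasNullity
  obtain ⟨n₂, hn₂⟩ := h₂.exists_hasNullity
  have hfree := hn₂.isFree he hns₂
  have hsys := hn₂.transitionSystem he hfree
  refine ⟨_, _, _, hsys, fun p' q' r' h' => transitionSystem_unique hsys h', fun l hl hlE => ?_⟩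
  have hmem : ∀ a, a ∈ l ↔ a ∈ D₁.ground := fun a => by rw [← hlE, List.mem_toFinset]
  have hm := hn₁.map (Function.Embedding.inl (β := α × β))
  unfold SetFamily.tensor
  rw [SetFamily.Q_foldl_twoSum hn₂ he hfree l hl _ hm, hm.Q_eq, hn₁.Q_eq, map_tripartitionSum,
    map_tripartitionSum]
  -- Both sides are state sums once the renaming by `inl` is undone. Since `l` exhausts the ground
  -- set, `substList` and `psi` give the same weight at every element.
  · refine (tripartitionSum_map Function.Embedding.inl D₁.ground _ fun φ =>
      substList (slackPoly D₂.ground n₂ e) l (MvPolynomial.X TVar.t ^ n₁ φ)).trans ?_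
    refine tripartitionSum_congr (fun a ha k => ?_) fun P _ => ?_
    · refine (substList_inl _ l a k).trans ?_
      rw [if_pos ((hmem a).2 ha)]
      have hk : k = 0 ∨ k = 1 ∨ k = 2 := by revert k; decide
      rcases hk with rfl | rfl | rfl <;> simp [psi, stateWeight, stateVar]
    · rw [map_pow, map_pow, substList_t]
      simp [psi]
  · intro a ha
    exact Finset.mem_map_of_mem _ ((hmem a).1 ha)
  · intro a _ b hb
    obtain ⟨c, -, hc⟩ := Finset.mem_map.1 hb
    cases hc
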